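/- Let $n \ge 2$, let $I=[a,b]$ with $a<b$, and let $\gamma : I \to \mathbb{R}^n$ be a smooth non-degenerate curve, i.e. there is $c_0>0$ with $|\det(\gamma'(s),\dots,\gamma^{(n)}(s))| \ge c_0$ for all $s\in I$. Let $\chi\in C^\infty(\mathbb{R})$ be a real-valued bump function supported in the interior of $I$. For $t>0$ define the measure $\mu_t$ by $\langle \mu_t,g\rangle=\int_{\mathbb{R}} g(t\gamma(s))\chi(s)\,ds$, and assume that $\mu_1\neq 0$ (this holds, for instance, if $\chi\ge 0$ and $\chi\not\equiv 0$). Let $A_tf(x)=\mu_t*f(x)=\int_{\mathbb{R}} f(x-t\gamma(s))\chi(s)\,ds$. Let $2\le p\le\infty$ and $\sigma\in\mathbb{R}$, and let $L^p_\sigma(\mathbb{R}^n)$ be the Bessel potential space, with norm $\|g\|_{L^p_\sigma}=\|(1-(2\pi)^{-2}\Delta)^{\sigma/2}g\|_{L^p}$ (equivalent to the norm with $1-\Delta$). Suppose that there is a constant $C$ such that $$\Big(\int_1^2\|A_tf\|_{L^p_\sigma(\mathbb{R}^n)}^p\,dt\Big)^{1/p}\le C\,\|f\|_{L^p(\mathbb{R}^n)}$$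 for all Schwartz functions $f$ on $\mathbb{R}^n$ (for $p=\infty$ the left-hand side is the essential supremum over $t \in [1,2]$ of $\|A_tf\|_{L^\infty_\sigma}$). Then $$\sigma\le\min\Big\{\frac1n,\ \frac1n\Big(\frac12+\frac2p\Big),\ \frac2p\Big\},$$ where $2/p=0$ if $p=\infty$. -/

import Mathlib

open MeasureTheory Set
open scoped ENNReal NNReal ContDiff SchwartzMap

noncomputable section

/-- A smooth curve `γ : [a, b] → ℝⁿ` is non-degenerate if
`|det (γ'(s), …, γ⁽ⁿ⁾(s))| ≥ c₀` on `[a, b]` for some constant `c₀ > 0`.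
Derivatives are taken within `[a, b]` (one-sided at the end points). -/
def IsNondegenerateCurve {n : ℕ} (a b : ℝ) (γ : ℝ → EuclideanSpace ℝ (Fin n)) : Prop :=
  ContDiffOn ℝ ∞ γ (Icc a b) ∧
    ∃ c₀ : ℝ, 0 < c₀ ∧ ∀ s ∈ Icc a b,
      c₀ ≤ |(Matrix.of fun i j : Fin n =>
        iteratedDerivWithin ((j : ℕ) + 1) γ (Icc a b) s i).det|

/-- The pairing `⟨μ_t, g⟩ = ∫ g(t γ(s)) χ(s) ds` of the measure `μ_t` on the dilated curve `t γ`
with a function `g`. -/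
def curveMeasurePairing {n : ℕ} (γ : ℝ → EuclideanSpace ℝ (Fin n)) (χ : ℝ → ℝ) (t : ℝ)
    (g : EuclideanSpace ℝ (Fin n) → ℂ) : ℂ :=
  ∫ s : ℝ, g (t • γ s) * (χ s : ℂ)

/-- The averaging operator `A_t f(x) = (μ_t * f)(x) = ∫ f(x - t γ(s)) χ(s) ds`. -/
def curveAverage {n : ℕ} (γ : ℝ → EuclideanSpace ℝ (Fin n)) (χ : ℝ → ℝ) (t : ℝ)
    (f : EuclideanSpace ℝ (Fin n) → ℂ) (x : EuclideanSpace ℝ (Fin n)) : ℂ :=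
  curveMeasurePairing γ χ t (fun y => f (x - y))

/-- The tempered distribution `u` is given by integration against the function `g`. -/
def IsGivenBy {n : ℕ} (u : 𝓢'(EuclideanSpace ℝ (Fin n), ℂ))
    (g : EuclideanSpace ℝ (Fin n) → ℂ) : Prop :=
  ∀ φ : 𝓢(EuclideanSpace ℝ (Fin n), ℂ),
    Integrable (fun x => φ x * g x) ∧ u φ = ∫ x, φ x * g x

/-- The norm of a function `g` in the Bessel potential space `L^p_σ(ℝⁿ)`: it equals `‖h‖_{L^p}` if
the tempered distribution `(1 - (2π)⁻² Δ)^{σ/2} g` is given by the function `h ∈ L^p` (which is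
then unique up to null sets), and `∞` if `g` does not belong to `L^p_σ(ℝⁿ)`.
The factor `(2π)⁻²` comes from the normalization of the Fourier transform, with which the
symbol of the operator is `(1 + |ξ|²)^{σ/2}`; it only changes the norm to an equivalent one. -/
def sobolevENorm {n : ℕ} (σ : ℝ) (p : ℝ≥0∞) (g : EuclideanSpace ℝ (Fin n) → ℂ) : ℝ≥0∞ :=
  ⨅ (u : 𝓢'(EuclideanSpace ℝ (Fin n), ℂ)) (_ : IsGivenBy u g)
    (h : EuclideanSpace ℝ (Fin n) → ℂ) (_ : MemLp h p volume)
    (_ : IsGivenBy (TemperedDistribution.besselPotential (EuclideanSpace ℝ (Fin n)) ℂ σ u) h),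
    eLpNorm h p volume

/-- The local smoothing estimate
`(∫_1^2 ‖A_t f‖_{L^p_σ}^p dt)^{1/p} ≤ C ‖f‖_{L^p}` with a constant `C` independent of `f`
(for `p = ∞` the left side is the essential supremum over `1 ≤ t ≤ 2`), as an a priori estimate
on Schwartz functions `f`. -/
def LocalSmoothingEstimate {n : ℕ} (γ : ℝ → EuclideanSpace ℝ (Fin n)) (χ : ℝ → ℝ)
    (p : ℝ≥0∞) (σ : ℝ) : Prop :=
  ∃ C : ℝ≥0, ∀ f : 𝓢(EuclideanSpace ℝ (Fin n), ℂ),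
    eLpNorm (fun t : ℝ => sobolevENorm σ p (curveAverage γ χ t f)) p
        (volume.restrict (Icc (1 : ℝ) 2)) ≤
      C * eLpNorm f p volume

end

/-!
The estimate is tested on superpositions of wave packets, and each of the three bounds for `σ` comes
from one such superposition. No asymptotics of oscillatory integrals are needed.

A packet lives on a ball of radius `1 / N` about `-γ s₀` and oscillates with frequency `l` in a
direction `θ s₀`. Non-degeneracy makes it possible to choose `θ s₀` orthogonal to
`γ'(s₀), …, γ⁽ⁿ⁻¹⁾(s₀)` (`exists_unit_normal`), so that along the curve the phase of the packet
varies by `O(l |s - s₀| ^ n)`. With `l = N ^ β` and `β < n` there is therefore no oscillation on the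
piece of the curve of length about `1 / N` that the packet sees: the pairing of `A_t` of the packet
with a test function of the same kind is as large as its size permits, up to the sign of the cutoff
`χ`. To deal with that sign (and with self-intersections of the curve), the responses are integrated
over `s₀` in an arc against a weight `ρ`. As `N → ∞` these integrals converge to `∫ χ G ∘ γ` over
the part of the curve lying on the arc (`tendsto_integral_packets`), and because `μ₁ ≠ 0` the arc,
`ρ` and `G` can be chosen with this limit nonzero (`exists_arc`). This gives the lower bound
`PacketArc.exists_sum_response_ge` for sums over `m` equally spaced packets.

The upper bounds use duality. The test function is `𝓕 H` with `H` equal to `(1 + |ξ|²)^{σ/2} Q`, so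
its pairing with `A_t f` is controlled by the Bessel norm of `A_t f` times the dual norm of `𝓕 Q`
(`enorm_integral_le_sobolevENorm`). As `Q` lives at frequencies comparable to `l`, this dual norm is
`l ^ (-σ)` times what it would be without the multiplier (`exists_bessel_testFunctions`). The
pairings are integrated over a time interval of length `w ≤ 1`.

* A single packet of frequency `N ^ β`, with a test function that travels with it for a time
  `w ≈ 1`, gives `σ ≤ 1 / n` (`le_one_div_of_localSmoothing`).
* `N` packets of frequency `2 N`, all in the same direction, with one fixed test function and
  `w ≈ 1 / N`, give `σ ≤ 2 / p` (`le_two_mul_of_localSmoothing`).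
* `N` packets of frequency `N ^ β` in the directions `θ s₀` along the arc, with fixed test functions
  and `w ≈ 1 / N`, give `σ ≤ (1 / n) (1 / 2 + 2 / p)` (`le_mul_of_localSmoothing`). Packets and test
  functions carry mutually inverse signs, which are roots of unity; averaging over
  the signs leaves only the diagonal terms and replaces the sum of the test functions by their
  square function, which costs only `N ^ (1 / 2)`.
-/

namespace CurveAverages

open Filter Topology FourierTransform

/-! ### Duality for the Bessel potential norm -/

/-- Interpolation between a pointwise bound and a bound for the `L¹` norm, for any `p ∈ [1, ∞]`; as
`∞.toReal⁻¹ = 0`, the formula is also right at `p = ∞`. -/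
theorem eLpNorm_le_interpolate {α F : Type*} [MeasurableSpace α] {μ : Measure α}
    [NormedAddCommGroup F] {f : α → F} {p : ℝ≥0∞} (hp : 1 ≤ p) {A B : ℝ} (hA : 0 < A) (hB : 0 ≤ B)
    (hfA : ∀ x, ‖f x‖ ≤ A) (hfB : ∫⁻ x, ‖f x‖ₑ ∂μ ≤ ENNReal.ofReal B) :
    eLpNorm f p μ ≤ ENNReal.ofReal (A ^ (1 - p.toReal⁻¹) * B ^ p.toReal⁻¹) := by
  rcases eq_or_ne p ⊤ with rfl | hpt
  · simp only [ENNReal.toReal_top, inv_zero, sub_zero, Real.rpow_one, Real.rpow_zero, mul_one]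
    exact eLpNormEssSup_le_of_ae_bound (Eventually.of_forall hfA)
  have hp0 : p ≠ 0 := (zero_lt_one.trans_le hp).ne'
  have hr1 : 1 ≤ p.toReal := by
    rw [← ENNReal.toReal_one]; exact ENNReal.toReal_mono hpt hp
  have hr0 : 0 < p.toReal := by linarith
  rw [eLpNorm_eq_lintegral_rpow_enorm_toReal hp0 hpt]
  have h1 : ∫⁻ x, ‖f x‖ₑ ^ p.toReal ∂μ ≤ ENNReal.ofReal (A ^ (p.toReal - 1) * B) := by
    calc ∫⁻ x, ‖f x‖ₑ ^ p.toReal ∂μ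
        ≤ ∫⁻ x, ENNReal.ofReal (A ^ (p.toReal - 1)) * ‖f x‖ₑ ∂μ := by
          refine lintegral_mono fun x => ?_
          have : p.toReal = (p.toReal - 1) + 1 := by ring
          conv_lhs => rw [this]
          rw [ENNReal.rpow_add_of_nonneg _ _ (by linarith) zero_le_one, ENNReal.rpow_one]
          gcongr
          rw [← ofReal_norm, ENNReal.ofReal_rpow_of_nonneg (norm_nonneg _) (by linarith)]
          exact ENNReal.ofReal_le_ofReal
            (Real.rpow_le_rpow (norm_nonneg _) (hfA x) (by linarith))
      _ = ENNReal.ofReal (A ^ (p.toReal - 1)) * ∫⁻ x, ‖f x‖ₑ ∂μ :=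
          lintegral_const_mul' _ _ ENNReal.ofReal_ne_top
      _ ≤ _ := by
          rw [ENNReal.ofReal_mul (by positivity)]
          gcongr
  calc (∫⁻ x, ‖f x‖ₑ ^ p.toReal ∂μ) ^ (1 / p.toReal)
      ≤ (ENNReal.ofReal (A ^ (p.toReal - 1) * B)) ^ (1 / p.toReal) := by gcongr
    _ = _ := by
      rw [ENNReal.ofReal_rpow_of_nonneg (by positivity) (by positivity),
        Real.mul_rpow (by positivity) hB, ← Real.rpow_mul hA.le, one_div, sub_mul, one_mul,
        mul_inv_cancel₀ hr0.ne']

theorem enorm_integral_mul_le {α : Type*} [MeasurableSpace α] {μ : Measure α} {p p' : ℝ≥0∞}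
    [p.HolderConjugate p'] {f g : α → ℂ} (hf : AEStronglyMeasurable f μ)
    (hg : AEStronglyMeasurable g μ) :
    ‖∫ x, f x * g x ∂μ‖ₑ ≤ eLpNorm f p μ * eLpNorm g p' μ := by
  refine (enorm_integral_le_lintegral_enorm _).trans ?_
  rw [← eLpNorm_one_eq_lintegral_enorm]
  have h := eLpNorm_smul_le_mul_eLpNorm (μ := μ) (p := p) (q := p') (r := 1) (f := g) (φ := f) hg hf
  exact h

variable {n : ℕ}

/-- The Bessel potential of a distribution, tested against a Fourier transform: the multiplier
`(1 + |ξ|²)^{σ/2}` moves to the test function. -/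
theorem besselPotential_apply_apply (σ : ℝ) (u : 𝓢'(EuclideanSpace ℝ (Fin n), ℂ))
    (Q : 𝓢(EuclideanSpace ℝ (Fin n), ℂ)) :
    TemperedDistribution.besselPotential (EuclideanSpace ℝ (Fin n)) ℂ σ u (𝓕 Q) =
      u (𝓕 (SchwartzMap.smulLeftCLM ℂ
        (fun x : EuclideanSpace ℝ (Fin n) => (((1 + ‖x‖ ^ 2) ^ (σ / 2) : ℝ) : ℂ)) Q)) := by
  simp [TemperedDistribution.besselPotential, TemperedDistribution.fourierMultiplierCLM_apply,
    TemperedDistribution.fourierInv_apply, TemperedDistribution.fourier_apply,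
    TemperedDistribution.smulLeftCLM_apply_apply]

/-- Duality for the Bessel potential norm: a pairing with the Fourier transform of
`H = (1 + |ξ|²)^{σ/2} Q` is at most the norm in `L^p_σ` times a bound `D` for the dual norm of
`𝓕 Q`. In the form of a quotient the bound needs no case distinction when the norm in `L^p_σ` is
infinite. -/
theorem enorm_integral_le_sobolevENorm {σ : ℝ} {p p' : ℝ≥0∞} [p.HolderConjugate p']
    (g : EuclideanSpace ℝ (Fin n) → ℂ) (Q H : 𝓢(EuclideanSpace ℝ (Fin n), ℂ))
    (hQH : ∀ x, H x = (((1 + ‖x‖ ^ 2) ^ (σ / 2) : ℝ) : ℂ) * Q x)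
    {D : ℝ≥0∞}
    (hD : eLpNorm (𝓕 Q : 𝓢(EuclideanSpace ℝ (Fin n), ℂ)) p' volume ≤ D) :
    ‖∫ x, (𝓕 H : 𝓢(EuclideanSpace ℝ (Fin n), ℂ)) x * g x‖ₑ / D ≤ sobolevENorm σ p g := by
  rw [sobolevENorm]
  refine le_iInf fun u => le_iInf fun hu => le_iInf fun h => le_iInf fun hh => le_iInf fun huh => ?_
  have e : SchwartzMap.smulLeftCLM ℂ
        (fun x : EuclideanSpace ℝ (Fin n) => (((1 + ‖x‖ ^ 2) ^ (σ / 2) : ℝ) : ℂ)) Q = H := by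
    ext x
    rw [SchwartzMap.smulLeftCLM_apply_apply (by fun_prop), hQH, smul_eq_mul]
  have h1 := besselPotential_apply_apply σ u Q
  rw [e, (hu _).2, (huh _).2] at h1
  rw [← h1]
  refine ENNReal.div_le_of_le_mul ?_
  have : ∀ x, (𝓕 Q : 𝓢(EuclideanSpace ℝ (Fin n), ℂ)) x * h x =
    h x * (𝓕 Q : 𝓢(EuclideanSpace ℝ (Fin n), ℂ)) x := fun x => mul_comm _ _
  simp_rw [this]
  refine (enorm_integral_mul_le (p := p) (p' := p') hh.1
    (SchwartzMap.continuous _).aestronglyMeasurable).trans ?_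
  gcongr

/-- The local smoothing estimate tested, at each time `t`, against the Fourier transform of `H t`.
Hölder in `t` is applied as Cauchy–Schwarz followed by the comparison of `L²` and `L^p` on `S`, so
that only the mean square of the dual norms `D t` enters: this is what the averaging over signs
controls. -/
theorem lintegral_enorm_pairing_le {γ : ℝ → EuclideanSpace ℝ (Fin n)} {χ : ℝ → ℝ}
    {σ : ℝ} {p p' : ℝ≥0∞} (hp : 2 ≤ p) [p.HolderConjugate p'] {C : ℝ≥0}
    {f : 𝓢(EuclideanSpace ℝ (Fin n), ℂ)}
    (hC : eLpNorm (fun t : ℝ => sobolevENorm σ p (curveAverage γ χ t f)) p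
        (volume.restrict (Icc (1 : ℝ) 2)) ≤ C * eLpNorm f p volume)
    {S : Set ℝ} (hS : S ⊆ Icc 1 2) (hSm : MeasurableSet S)
    (Q H : ℝ → 𝓢(EuclideanSpace ℝ (Fin n), ℂ))
    (hQH : ∀ t x, H t x = (((1 + ‖x‖ ^ 2) ^ (σ / 2) : ℝ) : ℂ) * Q t x)
    {D : ℝ → ℝ≥0∞} (hDm : Measurable D) (hD0 : ∀ t, D t ≠ 0) (hDt : ∀ t, D t ≠ ⊤)
    (hD : ∀ t ∈ S, eLpNorm (𝓕 (Q t) : 𝓢(EuclideanSpace ℝ (Fin n), ℂ)) p' volume ≤ D t)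
    {G : ℝ → ℂ} (hG : Measurable G)
    (hGt : ∀ t ∈ S, G t = ∫ x, (𝓕 (H t) : 𝓢(EuclideanSpace ℝ (Fin n), ℂ)) x *
      curveAverage γ χ t f x) :
    ∫⁻ t in S, ‖G t‖ₑ ≤ (∫⁻ t in S, D t ^ 2) ^ (1 / 2 : ℝ) *
      (C * eLpNorm f p volume * (volume S) ^ (1 / 2 - p.toReal⁻¹)) := by
  have h1 : eLpNorm (fun t => ‖G t‖ₑ / D t) p (volume.restrict S) ≤ C * eLpNorm f p volume := by
    calc eLpNorm (fun t => ‖G t‖ₑ / D t) p (volume.restrict S)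
        ≤ eLpNorm (fun t : ℝ => sobolevENorm σ p (curveAverage γ χ t f)) p
            (volume.restrict S) := by
          refine eLpNorm_mono_enorm_ae ?_
          refine (ae_restrict_iff' hSm).2 (Eventually.of_forall fun t ht => ?_)
          simp only [enorm_eq_self]
          rw [hGt t ht]
          exact enorm_integral_le_sobolevENorm _ (Q t) (H t) (hQH t) (hD t ht)
      _ ≤ _ := (eLpNorm_mono_measure _ (Measure.restrict_mono hS le_rfl)).trans hC
  have hmeas : Measurable fun t => ‖G t‖ₑ / D t := by fun_prop
  have h2 : (∫⁻ t in S, (‖G t‖ₑ / D t) ^ (2 : ℝ)) ^ (1 / 2 : ℝ) ≤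
      C * eLpNorm f p volume * (volume S) ^ (1 / 2 - p.toReal⁻¹) := by
    have := eLpNorm_le_eLpNorm_mul_rpow_measure_univ (μ := volume.restrict S) (p := 2) (q := p) hp
      (f := fun t => ‖G t‖ₑ / D t) hmeas.aestronglyMeasurable
    rw [eLpNorm_eq_lintegral_rpow_enorm_toReal two_ne_zero ENNReal.ofNat_ne_top] at this
    simp only [enorm_eq_self, ENNReal.toReal_ofNat, one_div, Measure.restrict_apply_univ]
      at this ⊢
    exact this.trans (by gcongr)
  calc ∫⁻ t in S, ‖G t‖ₑ = ∫⁻ t in S, (D * fun t => ‖G t‖ₑ / D t) t := by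
        congr 1 with t; rw [Pi.mul_apply, ENNReal.mul_div_cancel (hD0 t) (hDt t)]
    _ ≤ (∫⁻ t in S, D t ^ (2 : ℝ)) ^ (1 / 2 : ℝ) *
        (∫⁻ t in S, (‖G t‖ₑ / D t) ^ (2 : ℝ)) ^ (1 / 2 : ℝ) :=
      ENNReal.lintegral_mul_le_Lp_mul_Lq _ Real.HolderConjugate.two_two hDm.aemeasurable
        hmeas.aemeasurable
    _ ≤ _ := by
      simp only [ENNReal.rpow_ofNat] at h2 ⊢
      gcongr

/-! ### Test functions and packets at a given frequency -/

section TestFunctions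

variable {E : Type*} [NormedAddCommGroup E] [InnerProductSpace ℝ E] [FiniteDimensional ℝ E]
  [MeasurableSpace E] [BorelSpace E]

/-- A window of compact support with nonnegative Fourier transform: the convolution square of an
even bump function, whose Fourier transform is the square of a real function. -/
theorem exists_fourier_nonneg :
    ∃ (η : E → ℂ) (Ψ : E → ℝ), ContDiff ℝ ∞ η ∧ tsupport η ⊆ Metric.closedBall 0 1 ∧
      (∀ x, 𝓕 η x = (Ψ x : ℂ)) ∧ Continuous Ψ ∧ (∀ x, 0 ≤ Ψ x) ∧ 0 < Ψ 0 := by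
  let b : ContDiffBump (0 : E) := ⟨1 / 4, 1 / 2, by norm_num, by norm_num⟩
  let B : E → ℂ := fun x => (b x : ℂ)
  have hBc : Continuous B := Complex.continuous_ofReal.comp b.continuous
  have hBs : HasCompactSupport B := b.hasCompactSupport.comp_left (g := fun r : ℝ => (r : ℂ)) rfl
  have hBi : Integrable B := hBc.integrable_of_hasCompactSupport hBs
  have hBd : ContDiff ℝ ∞ B := Complex.ofRealCLM.contDiff.comp b.contDiff
  have hreal : ∀ ξ, (starRingEnd ℂ) (𝓕 B ξ) = 𝓕 B ξ := by
    intro ξ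
    rw [Real.fourier_eq, ← integral_conj, ← integral_neg_eq_self]
    congr 1 with x
    simp only [Circle.smul_def, smul_eq_mul, map_mul, inner_neg_left, neg_neg]
    congr 1
    · rw [← Circle.coe_inv_eq_conj, ← AddChar.map_neg_eq_inv]
    · simp only [B, b.neg]; exact Complex.conj_ofReal _
  have hre : ∀ ξ, 𝓕 B ξ = ((𝓕 B ξ).re : ℂ) := fun ξ => (Complex.conj_eq_iff_re.1 (hreal ξ)).symm
  have hF : Continuous (𝓕 B) := VectorFourier.fourierIntegral_continuous
    Real.continuous_fourierChar (by exact continuous_inner) hBi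
  refine ⟨convolution B B (ContinuousLinearMap.mul ℂ ℂ) volume, fun ξ => (𝓕 B ξ).re ^ 2,
    ?_, ?_, ?_, ?_, fun x => sq_nonneg _, ?_⟩
  · have := hBs.contDiff_convolution_left (μ := volume) (L := (ContinuousLinearMap.mul ℝ ℂ))
      (n := ⊤) hBd hBc.locallyIntegrable
    exact this
  · refine closure_minimal ?_ Metric.isClosed_closedBall
    refine (support_convolution_subset (L := ContinuousLinearMap.mul ℂ ℂ)).trans ?_
    have hs : Function.support B ⊆ Metric.ball 0 (1 / 2) := by
      intro x hx
      have : x ∈ Function.support b := by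
        simpa [B] using hx
      rwa [b.support_eq] at this
    rintro x ⟨y, hy, z, hz, rfl⟩
    have h1 := hs hy
    have h2 := hs hz
    simp only [Metric.mem_ball, dist_zero_right, Metric.mem_closedBall] at *
    exact (norm_add_le y z).trans (by linarith)
  · intro ξ
    rw [Real.fourier_mul_convolution_eq hBi hBi, hre ξ]
    push_cast; ring
  · exact (Complex.continuous_re.comp hF).pow 2
  · have h0 : (𝓕 B 0).re = ∫ x, b x := by
      rw [Real.fourier_eq]
      simp only [inner_zero_right, neg_zero, AddChar.map_zero_eq_one, one_smul]
      rw [← RCLike.re_eq_complex_re, ← integral_re hBi]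
      simp [B]
    have : 0 < ∫ x, b x := b.integral_pos
    show 0 < (𝓕 B 0).re ^ 2
    rw [h0]; positivity

/-- Decay of the Fourier transform of a smooth function supported in the unit ball, with a constant
that depends on the function only through the bounds for its first `M` derivatives. -/
theorem exists_decay_fourier_of_iteratedFDeriv_le (M : ℕ) :
    ∃ C : ℝ, 0 < C ∧ ∀ (K : E → ℂ) (B : ℝ), ContDiff ℝ ∞ K → 0 ≤ B →
      tsupport K ⊆ Metric.closedBall 0 1 →
      (∀ j ≤ M, ∀ x, ‖iteratedFDeriv ℝ j K x‖ ≤ B) →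
      ∀ w, (1 + ‖w‖) ^ M * ‖𝓕 K w‖ ≤ C * B := by
  set V : ℝ := volume.real (Metric.closedBall (0 : E) 1) with hV
  have key : ∀ m ≤ M, ∀ (K : E → ℂ) (B : ℝ), ContDiff ℝ ∞ K → 0 ≤ B →
      tsupport K ⊆ Metric.closedBall 0 1 →
      (∀ j ≤ M, ∀ x, ‖iteratedFDeriv ℝ j K x‖ ≤ B) →
      ∀ w, ‖w‖ ^ m * ‖𝓕 K w‖ ≤ 2 ^ m * ((m + 1) * (B * V)) := by
    intro m hm K B hK hB hs hb w
    have hcs : HasCompactSupport K := (isCompact_closedBall 0 1).of_isClosed_subset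
      (isClosed_tsupport K) hs
    have hint : ∀ k j : ℕ, Integrable (fun v => ‖v‖ ^ k * ‖iteratedFDeriv ℝ j K v‖) := by
      intro k j
      refine Continuous.integrable_of_hasCompactSupport ?_ ?_
      · exact (continuous_norm.pow k).mul
          (hK.continuous_iteratedFDeriv (by exact_mod_cast le_top)).norm
      · exact (hcs.iteratedFDeriv j).norm.mul_left
    have := Real.pow_mul_norm_iteratedFDeriv_fourier_le (K := ⊤) (N := ⊤) (f := K) hK
      (fun k j _ _ => hint k j) (k := 0) (n := m) le_top le_top w
    rw [norm_iteratedFDeriv_zero] at this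
    refine this.trans ?_
    simp only [pow_zero, Nat.cast_zero, mul_zero, zero_add, one_mul, Finset.range_one]
    gcongr
    calc ∑ p ∈ ({0} : Finset ℕ) ×ˢ Finset.range (m + 1), ∫ v, ‖v‖ ^ p.1 * ‖iteratedFDeriv ℝ p.2 K v‖
        ≤ ∑ p ∈ ({0} : Finset ℕ) ×ˢ Finset.range (m + 1), B * V := by
          refine Finset.sum_le_sum fun p hp => ?_
          simp only [Finset.mem_product, Finset.mem_singleton, Finset.mem_range] at hp
          rw [hp.1]
          simp only [pow_zero, one_mul]
          have hsub : Function.support (fun v => ‖iteratedFDeriv ℝ p.2 K v‖) ⊆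
              Metric.closedBall 0 1 := by
            intro v hv
            refine hs (tsupport_iteratedFDeriv_subset (𝕜 := ℝ) p.2 (subset_tsupport _ ?_))
            simpa using hv
          rw [← setIntegral_eq_integral_of_forall_compl_eq_zero
            (s := Metric.closedBall 0 1) (fun v hv => by
              by_contra h; exact hv (hsub h))]
          have := norm_setIntegral_le_of_norm_le_const (μ := volume)
            (s := Metric.closedBall (0 : E) 1)
            (f := fun v => ‖iteratedFDeriv ℝ p.2 K v‖) (C := B) measure_closedBall_lt_top
            (fun v _ => by simpa using hb p.2 (by omega) v)
          exact (Real.le_norm_self _).trans this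
      _ = (m + 1) * (B * V) := by simp
  refine ⟨2 ^ M * (2 ^ M * ((M + 1) * V) + V + 1), by positivity, ?_⟩
  intro K B hK hB hs hb w
  have h0 := key 0 (Nat.zero_le _) K B hK hB hs hb w
  have hM := key M le_rfl K B hK hB hs hb w
  have h1 : (1 + ‖w‖) ^ M ≤ 2 ^ M * (1 + ‖w‖ ^ M) := by
    calc (1 + ‖w‖) ^ M ≤ (2 * max 1 ‖w‖) ^ M := by
          gcongr
          linarith [le_max_left 1 ‖w‖, le_max_right 1 ‖w‖]
      _ = 2 ^ M * (max 1 ‖w‖) ^ M := mul_pow _ _ _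
      _ ≤ 2 ^ M * (1 + ‖w‖ ^ M) := by
          gcongr
          rcases max_cases 1 ‖w‖ with h | h
          · rw [h.1]; simp
          · rw [h.1]; simp
  simp only [pow_zero, Nat.cast_zero, zero_add, one_mul] at h0
  calc (1 + ‖w‖) ^ M * ‖𝓕 K w‖ ≤ 2 ^ M * (1 + ‖w‖ ^ M) * ‖𝓕 K w‖ := by gcongr
    _ = 2 ^ M * (‖𝓕 K w‖ + ‖w‖ ^ M * ‖𝓕 K w‖) := by ring
    _ ≤ 2 ^ M * (B * V + 2 ^ M * ((M + 1) * (B * V))) := by gcongr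
    _ ≤ 2 ^ M * (2 ^ M * ((M + 1) * V) + V + 1) * B := by
      have : 0 ≤ 2 ^ M * B := by positivity
      nlinarith

omit [MeasurableSpace E] [BorelSpace E] in
/-- The function `(e² + |v|²) ^ σ`, cut off smoothly to a compact region away from the origin. Since
`1 + |ξ|² = l² (l⁻² + |l⁻¹ ξ|²)`, it describes powers of `1 + |ξ|²` for `|ξ|` comparable to `l`;
with `e = l⁻¹` as a variable all bounds are uniform in `l`. -/
theorem exists_smooth_power (σ : ℝ) :
    ∃ W : ℝ × E → ℂ, ContDiff ℝ ∞ W ∧ HasCompactSupport W ∧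
      ∀ e v, 1 / 4 ≤ e ^ 2 + ‖v‖ ^ 2 → e ^ 2 + ‖v‖ ^ 2 ≤ 13 / 4 →
        W (e, v) = (((e ^ 2 + ‖v‖ ^ 2) ^ σ : ℝ) : ℂ) := by
  let b : ContDiffBump (2 : ℝ) := ⟨7 / 4, 15 / 8, by norm_num, by norm_num⟩
  let G : ℝ → ℝ := fun u => b u * u ^ σ
  have hG : ContDiff ℝ ∞ G := by
    rw [contDiff_iff_contDiffAt]
    intro u
    rcases lt_or_ge u (1 / 8) with hu | hu
    · refine (contDiffAt_const (c := (0 : ℝ))).congr_of_eventuallyEq ?_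
      filter_upwards [Iio_mem_nhds hu] with v hv
      have : b v = 0 := by
        refine b.zero_of_le_dist ?_
        rw [Real.dist_eq, abs_of_nonpos (by simp only [mem_Iio] at hv; linarith)]
        simp only [mem_Iio] at hv
        show (15 / 8 : ℝ) ≤ _
        linarith
      simp [G, this]
    · exact b.contDiffAt.mul (Real.contDiffAt_rpow_const_of_ne (by linarith))
  have hq : ContDiff ℝ ∞ (fun w : ℝ × E => w.1 ^ 2 + ‖w.2‖ ^ 2) :=
    (contDiff_fst.pow 2).add (contDiff_snd.norm_sq ℝ)
  refine ⟨fun w => (G (w.1 ^ 2 + ‖w.2‖ ^ 2) : ℂ), Complex.ofRealCLM.contDiff.comp (hG.comp hq),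
    ?_, ?_⟩
  · refine HasCompactSupport.intro (isCompact_closedBall (0 : ℝ × E) 2) fun w hw => ?_
    have h1 : 2 < ‖w‖ := by simpa using hw
    have h2 : 4 ≤ w.1 ^ 2 + ‖w.2‖ ^ 2 := by
      rw [Prod.norm_def, lt_max_iff, Real.norm_eq_abs] at h1
      rcases h1 with h | h
      · have : 4 < w.1 ^ 2 := by rw [← sq_abs]; nlinarith
        nlinarith [sq_nonneg ‖w.2‖]
      · nlinarith [sq_nonneg w.1]
    have : b (w.1 ^ 2 + ‖w.2‖ ^ 2) = 0 := by
      refine b.zero_of_le_dist ?_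
      rw [Real.dist_eq, abs_of_nonneg (by linarith)]
      show (15 / 8 : ℝ) ≤ _
      linarith
    simp [G, this]
  · intro e v h1 h2
    have : b (e ^ 2 + ‖v‖ ^ 2) = 1 := by
      refine b.one_of_mem_closedBall ?_
      rw [Metric.mem_closedBall, Real.dist_eq, abs_le]
      show -(7 / 4 : ℝ) ≤ _ ∧ _ ≤ (7 / 4 : ℝ)
      constructor <;> linarith
    simp [G, this]

omit [MeasurableSpace E] [BorelSpace E] in
/-- The derivatives of `η ζ * W (e, v + r ζ)` in `ζ` are bounded uniformly in the parameters `e`,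
`v` and `|r| ≤ 1`. -/
theorem exists_iteratedFDeriv_mul_le {η : E → ℂ} (hη : ContDiff ℝ ∞ η)
    (hηs : tsupport η ⊆ Metric.closedBall 0 1) {W : ℝ × E → ℂ} (hW : ContDiff ℝ ∞ W)
    (hWs : HasCompactSupport W) (M : ℕ) :
    ∃ B : ℝ, 0 ≤ B ∧ ∀ (e r : ℝ) (v : E), |r| ≤ 1 → ∀ j ≤ M, ∀ x,
      ‖iteratedFDeriv ℝ j (fun ζ => η ζ * W (e, v + r • ζ)) x‖ ≤ B := by
  have hηc : HasCompactSupport η := (isCompact_closedBall 0 1).of_isClosed_subset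
    (isClosed_tsupport η) hηs
  have hb : ∀ j : ℕ, ∃ A : ℝ, ∀ x, ‖iteratedFDeriv ℝ j η x‖ ≤ A := fun j =>
    (hη.continuous_iteratedFDeriv (by exact_mod_cast le_top)).bounded_above_of_compact_support
      (hηc.iteratedFDeriv j)
  have hw : ∀ j : ℕ, ∃ A : ℝ, ∀ x, ‖iteratedFDeriv ℝ j W x‖ ≤ A := fun j =>
    (hW.continuous_iteratedFDeriv (by exact_mod_cast le_top)).bounded_above_of_compact_support
      (hWs.iteratedFDeriv j)
  choose A hA using hb
  choose A' hA' using hw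
  have hA0 : ∀ j, 0 ≤ A j := fun j => (norm_nonneg _).trans (hA j 0)
  have hA0' : ∀ j, 0 ≤ A' j := fun j => (norm_nonneg _).trans (hA' j 0)
  have hterm : ∀ j i : ℕ, 0 ≤ (j.choose i : ℝ) * A i * A' (j - i) := fun j i => by
    have := hA0 i; have := hA0' (j - i); positivity
  refine ⟨∑ j ∈ Finset.range (M + 1), ∑ i ∈ Finset.range (j + 1),
    (j.choose i : ℝ) * A i * A' (j - i), Finset.sum_nonneg fun j _ => Finset.sum_nonneg fun i _ =>
      hterm j i, ?_⟩
  intro e r v hr j hj x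
  let L : E →L[ℝ] ℝ × E := (ContinuousLinearMap.inr ℝ ℝ E).comp (r • ContinuousLinearMap.id ℝ E)
  have hL : ‖L‖ ≤ 1 := by
    refine ContinuousLinearMap.opNorm_le_bound _ zero_le_one fun ζ => ?_
    simp only [L, ContinuousLinearMap.comp_apply, ContinuousLinearMap.inr_apply, Prod.norm_def]
    simp [norm_smul]
    exact mul_le_of_le_one_left (norm_nonneg _) hr
  have hfun : (fun ζ => W (e, v + r • ζ)) = (fun w => W ((e, v) + w)) ∘ L := by
    ext ζ; simp [L]
  have hWt : ContDiff ℝ ∞ (fun w => W ((e, v) + w)) := hW.comp (contDiff_const.add contDiff_id)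
  have hWL : ContDiff ℝ ∞ (fun ζ => W (e, v + r • ζ)) := by
    rw [hfun]; exact hWt.comp L.contDiff
  have hd : ∀ i, ‖iteratedFDeriv ℝ i (fun ζ => W (e, v + r • ζ)) x‖ ≤ A' i := by
    intro i
    rw [hfun, L.iteratedFDeriv_comp_right hWt x (by exact_mod_cast le_top),
      iteratedFDeriv_comp_add_left]
    refine (ContinuousMultilinearMap.norm_compContinuousLinearMap_le _ _).trans ?_
    rw [Finset.prod_const]
    calc _ ≤ A' i * 1 := by
          gcongr
          · exact hA0' i
          · exact hA' i _
          · exact pow_le_one₀ (norm_nonneg _) hL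
      _ = A' i := mul_one _
  calc _ ≤ ∑ i ∈ Finset.range (j + 1), (j.choose i : ℝ) * ‖iteratedFDeriv ℝ i η x‖ *
        ‖iteratedFDeriv ℝ (j - i) (fun ζ => W (e, v + r • ζ)) x‖ :=
        norm_iteratedFDeriv_mul_le (n := j) hη hWL x (by exact_mod_cast le_top)
    _ ≤ ∑ i ∈ Finset.range (j + 1), (j.choose i : ℝ) * A i * A' (j - i) := by
        gcongr with i hi
        · have := hA0 i; positivity
        · exact hA i x
        · exact hd _
    _ ≤ _ := Finset.single_le_sum (f := fun j => ∑ i ∈ Finset.range (j + 1),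
        (j.choose i : ℝ) * A i * A' (j - i))
        (fun j _ => Finset.sum_nonneg fun i _ => hterm j i) (Finset.mem_range.2 (by omega))

theorem integral_dilate (g : E → ℂ) (v : E) {N : ℝ} (hN : 0 < N) :
    ∫ ξ, ((N ^ Module.finrank ℝ E)⁻¹ : ℝ) • g ξ = ∫ ζ, g (v + N • ζ) := by
  have h1 : ∫ ζ, g (v + N • ζ) = ∫ ζ, (fun w => g (v + w)) (N • ζ) := rfl
  rw [h1, Measure.integral_comp_smul volume (fun w => g (v + w)) N, abs_of_nonneg (by positivity),
    integral_smul, integral_add_left_eq_self (fun w => g w) v]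

/-- The Fourier transform of a function that is dilated by `N`, centred at the frequency `v` and
modulated by `a`: a packet of frequency `-v` at scale `N⁻¹` about `a`. -/
theorem fourier_modulate_dilate (K : E → ℂ) (a v : E) {N : ℝ} (hN : 0 < N) (x : E) :
    𝓕 (fun ξ => ((N ^ Module.finrank ℝ E)⁻¹ : ℝ) •
      ((Real.fourierChar (inner ℝ a ξ) : ℂ) * K (N⁻¹ • (ξ - v)))) x =
    (Real.fourierChar (-inner ℝ v (x - a)) : ℂ) * 𝓕 K (N • (x - a)) := by
  rw [Real.fourier_eq, Real.fourier_eq, ← integral_const_mul]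
  have : ∀ ξ : E, Real.fourierChar (-inner ℝ ξ x) • (((N ^ Module.finrank ℝ E)⁻¹ : ℝ) •
      ((Real.fourierChar (inner ℝ a ξ) : ℂ) * K (N⁻¹ • (ξ - v)))) =
      ((N ^ Module.finrank ℝ E)⁻¹ : ℝ) • ((fun ξ => (Real.fourierChar (-inner ℝ ξ (x - a)) : ℂ) *
        K (N⁻¹ • (ξ - v))) ξ) := by
    intro ξ
    have e : Real.fourierChar (-inner ℝ ξ (x - a)) =
        Real.fourierChar (-inner ℝ ξ x) * Real.fourierChar (inner ℝ a ξ) := by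
      rw [← AddChar.map_add_eq_mul, inner_sub_right, real_inner_comm a ξ]
      congr 1; ring
    simp only [Circle.smul_def, smul_eq_mul, Complex.real_smul, e, Circle.coe_mul]
    ring
  simp_rw [this]
  rw [integral_dilate _ v hN]
  congr 1 with ζ
  have h2 : N⁻¹ • (v + N • ζ - v) = ζ := by
    rw [add_sub_cancel_left, smul_smul, inv_mul_cancel₀ hN.ne', one_smul]
  simp only [h2, Circle.smul_def, smul_eq_mul, ← mul_assoc]
  congr 1
  rw [← Circle.coe_mul, ← AddChar.map_add_eq_mul, inner_add_left, inner_smul_left,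
    inner_smul_right]
  simp [add_comm]

/-- The test functions. `𝓕 H` is a packet of frequency `-l θ` at scale `N⁻¹` about `a`, and
`H = (1 + |ξ|²)^{σ/2} Q`. Since `H` is supported in the ball of radius `N ≤ l / 2` about `l θ`,
where `(1 + |ξ|²)^{-σ/2}` is `l ^ (-σ)` times a function which is smooth at scale `l`, the function
`𝓕 Q` obeys the bounds of a packet, up to the factor `l ^ (-σ)`. -/
theorem exists_bessel_testFunctions {η : E → ℂ} (hη : ContDiff ℝ ∞ η)
    (hηs : tsupport η ⊆ Metric.closedBall 0 1) (σ : ℝ) (M : ℕ) :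
    ∃ C : ℝ, 0 < C ∧ ∀ (l N : ℝ) (θ a : E), 1 ≤ l → 0 < N → 2 * N ≤ l → ‖θ‖ = 1 →
      ∃ Q H : 𝓢(E, ℂ), (∀ ξ, H ξ = (((1 + ‖ξ‖ ^ 2) ^ (σ / 2) : ℝ) : ℂ) * Q ξ) ∧
        (∀ x, 𝓕 H x = (Real.fourierChar (-(l * inner ℝ θ (x - a))) : ℂ) * 𝓕 η (N • (x - a))) ∧
        (∀ x, (1 + N * ‖x - a‖) ^ M * ‖𝓕 Q x‖ ≤ C * l ^ (-σ)) := by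
  obtain ⟨W, hW, hWs, hWe⟩ := exists_smooth_power (E := E) (-σ / 2)
  obtain ⟨B, hB0, hB⟩ := exists_iteratedFDeriv_mul_le hη hηs hW hWs M
  obtain ⟨C, hC0, hC⟩ := exists_decay_fourier_of_iteratedFDeriv_le (E := E) M
  have hηc : HasCompactSupport η := (isCompact_closedBall 0 1).of_isClosed_subset
    (isClosed_tsupport η) hηs
  refine ⟨C * B + 1, by positivity, ?_⟩
  intro l N θ a hl hN hNl hθ
  have hl0 : 0 < l := by linarith
  -- after rescaling by `ξ = l (θ + l⁻¹ N ζ)` the multiplier is `l ^ (-σ)` times a smooth function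
  set K : E → ℂ := fun ζ => η ζ * W (l⁻¹, θ + (l⁻¹ * N) • ζ) with hK
  have hKd : ContDiff ℝ ∞ K := by
    refine hη.mul (hW.comp ?_)
    exact contDiff_const.prodMk (contDiff_const.add (contDiff_id.const_smul _))
  have hKs : tsupport K ⊆ Metric.closedBall 0 1 :=
    (closure_mono (fun x hx => left_ne_zero_of_mul hx)).trans hηs
  have hKc : HasCompactSupport K := (isCompact_closedBall 0 1).of_isClosed_subset
    (isClosed_tsupport K) hKs
  have hr : |l⁻¹ * N| ≤ 1 / 2 := by
    rw [abs_of_pos (by positivity), inv_mul_eq_div, div_le_iff₀ hl0]; linarith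
  -- dilated, modulated copies of compactly supported smooth functions are Schwartz
  have hmk : ∀ k : E → ℂ, ContDiff ℝ ∞ k → HasCompactSupport k → ∃ S : 𝓢(E, ℂ),
      ∀ ξ, S ξ = ((N ^ Module.finrank ℝ E)⁻¹ : ℝ) • ((Real.fourierChar (inner ℝ a ξ) : ℂ) *
        k (N⁻¹ • (ξ - l • θ))) := by
    intro k hk hkc
    have hc : HasCompactSupport (fun ξ : E => ((N ^ Module.finrank ℝ E)⁻¹ : ℝ) •
        ((Real.fourierChar (inner ℝ a ξ) : ℂ) * k (N⁻¹ • (ξ - l • θ)))) := by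
      refine HasCompactSupport.intro
        (K := (fun ζ => l • θ + N • ζ) '' (tsupport k)) ?_ ?_
      · exact IsCompact.image hkc (by fun_prop)
      · intro ξ hξ
        have : k (N⁻¹ • (ξ - l • θ)) = 0 := by
          by_contra h
          refine hξ ⟨_, subset_tsupport _ h, ?_⟩
          simp only
          rw [smul_smul, mul_inv_cancel₀ hN.ne', one_smul]; abel
        simp [this]
    have hd : ContDiff ℝ ∞ (fun ξ : E => ((N ^ Module.finrank ℝ E)⁻¹ : ℝ) •
        ((Real.fourierChar (inner ℝ a ξ) : ℂ) * k (N⁻¹ • (ξ - l • θ)))) := by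
      refine ContDiff.const_smul _ (ContDiff.mul ?_ ?_)
      · simp only [Real.fourierChar_apply]
        refine Complex.contDiff_exp.comp ?_
        refine ContDiff.mul (Complex.ofRealCLM.contDiff.comp ?_) contDiff_const
        exact contDiff_const.mul (contDiff_const.inner ℝ contDiff_id)
      · exact hk.comp ((contDiff_id.sub contDiff_const).const_smul _)
    exact ⟨hc.toSchwartzMap hd, fun ξ => rfl⟩
  obtain ⟨H, hH⟩ := hmk η hη hηc
  obtain ⟨Q₀, hQ₀⟩ := hmk K hKd hKc
  refine ⟨((l ^ (-σ) : ℝ) : ℂ) • Q₀, H, ?_, ?_, ?_⟩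
  · intro ξ
    rw [smul_apply, hH, hQ₀]
    by_cases h0 : η (N⁻¹ • (ξ - l • θ)) = 0
    · simp [hK, h0]
    have hz : ‖N⁻¹ • (ξ - l • θ)‖ ≤ 1 := by simpa using hηs (subset_tsupport _ h0)
    set ζ := N⁻¹ • (ξ - l • θ) with hζ
    have hξ : ξ = l • (θ + (l⁻¹ * N) • ζ) := by
      rw [hζ, smul_add, smul_smul, smul_smul]
      have : l * (l⁻¹ * N) * N⁻¹ = 1 := by field_simp
      rw [this, one_smul]; abel
    have hv1 : ‖(l⁻¹ * N) • ζ‖ ≤ 1 / 2 := by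
      rw [norm_smul, Real.norm_eq_abs]
      calc |l⁻¹ * N| * ‖ζ‖ ≤ 1 / 2 * 1 := by gcongr
        _ = 1 / 2 := by norm_num
    have hva : 1 / 2 ≤ ‖θ + (l⁻¹ * N) • ζ‖ := by
      have := norm_sub_norm_le θ (-((l⁻¹ * N) • ζ))
      rw [norm_neg, sub_neg_eq_add, hθ] at this
      linarith
    have hvb : ‖θ + (l⁻¹ * N) • ζ‖ ≤ 3 / 2 := by
      refine (norm_add_le _ _).trans ?_
      rw [hθ]; linarith
    have hle : l⁻¹ ^ 2 ≤ 1 := by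
      apply pow_le_one₀ (by positivity); exact inv_le_one_of_one_le₀ hl
    have hW1 := hWe l⁻¹ (θ + (l⁻¹ * N) • ζ) (by nlinarith [sq_nonneg l⁻¹]) (by nlinarith)
    have hnorm : (1 + ‖ξ‖ ^ 2) = l ^ 2 * (l⁻¹ ^ 2 + ‖θ + (l⁻¹ * N) • ζ‖ ^ 2) := by
      conv_lhs => rw [hξ]
      rw [norm_smul, Real.norm_eq_abs, abs_of_pos hl0]
      field_simp
    set u := l⁻¹ ^ 2 + ‖θ + (l⁻¹ * N) • ζ‖ ^ 2 with hu
    have hu0 : 0 < u := by positivity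
    -- the two multipliers cancel on the support of `η`
    have hscal : (1 + ‖ξ‖ ^ 2) ^ (σ / 2) * (l ^ (-σ) * u ^ (-σ / 2)) = 1 := by
      rw [hnorm, Real.mul_rpow (by positivity) hu0.le, ← Real.rpow_natCast l 2,
        ← Real.rpow_mul hl0.le]
      have e1 : l ^ (((2 : ℕ) : ℝ) * (σ / 2)) * l ^ (-σ) = 1 := by
        rw [← Real.rpow_add hl0]
        have : ((2 : ℕ) : ℝ) * (σ / 2) + -σ = 0 := by push_cast; ring
        rw [this, Real.rpow_zero]
      have e2 : u ^ (σ / 2) * u ^ (-σ / 2) = 1 := by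
        rw [← Real.rpow_add hu0, neg_div, add_neg_cancel, Real.rpow_zero]
      calc _ = (l ^ (((2 : ℕ) : ℝ) * (σ / 2)) * l ^ (-σ)) * (u ^ (σ / 2) * u ^ (-σ / 2)) := by ring
        _ = 1 := by rw [e1, e2, one_mul]
    have hscal' : (((1 + ‖ξ‖ ^ 2) ^ (σ / 2) : ℝ) : ℂ) * (((l ^ (-σ) : ℝ) : ℂ) *
        ((u ^ (-σ / 2) : ℝ) : ℂ)) = 1 := by
      rw [← Complex.ofReal_mul, ← Complex.ofReal_mul, hscal, Complex.ofReal_one]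
    simp only [hK, hW1, smul_eq_mul, Complex.real_smul]
    linear_combination -((N ^ Module.finrank ℝ E)⁻¹ : ℝ) * (Real.fourierChar (inner ℝ a ξ) : ℂ) *
      η ζ * hscal'
  · intro x
    rw [SchwartzMap.fourier_coe]
    have : (H : E → ℂ) = fun ξ => ((N ^ Module.finrank ℝ E)⁻¹ : ℝ) •
      ((Real.fourierChar (inner ℝ a ξ) : ℂ) * η (N⁻¹ • (ξ - l • θ))) := funext hH
    rw [this, fourier_modulate_dilate _ _ _ hN, real_inner_smul_left]
  · intro x
    have : (Q₀ : E → ℂ) = fun ξ => ((N ^ Module.finrank ℝ E)⁻¹ : ℝ) •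
      ((Real.fourierChar (inner ℝ a ξ) : ℂ) * K (N⁻¹ • (ξ - l • θ))) := funext hQ₀
    rw [FourierTransform.fourier_smul, smul_apply, SchwartzMap.fourier_coe, this,
      fourier_modulate_dilate _ _ _ hN, norm_smul, norm_mul, Circle.norm_coe, one_mul,
      Complex.norm_real, Real.norm_eq_abs, abs_of_pos (Real.rpow_pos_of_pos hl0 _)]
    have h1 := hC K B hKd hB0 hKs (fun j hj x => hB l⁻¹ (l⁻¹ * N) θ (by linarith) j hj x)
      (N • (x - a))
    rw [norm_smul, Real.norm_eq_abs, abs_of_pos hN] at h1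
    have hp : 0 < l ^ (-σ) := Real.rpow_pos_of_pos hl0 _
    calc _ = l ^ (-σ) * ((1 + N * ‖x - a‖) ^ M * ‖𝓕 K (N • (x - a))‖) := by ring
      _ ≤ l ^ (-σ) * (C * B) := by gcongr
      _ ≤ (C * B + 1) * l ^ (-σ) := by nlinarith

/-- Windows `η` for the test functions and `φ` for the packets with a nonnegative correlation `Φ`
that does not vanish at the origin, so that `Φ` has positive integral over every line through it. -/
theorem exists_profile :
    ∃ (η : E → ℂ) (φ Φ : E → ℝ), ContDiff ℝ ∞ η ∧ tsupport η ⊆ Metric.closedBall 0 1 ∧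
      ContDiff ℝ ∞ φ ∧ tsupport φ ⊆ Metric.closedBall 0 1 ∧ (∀ x, 0 ≤ φ x) ∧ (∀ x, φ x ≤ 1) ∧
      Continuous Φ ∧ (∀ Z, 0 ≤ Φ Z) ∧ 0 < Φ 0 ∧ (∃ C, ∀ Z, Φ Z ≤ C / (1 + ‖Z‖ ^ 2)) ∧
      ∀ Z, ∫ x, 𝓕 η x * (φ (x + Z) : ℂ) = Φ Z := by
  obtain ⟨η, Ψ, hη, hηs, hΨ, hΨc, hΨ0, hΨp⟩ := exists_fourier_nonneg (E := E)
  let b : ContDiffBump (0 : E) := ⟨1 / 2, 1, by norm_num, by norm_num⟩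
  have hηc : HasCompactSupport η := (isCompact_closedBall 0 1).of_isClosed_subset
    (isClosed_tsupport η) hηs
  have hb : ∀ j : ℕ, ∃ A : ℝ, ∀ x, ‖iteratedFDeriv ℝ j η x‖ ≤ A := fun j =>
    (hη.continuous_iteratedFDeriv (by exact_mod_cast le_top)).bounded_above_of_compact_support
      (hηc.iteratedFDeriv j)
  choose A hA using hb
  have hA0 : ∀ j, 0 ≤ A j := fun j => (norm_nonneg _).trans (hA j 0)
  obtain ⟨C, hC0, hC⟩ := exists_decay_fourier_of_iteratedFDeriv_le (E := E) 2
  have hdec : ∀ x, (1 + ‖x‖) ^ 2 * Ψ x ≤ C * (A 0 + A 1 + A 2) := by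
    intro x
    have := hC η (A 0 + A 1 + A 2) hη (by have := hA0 0; have := hA0 1; have := hA0 2; positivity)
      hηs (fun j hj x => (hA j x).trans (by
        have := hA0 0; have := hA0 1; have := hA0 2
        interval_cases j <;> linarith)) x
    rwa [hΨ, Complex.norm_real, Real.norm_eq_abs, abs_of_nonneg (hΨ0 x)] at this
  set C₁ := C * (A 0 + A 1 + A 2) with hC₁
  have hC₁0 : 0 ≤ C₁ := le_trans (mul_nonneg (by positivity) (hΨ0 0)) (hdec 0)
  have hbc : Continuous b := b.continuous
  have hform : ∀ Z, ∫ x, Ψ x * b (x + Z) = ∫ y, Ψ (y - Z) * b y := by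
    intro Z
    rw [← integral_add_right_eq_self (fun y => Ψ (y - Z) * b y) Z]
    simp
  have hcs : ∀ Z, HasCompactSupport (fun y => Ψ (y - Z) * b y) := fun Z =>
    b.hasCompactSupport.mul_left
  have hint : ∀ Z, Integrable (fun y => Ψ (y - Z) * b y) := fun Z =>
    ((hΨc.comp (continuous_id.sub continuous_const)).mul hbc).integrable_of_hasCompactSupport
      (hcs Z)
  refine ⟨η, b, fun Z => ∫ x, Ψ x * b (x + Z), hη, hηs, b.contDiff, b.tsupport_eq.subset,
    fun x => b.nonneg, fun x => b.le_one, ?_, ?_, ?_, ?_, ?_⟩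
  · simp_rw [hform]
    have : ∀ Z, ∫ y, Ψ (y - Z) * b y = ∫ y in Metric.closedBall (0 : E) 1, Ψ (y - Z) * b y := by
      intro Z
      rw [setIntegral_eq_integral_of_forall_compl_eq_zero]
      intro y hy
      rw [b.zero_of_le_dist, mul_zero]
      simpa using (not_le.1 (fun h => hy (by simpa using h))).le
    simp_rw [this]
    refine continuous_parametric_integral_of_continuous ?_ (isCompact_closedBall 0 1)
    exact (hΨc.comp (continuous_snd.sub continuous_fst)).mul (hbc.comp continuous_snd)
  · exact fun Z => integral_nonneg fun x => mul_nonneg (hΨ0 x) b.nonneg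
  · refine Continuous.integral_pos_of_hasCompactSupport_nonneg_nonzero (x := 0) ?_ ?_ ?_ ?_
    · exact hΨc.mul (hbc.comp (by fun_prop))
    · simpa using hcs 0
    · exact fun x => mul_nonneg (hΨ0 x) b.nonneg
    · have : b (0 : E) = 1 := b.one_of_mem_closedBall (Metric.mem_closedBall_self b.rIn_pos.le)
      simp only [add_zero, this, mul_one]
      exact hΨp.ne'
  · refine ⟨4 * C₁ * ∫ y, b y, fun Z => ?_⟩
    simp only
    rw [hform, le_div_iff₀ (by positivity), mul_comm, ← integral_const_mul, ← integral_const_mul]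
    refine integral_mono ((hint Z).const_mul _) (b.integrable.const_mul _) fun y => ?_
    by_cases hy : b y = 0
    · simp [hy]
    have hy1 : ‖y‖ ≤ 1 := by
      have : y ∈ Function.support b := hy
      rw [b.support_eq] at this
      have h2 : ‖y‖ < 1 := by simpa using this
      exact h2.le
    have hZ : ‖Z‖ ≤ ‖y - Z‖ + 1 := by
      have := norm_sub_norm_le Z y
      rw [norm_sub_rev] at this; linarith
    have h1 : 1 + ‖Z‖ ^ 2 ≤ 4 * (1 + ‖y - Z‖) ^ 2 := by
      nlinarith [norm_nonneg Z, norm_nonneg (y - Z)]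
    have h2 := hdec (y - Z)
    have h3 : 0 ≤ b y := b.nonneg
    have h4 := hΨ0 (y - Z)
    simp only
    calc (1 + ‖Z‖ ^ 2) * (Ψ (y - Z) * b y) ≤ 4 * (1 + ‖y - Z‖) ^ 2 * (Ψ (y - Z) * b y) := by gcongr
      _ = 4 * ((1 + ‖y - Z‖) ^ 2 * Ψ (y - Z)) * b y := by ring
      _ ≤ 4 * C₁ * b y := by gcongr
  · intro Z
    simp_rw [hΨ, ← Complex.ofReal_mul]
    exact integral_ofReal

/-- A packet of frequency `l θ` about `-c` and a test function of frequency `-l θ` about `a` pair to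
`N⁻ⁿ` times the value of the correlation `Φ` at the rescaled displacement `N (c + a)`, times the
phase of that displacement. -/
theorem integral_packet_mul_test {η : E → ℂ} {φ Φ : E → ℝ}
    (hΦ : ∀ Z, ∫ x, 𝓕 η x * (φ (x + Z) : ℂ) = Φ Z) (l : ℝ) {N : ℝ} (hN : 0 < N) (θ a c : E) :
    ∫ x, ((Real.fourierChar (-(l * inner ℝ θ (x - a))) : ℂ) * 𝓕 η (N • (x - a))) *
      ((Real.fourierChar (l * inner ℝ θ (x + c)) : ℂ) * (φ (N • (x + c)) : ℂ)) =
    ((N ^ Module.finrank ℝ E)⁻¹ : ℝ) *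
      ((Real.fourierChar (l * inner ℝ θ (c + a)) : ℂ) * (Φ (N • (c + a)) : ℂ)) := by
  rw [← hΦ, ← integral_add_right_eq_self _ a]
  have h : ∀ x : E, ((Real.fourierChar (-(l * inner ℝ θ (x + a - a))) : ℂ) *
      𝓕 η (N • (x + a - a))) *
      ((Real.fourierChar (l * inner ℝ θ (x + a + c)) : ℂ) * (φ (N • (x + a + c)) : ℂ)) =
      (Real.fourierChar (l * inner ℝ θ (c + a)) : ℂ) *
        (fun y : E => 𝓕 η y * (φ (y + N • (c + a)) : ℂ)) (N • x) := by
    intro x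
    have e : Real.fourierChar (l * inner ℝ θ (x + a + c)) =
        Real.fourierChar (l * inner ℝ θ x) * Real.fourierChar (l * inner ℝ θ (c + a)) := by
      rw [← AddChar.map_add_eq_mul, add_assoc, inner_add_right, mul_add, add_comm a c]
    have e2 : N • (x + a + c) = N • x + N • (c + a) := by
      rw [← smul_add, add_assoc, add_comm a c]
    have e3 : (Real.fourierChar (-(l * inner ℝ θ x)) : ℂ) * (Real.fourierChar (l * inner ℝ θ x) : ℂ)
        = 1 := by
      rw [← Circle.coe_mul, ← AddChar.map_add_eq_mul]; simp
    simp only [add_sub_cancel_right, e, e2, Circle.coe_mul]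
    linear_combination (𝓕 η (N • x) * (Real.fourierChar (l * inner ℝ θ (c + a)) : ℂ) *
      (φ (N • x + N • (c + a)) : ℂ)) * e3
  simp_rw [h]
  rw [integral_const_mul, Measure.integral_comp_smul volume
    (fun y : E => 𝓕 η y * (φ (y + N • (c + a)) : ℂ)) N, abs_of_nonneg (by positivity),
    Complex.real_smul]
  ring

end TestFunctions

/-! ### Elementary properties of curves -/

section Curves

variable {E : Type*} [NormedAddCommGroup E] [InnerProductSpace ℝ E]

theorem exists_mul_abs_sub_le_norm_sub {γ : ℝ → E} {v : E} {s : ℝ} (h : HasStrictDerivAt γ v s)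
    (hv : v ≠ 0) : ∃ δ > 0, ∀ x ∈ Icc (s - δ) (s + δ), ∀ y ∈ Icc (s - δ) (s + δ),
      ‖v‖ / 2 * |x - y| ≤ ‖γ x - γ y‖ := by
  have hv0 : 0 < ‖v‖ := norm_pos_iff.2 hv
  have h1 := h.isLittleO.def (half_pos hv0)
  rw [Metric.eventually_nhds_iff] at h1
  obtain ⟨ε, hε, h2⟩ := h1
  refine ⟨ε / 2, half_pos hε, fun x hx y hy => ?_⟩
  have h3 := @h2 (x, y) (by
    rw [Prod.dist_eq, max_lt_iff, Real.dist_eq, Real.dist_eq, abs_lt, abs_lt]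
    rw [mem_Icc] at hx hy
    refine ⟨⟨?_, ?_⟩, ?_, ?_⟩ <;> simp only <;> linarith)
  have h4 : ‖(x - y) • v‖ = |x - y| * ‖v‖ := by rw [norm_smul, Real.norm_eq_abs]
  have h5 := norm_sub_norm_le ((x - y) • v) (γ x - γ y)
  have h6 := norm_sub_rev ((x - y) • v) (γ x - γ y)
  simp only [ContinuousLinearMap.toSpanSingleton_apply, Real.norm_eq_abs] at h3
  rw [h4, h6] at h5
  linarith

/-- Taylor estimate for a function `g 0` with successive derivatives `g j`, of which those of order
`1, …, n - 1` vanish at `s₀`. -/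
theorem abs_sub_le_mul_pow_of_hasDerivWithinAt {a b B s₀ : ℝ} {g : ℕ → ℝ → ℝ} {n : ℕ} (hn : 1 ≤ n)
    (hg : ∀ j < n, ∀ s ∈ Icc a b, HasDerivWithinAt (g j) (g (j + 1) s) (Icc a b) s)
    (hs₀ : s₀ ∈ Icc a b) (h0 : ∀ j, 1 ≤ j → j < n → g j s₀ = 0)
    (hB : ∀ s ∈ Icc a b, |g n s| ≤ B) {s : ℝ} (hs : s ∈ Icc a b) :
    |g 0 s - g 0 s₀| ≤ B * |s - s₀| ^ n := by
  have step : ∀ j < n, ∀ k, (∀ s ∈ Icc a b, |g (j + 1) s| ≤ B * |s - s₀| ^ k) →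
      ∀ s ∈ Icc a b, |g j s - g j s₀| ≤ B * |s - s₀| ^ (k + 1) := by
    intro j hj k hk s hs
    have hsub : uIcc s₀ s ⊆ Icc a b := by
      rw [uIcc]
      exact Icc_subset_Icc (le_min hs₀.1 hs.1) (max_le hs₀.2 hs.2)
    have := Convex.norm_image_sub_le_of_norm_hasDerivWithin_le (f := g j)
      (f' := fun x => g (j + 1) x) (s := uIcc s₀ s) (x := s₀) (y := s) (C := B * |s - s₀| ^ k)
      (fun x hx => (hg j hj x (hsub hx)).mono hsub)
      (fun x hx => by
        refine (hk x (hsub hx)).trans ?_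
        have hB0 : 0 ≤ B := (abs_nonneg _).trans (hB s hs)
        have : |x - s₀| ≤ |s - s₀| := abs_sub_left_of_mem_uIcc hx
        gcongr) (convex_uIcc _ _) left_mem_uIcc right_mem_uIcc
    rw [Real.norm_eq_abs, Real.norm_eq_abs] at this
    rw [pow_succ, ← mul_assoc]
    exact this
  have main : ∀ k, k < n → ∀ s ∈ Icc a b, |g (n - k) s| ≤ B * |s - s₀| ^ k := by
    intro k
    induction k with
    | zero => intro _ s hs; simpa using hB s hs
    | succ k ih =>
      intro hk s hs
      have h1 := step (n - (k + 1)) (by omega) k (by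
        have : n - (k + 1) + 1 = n - k := by omega
        rw [this]
        exact ih (by omega)) s hs
      rwa [h0 (n - (k + 1)) (by omega) (by omega), sub_zero] at h1
  have := step 0 (by omega) (n - 1) (by
    have h := main (n - 1) (by omega)
    have e : n - (n - 1) = 0 + 1 := by omega
    rwa [e] at h) s hs
  rwa [Nat.sub_add_cancel hn] at this

omit [InnerProductSpace ℝ E] in
/-- A curve that is locally injective at the points of a compact set passes only finitely often
through a given point there, hence only in a null set of parameters. -/
theorem volume_fiber_eq_zero {K : Set ℝ} (hK : IsCompact K) {γ : ℝ → E} (hγ : Continuous γ)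
    (hinj : ∀ s ∈ K, ∃ δ > 0, InjOn γ (Icc (s - δ) (s + δ))) (y : E) :
    volume (K ∩ γ ⁻¹' {y}) = 0 := by
  refine (hK.inter_right (isClosed_singleton.preimage hγ)).measure_zero_of_nhdsWithin fun s hs => ?_
  obtain ⟨δ, hδ, h⟩ := hinj s hs.1
  refine ⟨Icc (s - δ) (s + δ) ∩ (K ∩ γ ⁻¹' {y}), ?_, ?_⟩
  · exact inter_mem (mem_nhdsWithin_of_mem_nhds
      (Icc_mem_nhds (sub_lt_self s hδ) (lt_add_of_pos_right s hδ))) self_mem_nhdsWithin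
  · refine measure_mono_null (t := {s}) ?_ (measure_singleton s)
    rintro x ⟨hx, -, hxy⟩
    exact h hx ⟨by linarith, by linarith⟩
      ((mem_singleton_iff.1 hxy).trans (mem_singleton_iff.1 hs.2).symm)

end Curves

/-! ### The part of the curve measure carried by an arc -/

section PushForward

variable {E : Type*} [NormedAddCommGroup E] [MeasurableSpace E] [BorelSpace E]

/-- Integrals against the pushforward under `γ` of the signed measure `χ(s) ds`, which is treated as
the difference of the pushforwards of its positive and negative parts. -/
theorem setIntegral_map_withDensity_sub {F : Type*} [NormedAddCommGroup F] [NormedSpace ℝ F]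
    {γ : ℝ → E} (hγ : Continuous γ) {χ : ℝ → ℝ} (hχ : Continuous χ) (hχs : HasCompactSupport χ)
    {g : E → F} (hg : Continuous g) [SecondCountableTopologyEither E F]
    {A : Set E} (hA : MeasurableSet A) :
    ∫ y in A, g y ∂((volume.withDensity fun s => ENNReal.ofReal (χ s)).map γ) -
      ∫ y in A, g y ∂((volume.withDensity fun s => ENNReal.ofReal (-χ s)).map γ) =
    ∫ s in γ ⁻¹' A, χ s • g (γ s) := by
  have h1 : ∀ χ : ℝ → ℝ, Continuous χ → HasCompactSupport χ →
      (∫ y in A, g y ∂((volume.withDensity fun s => ENNReal.ofReal (χ s)).map γ) =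
      ∫ s in γ ⁻¹' A, (max (χ s) 0) • g (γ s)) ∧
      Integrable (fun s => (max (χ s) 0) • g (γ s)) := by
    intro χ hχ hχs
    constructor
    · rw [setIntegral_map hA hg.aestronglyMeasurable hγ.measurable.aemeasurable,
        setIntegral_withDensity_eq_setIntegral_toReal_smul (by fun_prop)
          (Eventually.of_forall fun _ => ENNReal.ofReal_lt_top) _ (hA.preimage hγ.measurable)]
      simp only [ENNReal.toReal_ofReal']
    · refine Continuous.integrable_of_hasCompactSupport (by fun_prop) ?_
      exact HasCompactSupport.smul_right (hχs.comp_left (g := fun r : ℝ => max r 0) (by simp))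
  have hp := h1 χ hχ hχs
  have hm := h1 (fun s => -χ s) hχ.neg hχs.neg
  rw [hp.1, hm.1, ← integral_sub hp.2.integrableOn hm.2.integrableOn]
  congr 1 with s
  rw [← sub_smul]
  congr 1
  rcases le_total 0 (χ s) with h | h
  · rw [max_eq_left h, max_eq_right (by linarith)]; ring
  · rw [max_eq_right h, max_eq_left (by linarith)]; ring

/-- If `μ₁ ≠ 0` then its restriction to some arc is nonzero. The preimage `γ ⁻¹' (γ '' J s)`
contains all parameters at which the curve meets the arc, so that cancellation between different
passes of the curve is taken into account. -/
theorem exists_arc_integral_ne_zero {γ : ℝ → E} (hγ : Continuous γ) {χ : ℝ → ℝ}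
    (hχ : Continuous χ) (hχs : HasCompactSupport χ) {g : E → ℂ} (hg : Continuous g)
    (hμ : ∫ s, g (γ s) * (χ s : ℂ) ≠ 0) (J : ℝ → Set ℝ)
    (hJ : ∀ s ∈ tsupport χ, IsCompact (J s) ∧ J s ∈ 𝓝 s) :
    ∃ s ∈ tsupport χ, ∃ G : BoundedContinuousFunction E ℝ,
      ∫ u in γ ⁻¹' (γ '' J s), χ u * G (γ u) ≠ 0 := by
  by_contra! hcon
  set νp := (volume.withDensity fun s => ENNReal.ofReal (χ s)).map γ with hνp
  set νm := (volume.withDensity fun s => ENNReal.ofReal (-χ s)).map γ with hνm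
  have hfin : ∀ χ : ℝ → ℝ, Continuous χ → HasCompactSupport χ →
      IsFiniteMeasure ((volume.withDensity fun s => ENNReal.ofReal (χ s)).map γ) := by
    intro χ hχ hχs
    have : IsFiniteMeasure (volume.withDensity fun s => ENNReal.ofReal (χ s)) :=
      isFiniteMeasure_withDensity_ofReal (hχ.integrable_of_hasCompactSupport hχs).2
    infer_instance
  have := hfin χ hχ hχs
  have : IsFiniteMeasure νm := hfin (fun s => -χ s) hχ.neg hχs.neg
  -- finite measures with the same integrals of bounded continuous functions agree
  have hres : ∀ s ∈ tsupport χ, νp.restrict (γ '' J s) = νm.restrict (γ '' J s) := by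
    intro s hs
    have hA : MeasurableSet (γ '' J s) := ((hJ s hs).1.image hγ).isClosed.measurableSet
    refine ext_of_forall_integral_eq_of_IsFiniteMeasure fun G => ?_
    have := setIntegral_map_withDensity_sub hγ hχ hχs G.continuous hA
    rw [← sub_eq_zero, this]
    exact hcon s hs G
  -- finitely many arcs cover the support of `χ`
  have hK : νp.restrict (γ '' tsupport χ) = νm.restrict (γ '' tsupport χ) := by
    refine IsCompact.induction_on (p := fun S => νp.restrict (γ '' S) = νm.restrict (γ '' S))
      hχs ?_ ?_ ?_ ?_
    · simp
    · intro S T hST hT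
      exact Measure.restrict_congr_mono (image_mono hST) hT
    · intro S T hS hT
      simp only [image_union]
      exact Measure.restrict_union_congr.2 ⟨hS, hT⟩
    · intro s hs
      exact ⟨J s, mem_nhdsWithin_of_mem_nhds (hJ s hs).2, hres s hs⟩
  have hA : MeasurableSet (γ '' tsupport χ) := (IsCompact.image hχs hγ).isClosed.measurableSet
  have h := setIntegral_map_withDensity_sub hγ hχ hχs hg hA
  rw [← hνp, ← hνm, hK, sub_self] at h
  apply hμ
  rw [setIntegral_eq_integral_of_forall_compl_eq_zero] at h
  · rw [h]
    congr 1 with s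
    rw [Complex.real_smul, mul_comm]
  · intro s hs
    rw [image_eq_zero_of_notMem_tsupport (fun h => hs ⟨s, h, rfl⟩), zero_smul]

end PushForward

/-! ### The normal direction of a non-degenerate curve -/

section Frame

variable {n : ℕ}

/-- A continuous unit field `θ` orthogonal to `γ', …, γ⁽ⁿ⁻¹⁾`, namely the normalized last row of the
adjugate of the matrix of derivatives. By Taylor's formula, `γ` stays within `O(|s - s₀| ^ n)` of
the hyperplane through `γ s₀` normal to `θ s₀`. -/
theorem exists_unit_normal {a b : ℝ} (hab : a < b) (hn : 2 ≤ n)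
    {γ : ℝ → EuclideanSpace ℝ (Fin n)} (hγ : IsNondegenerateCurve a b γ) :
    ∃ θ : ℝ → EuclideanSpace ℝ (Fin n), Continuous θ ∧ (∀ s, ‖θ s‖ = 1) ∧
      (∃ B, ∀ s₀ ∈ Icc a b, ∀ s ∈ Icc a b,
        |inner ℝ (θ s₀) (γ s₀ - γ s)| ≤ B * |s - s₀| ^ n) ∧
      ∀ s ∈ Ioo a b, deriv γ s ≠ 0 ∧ inner ℝ (θ s) (deriv γ s) = 0 := by
  obtain ⟨hγd, c₀, hc₀, hdet⟩ := hγ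
  have hU : UniqueDiffOn ℝ (Icc a b) := uniqueDiffOn_Icc hab
  set D : ℕ → ℝ → EuclideanSpace ℝ (Fin n) := fun j s => iteratedDerivWithin j γ (Icc a b) s with hD
  have hDc : ∀ j, ContinuousOn (D j) (Icc a b) := fun j =>
    hγd.continuousOn_iteratedDerivWithin (by exact_mod_cast le_top) hU
  have hDd : ∀ j, ∀ s ∈ Icc a b, HasDerivWithinAt (D j) (D (j + 1) s) (Icc a b) s := by
    intro j s hs
    have h1 := (hγd.differentiableOn_iteratedDerivWithin (m := j)
      (by exact_mod_cast ENat.natCast_lt_top j) hU) s hs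
    have h2 := h1.hasDerivWithinAt
    rwa [← iteratedDerivWithin_succ] at h2
  set A : ℝ → Matrix (Fin n) (Fin n) ℝ := fun s => Matrix.of fun i j : Fin n => D ((j : ℕ) + 1) s i
    with hA
  have hAc : ContinuousOn A (Icc a b) := by
    rw [continuousOn_iff_continuous_domRestrict]
    refine continuous_matrix fun i j => ?_
    have := (continuousOn_iff_continuous_domRestrict.1 (hDc ((j : ℕ) + 1)))
    exact (EuclideanSpace.proj (𝕜 := ℝ) i).continuous.comp this
  have hdet0 : ∀ s ∈ Icc a b, (A s).det ≠ 0 := fun s hs h => by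
    have := hdet s hs
    change c₀ ≤ |(A s).det| at this
    rw [h, abs_zero] at this
    linarith
  let last : Fin n := ⟨n - 1, by omega⟩
  -- the last row of the adjugate is orthogonal to all columns but the last
  set θ₀ : ℝ → EuclideanSpace ℝ (Fin n) := fun s =>
    WithLp.toLp 2 (fun i => (A s).adjugate last i) with hθ₀
  have hinner : ∀ s, ∀ j : Fin n, inner ℝ (θ₀ s) (D ((j : ℕ) + 1) s) =
      (A s).det * (if last = j then 1 else 0) := by
    intro s j
    have h1 := congrFun (congrFun (Matrix.adjugate_mul (A s)) last) j
    rw [Matrix.mul_apply, Matrix.smul_apply, Matrix.one_apply, smul_eq_mul] at h1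
    rw [← h1, PiLp.inner_apply]
    refine Finset.sum_congr rfl fun i _ => ?_
    simp [hθ₀, hA, mul_comm]
  have hθ₀c : ContinuousOn θ₀ (Icc a b) := by
    rw [continuousOn_iff_continuous_domRestrict] at hAc ⊢
    have h1 : Continuous fun s : Icc a b => ((Icc a b).domRestrict A s).adjugate :=
      hAc.matrix_adjugate
    refine (PiLp.continuous_toLp 2 _).comp (continuous_pi fun i => ?_)
    exact h1.matrix_elem last i
  have hθ₀n : ∀ s ∈ Icc a b, θ₀ s ≠ 0 := by
    intro s hs h
    have := hinner s last
    rw [h, inner_zero_left, if_pos rfl, mul_one] at this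
    exact hdet0 s hs this.symm
  have horth : ∀ s, ∀ j, 1 ≤ j → j < n → inner ℝ (θ₀ s) (D j s) = 0 := by
    intro s j h1 h2
    have := hinner s ⟨j - 1, by omega⟩
    simp only [Nat.sub_add_cancel h1] at this
    rw [this, if_neg, mul_zero]
    intro h
    have := congrArg Fin.val h
    simp only [last] at this
    omega
  obtain ⟨B, hB⟩ := isCompact_Icc.exists_bound_of_continuousOn (hDc n)
  let π := projIcc a b hab.le
  refine ⟨fun s => ‖θ₀ (π s)‖⁻¹ • θ₀ (π s), ?_, ?_, ⟨B, ?_⟩, ?_⟩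
  · have h1 : Continuous fun s => θ₀ (π s) :=
      (continuousOn_iff_continuous_domRestrict.1 hθ₀c).comp continuous_projIcc
    exact (h1.norm.inv₀ fun s => norm_ne_zero_iff.2 (hθ₀n _ (π s).2)).smul h1
  · intro s
    have := norm_ne_zero_iff.2 (hθ₀n _ (π s).2)
    rw [norm_smul, norm_inv, norm_norm, inv_mul_cancel₀ this]
  · intro s₀ hs₀ s hs
    have hπ : (π s₀ : ℝ) = s₀ := by simp [π, projIcc_of_mem _ hs₀]
    simp only [hπ]
    set u := ‖θ₀ s₀‖⁻¹ • θ₀ s₀ with hu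
    have hu1 : ‖u‖ = 1 := by
      have := norm_ne_zero_iff.2 (hθ₀n _ hs₀)
      rw [hu, norm_smul, norm_inv, norm_norm, inv_mul_cancel₀ this]
    have := abs_sub_le_mul_pow_of_hasDerivWithinAt (a := a) (b := b) (B := B) (s₀ := s₀)
      (g := fun j s => inner ℝ u (D j s)) (n := n) (by omega)
      (fun j _ s hs =>
        (innerSL ℝ u).hasFDerivAt.comp_hasDerivWithinAt s (hDd j s hs)) hs₀
      (fun j h1 h2 => by
        simp only [hu, real_inner_smul_left, horth s₀ j h1 h2, mul_zero])
      (fun s hs => by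
        refine (abs_real_inner_le_norm _ _).trans ?_
        rw [hu1, one_mul]; exact hB s hs) hs
    simp only [hD, iteratedDerivWithin_zero] at this
    rwa [← inner_sub_right, ← neg_sub, inner_neg_right, abs_neg] at this
  · intro s hs
    have hsI : s ∈ Icc a b := Ioo_subset_Icc_self hs
    have hπ : (π s : ℝ) = s := by simp [π, projIcc_of_mem _ hsI]
    have h1 : D 1 s = deriv γ s := by
      simp only [hD, iteratedDerivWithin_one]
      exact derivWithin_of_mem_nhds (Icc_mem_nhds hs.1 hs.2)
    rw [← h1]
    constructor
    · intro h
      refine hdet0 s hsI (Matrix.det_eq_zero_of_column_eq_zero ⟨0, by omega⟩ fun i => ?_)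
      simp [hA, h]
    · simp only [hπ, real_inner_smul_left, horth s 1 le_rfl (by omega), mul_zero]

theorem curveAverage_congr {γ γ' : ℝ → EuclideanSpace ℝ (Fin n)} {χ : ℝ → ℝ}
    (h : ∀ s ∈ tsupport χ, γ s = γ' s) (t : ℝ) (f : EuclideanSpace ℝ (Fin n) → ℂ) :
    curveAverage γ χ t f = curveAverage γ' χ t f := by
  ext x
  simp only [curveAverage, curveMeasurePairing]
  congr 1 with s
  by_cases hs : s ∈ tsupport χ
  · rw [h s hs]
  · simp [image_eq_zero_of_notMem_tsupport hs]

end Frame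

theorem continuous_fourierChar_coe : Continuous fun x : ℝ => (Real.fourierChar x : ℂ) :=
  continuous_induced_dom.comp Real.continuous_fourierChar

/-! ### Superpositions of packets along an arc concentrate on the curve -/

section Concentration

variable {E : Type*} [NormedAddCommGroup E] [InnerProductSpace ℝ E]

/-- The response at the point `y` to a packet with profile `Φ` centred at `γ s₀`: the profile at the
rescaled displacement `N t (γ s₀ - y)`, multiplied by a character with phase `ψ s₀ y`. The shift
`ε γ s₀` accounts for the displacement of a packet relative to a test function which does not move
with the time `t`. -/
noncomputable def packetKernel (γ : ℝ → E) (Φ : E → ℂ) (ψ : ℝ → E → ℝ) (N t ε s₀ : ℝ)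
    (y : E) : ℂ :=
  (Real.fourierChar (ψ s₀ y) : ℂ) * Φ ((N * t) • (γ s₀ - y) - ε • γ s₀)

/-- The superposition of the responses `packetKernel` over the arc `s₀ ∈ [c, d]` with weight `ρ`,
normalized so that it stays bounded as `N → ∞`. -/
noncomputable def arcKernel (γ : ℝ → E) (Φ : E → ℂ) (ψ : ℝ → E → ℝ) (ρ : ℝ → ℂ) (c d N t ε : ℝ)
    (y : E) : ℂ :=
  ∫ s₀ in Icc c d, (N : ℝ) • (ρ s₀ * packetKernel γ Φ ψ N t ε s₀ y)

/-- The substitution `x = v + u / N`. -/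
theorem integral_dilate_real (g : ℝ → ℂ) (v : ℝ) {N : ℝ} (hN : 0 < N) :
    ∫ x, N • g x = ∫ u, g (v + u / N) := by
  have := integral_dilate g v (inv_pos.2 hN)
  simp only [Module.finrank_self, pow_one, inv_inv, smul_eq_mul] at this
  rw [this]
  congr 1 with u
  rw [inv_mul_eq_div]

omit [InnerProductSpace ℝ E] in
theorem norm_le_of_profile_bound {Φ : E → ℂ} {C : ℝ} (hΦ : ∀ Z, ‖Φ Z‖ ≤ C / (1 + ‖Z‖ ^ 2))
    {Z : E} {z : ℝ} (hz : |z| ≤ ‖Z‖ + 1) : ‖Φ Z‖ ≤ 3 * C / (1 + z ^ 2) := by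
  have hC : 0 ≤ C := by
    have := (norm_nonneg _).trans (hΦ 0)
    simpa using this
  refine (hΦ Z).trans ?_
  rw [div_le_div_iff₀ (by positivity) (by positivity)]
  have h1 : z ^ 2 ≤ 2 * ‖Z‖ ^ 2 + 2 := by
    rw [← sq_abs]
    nlinarith [sq_nonneg (‖Z‖ - 1), abs_nonneg z, norm_nonneg Z]
  nlinarith [sq_nonneg ‖Z‖]

theorem integrable_profile_bound (A : ℝ) {m : ℝ} (hm : 0 < m) :
    Integrable (fun u : ℝ => A / (1 + (m * u) ^ 2)) := by
  have := (integrable_inv_one_add_sq.comp_mul_left' hm.ne').const_mul A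
  simpa [div_eq_mul_inv] using this

variable {ι : Type*} {l : Filter ι} {N t ε : ι → ℝ} {γ : ℝ → E} {Φ : E → ℂ} {ψ : ι → ℝ → E → ℝ}
  {ρ : ℝ → ℂ} {c d κ C : ℝ}

/-- Decay of the response away from the centre of the packet, uniform in the phase. -/
theorem eventually_norm_packetKernel_le (hγ : Continuous γ)
    (hΦb : ∀ Z, ‖Φ Z‖ ≤ C / (1 + ‖Z‖ ^ 2))
    (hN : Tendsto N l atTop) (ht : Tendsto t l (𝓝 1)) (hε : Tendsto ε l (𝓝 0)) :
    ∀ᶠ i in l, 1 ≤ N i ∧ ∀ s₀ ∈ Icc c d, ∀ (y : E) (z : ℝ), |z| ≤ ‖γ s₀ - y‖ →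
      ‖packetKernel γ Φ (ψ i) (N i) (t i) (ε i) s₀ y‖ ≤ 3 * C / (1 + (1 / 2 * N i * z) ^ 2) := by
  obtain ⟨R, hR⟩ := isCompact_Icc.exists_bound_of_continuousOn (s := Icc c d) hγ.continuousOn
  have h1 : ∀ᶠ i in l, 1 / 2 < t i := ht.eventually (lt_mem_nhds (by norm_num))
  have h2 : ∀ᶠ i in l, |ε i| * (|R| + 1) < 1 := by
    have : Tendsto (fun i => |ε i| * (|R| + 1)) l (𝓝 (|0| * (|R| + 1))) := hε.abs.mul_const _
    rw [abs_zero, zero_mul] at this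
    exact this.eventually (gt_mem_nhds one_pos)
  filter_upwards [h1, h2, hN.eventually (eventually_ge_atTop 1)] with i h1 h2 h3
  refine ⟨h3, fun s₀ hs₀ y z hz => ?_⟩
  rw [packetKernel, norm_mul, Circle.norm_coe, one_mul]
  refine norm_le_of_profile_bound hΦb ?_
  have e1 : ‖ε i • γ s₀‖ ≤ 1 := by
    rw [norm_smul, Real.norm_eq_abs]
    calc |ε i| * ‖γ s₀‖ ≤ |ε i| * (|R| + 1) := by
          gcongr
          exact (hR s₀ hs₀).trans ((le_abs_self R).trans (by linarith))
      _ ≤ 1 := h2.le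
  have e2 : 1 / 2 * N i * ‖γ s₀ - y‖ ≤ ‖(N i * t i) • (γ s₀ - y)‖ := by
    rw [norm_smul, Real.norm_eq_abs, abs_of_pos (by positivity)]
    gcongr ?_ * _
    nlinarith
  have e3 := norm_sub_norm_le ((N i * t i) • (γ s₀ - y)) (ε i • γ s₀)
  rw [abs_mul, abs_of_pos (by positivity : 0 < 1 / 2 * N i)]
  have e4 : 1 / 2 * N i * |z| ≤ 1 / 2 * N i * ‖γ s₀ - y‖ := by gcongr
  linarith

/-- At a point of the arc, the superposition of the responses converges to the integral of the
profile over the tangent line. The hypothesis `hψ` says that the phase does not oscillate at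
distance `1 / N` from the point. -/
theorem tendsto_arcKernel_of_mem (hγ : Continuous γ) (hΦ : Continuous Φ)
    (hΦb : ∀ Z, ‖Φ Z‖ ≤ C / (1 + ‖Z‖ ^ 2)) (hρ : Continuous ρ) (hκ : 0 < κ)
    (hinj : ∀ x ∈ Icc c d, ∀ y ∈ Icc c d, κ * |x - y| ≤ ‖γ x - γ y‖)
    (hψc : ∀ i, Continuous fun q : ℝ × E => ψ i q.1 q.2) [l.IsCountablyGenerated]
    (hN : Tendsto N l atTop) (ht : Tendsto t l (𝓝 1)) (hε : Tendsto ε l (𝓝 0))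
    {s : ℝ} (hs : s ∈ Ioo c d) {v : E} (hv : HasDerivAt γ v s)
    (hψ : ∀ u, Tendsto (fun i => ψ i (s + u / N i) (γ s)) l (𝓝 0)) :
    Tendsto (fun i => arcKernel γ Φ (ψ i) ρ c d (N i) (t i) (ε i) (γ s)) l
      (𝓝 (ρ s * ∫ u : ℝ, Φ (u • v))) := by
  have hC : 0 ≤ C := by
    have := (norm_nonneg _).trans (hΦb 0)
    simpa using this
  obtain ⟨R, hR⟩ := isCompact_Icc.exists_bound_of_continuousOn (s := Icc c d) hρ.continuousOn
  have hsI : s ∈ Icc c d := Ioo_subset_Icc_self hs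
  have hR0 : 0 ≤ R := (norm_nonneg _).trans (hR s hsI)
  set F : ι → ℝ → ℂ := fun i => (Icc c d).indicator
    (fun s₀ => ρ s₀ * packetKernel γ Φ (ψ i) (N i) (t i) (ε i) s₀ (γ s)) with hF
  have hFm : ∀ i, Measurable (F i) := by
    intro i
    refine Measurable.indicator (Continuous.measurable ?_) measurableSet_Icc
    refine hρ.mul ((continuous_fourierChar_coe.comp
      ((hψc i).comp (continuous_id.prodMk continuous_const))).mul (hΦ.comp ?_))
    fun_prop
  have hNinv : Tendsto (fun i => (N i)⁻¹) l (𝓝 0) := tendsto_inv_atTop_zero.comp hN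
  have hpt : ∀ u : ℝ, Tendsto (fun i => s + u / N i) l (𝓝 s) := by
    intro u
    have : Tendsto (fun i => s + u * (N i)⁻¹) l (𝓝 (s + u * 0)) :=
      (hNinv.const_mul u).const_add s
    simpa [div_eq_mul_inv] using this
  -- in the variable `u = N (s₀ - s)` the integrands are dominated and converge pointwise
  have hlim : Tendsto (fun i => ∫ u, F i (s + u / N i)) l
      (𝓝 (∫ u : ℝ, ρ s * Φ (u • v))) := by
    refine tendsto_integral_filter_of_dominated_convergence
      (fun u => R * (3 * C) / (1 + (1 / 2 * κ * u) ^ 2)) ?_ ?_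
      (integrable_profile_bound _ (by positivity)) ?_
    · exact Eventually.of_forall fun i => ((hFm i).comp (by fun_prop)).aestronglyMeasurable
    · filter_upwards [eventually_norm_packetKernel_le (c := c) (d := d) (ψ := ψ) hγ hΦb hN ht hε]
        with i hi
      refine Eventually.of_forall fun u => ?_
      by_cases hu : s + u / N i ∈ Icc c d
      · simp only [hF]
        rw [indicator_of_mem hu, norm_mul, mul_div_assoc]
        have hN0 : 0 < N i := by linarith [hi.1]
        have h1 := hi.2 _ hu (γ s) (κ * (u / N i)) (by
          have := hinj _ hu _ hsI
          rw [add_sub_cancel_left] at this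
          rwa [abs_mul, abs_of_pos hκ])
        have e : 1 / 2 * N i * (κ * (u / N i)) = 1 / 2 * κ * u := by field_simp
        rw [e] at h1
        gcongr
        exact hR _ hu
      · simp only [hF]
        rw [indicator_of_notMem hu, norm_zero]
        positivity
    · refine Eventually.of_forall fun u => ?_
      have hmem : ∀ᶠ i in l, s + u / N i ∈ Icc c d := (hpt u).eventually (Icc_mem_nhds hs.1 hs.2)
      have h0 : Tendsto (fun i => ρ (s + u / N i) *
          packetKernel γ Φ (ψ i) (N i) (t i) (ε i) (s + u / N i) (γ s)) l
          (𝓝 (ρ s * (((Real.fourierChar 0 : Circle) : ℂ) * Φ (u • v)))) := by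
        refine ((hρ.tendsto s).comp (hpt u)).mul (Tendsto.mul ?_ ((hΦ.tendsto _).comp ?_))
        · exact (continuous_fourierChar_coe.tendsto 0).comp (hψ u)
        · have hd : HasDerivAt (fun x : ℝ => γ (s + x * u)) (u • v) 0 := by
            have h2 : HasDerivAt (fun x : ℝ => s + x * u) u 0 := by
              simpa using ((hasDerivAt_id (0 : ℝ)).mul_const u).const_add s
            have h3 : HasDerivAt γ v (s + 0 * u) := by simpa using hv
            exact h3.scomp 0 h2
          have h3 := hasDerivAt_iff_tendsto_slope_zero.1 hd
          have h4 : Tendsto (fun i => (N i)⁻¹) l (𝓝[≠] 0) := by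
            refine tendsto_nhdsWithin_iff.2 ⟨hNinv, ?_⟩
            filter_upwards [hN.eventually (eventually_gt_atTop 0)] with i hi
            exact inv_ne_zero hi.ne'
          have h5 := h3.comp h4
          have h6 : Tendsto (fun i => t i • (N i • (γ (s + u / N i) - γ s)) -
              ε i • γ (s + u / N i)) l (𝓝 ((1 : ℝ) • (u • v) - (0 : ℝ) • γ s)) := by
            refine (ht.smul ?_).sub (hε.smul ((hγ.tendsto s).comp (hpt u)))
            refine h5.congr fun i => ?_
            simp [div_eq_mul_inv, mul_comm]
          rw [one_smul, zero_smul, sub_zero] at h6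
          refine h6.congr fun i => ?_
          rw [smul_smul, mul_comm (t i)]
      rw [AddChar.map_zero_eq_one, Circle.coe_one, one_mul] at h0
      refine h0.congr' ?_
      filter_upwards [hmem] with i hi
      simp only [hF]
      rw [indicator_of_mem hi]
  rw [integral_const_mul] at hlim
  refine hlim.congr' ?_
  filter_upwards [hN.eventually (eventually_gt_atTop 0)] with i hi
  rw [← integral_dilate_real (F i) s hi, arcKernel, ← integral_indicator measurableSet_Icc]
  congr 1 with x
  simp only [hF]
  by_cases hx : x ∈ Icc c d
  · rw [indicator_of_mem hx, indicator_of_mem hx]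
  · rw [indicator_of_notMem hx, indicator_of_notMem hx, smul_zero]

/-- Uniform bound for the superpositions, on and off the arc. -/
theorem eventually_norm_arcKernel_le (hγ : Continuous γ)
    (hΦb : ∀ Z, ‖Φ Z‖ ≤ C / (1 + ‖Z‖ ^ 2)) (hρ : Continuous ρ) (hκ : 0 < κ) (hcd : c ≤ d)
    (hinj : ∀ x ∈ Icc c d, ∀ y ∈ Icc c d, κ * |x - y| ≤ ‖γ x - γ y‖)
    (hN : Tendsto N l atTop) (ht : Tendsto t l (𝓝 1)) (hε : Tendsto ε l (𝓝 0)) :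
    ∃ A : ℝ, ∀ᶠ i in l, ∀ y, ‖arcKernel γ Φ (ψ i) ρ c d (N i) (t i) (ε i) y‖ ≤ A := by
  have hC : 0 ≤ C := by
    have := (norm_nonneg _).trans (hΦb 0)
    simpa using this
  obtain ⟨R, hR⟩ := isCompact_Icc.exists_bound_of_continuousOn (s := Icc c d) hρ.continuousOn
  have hR0 : 0 ≤ R := (norm_nonneg _).trans (hR c ⟨le_rfl, hcd⟩)
  set m := 1 / 2 * (κ / 2) with hm
  have hm0 : 0 < m := by positivity
  refine ⟨∫ u : ℝ, R * (3 * C) / (1 + (m * u) ^ 2), ?_⟩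
  filter_upwards [eventually_norm_packetKernel_le (c := c) (d := d) (ψ := ψ) hγ hΦb hN ht hε]
    with i hi y
  have hN0 : 0 < N i := by linarith [hi.1]
  -- compare with the point of the arc that is closest to `y`
  obtain ⟨s, hs, hsmin⟩ := isCompact_Icc.exists_isMinOn (s := Icc c d) ⟨c, ⟨le_rfl, hcd⟩⟩
    (f := fun x => ‖γ x - y‖) (by fun_prop)
  have hnear : ∀ x ∈ Icc c d, κ / 2 * |x - s| ≤ ‖γ x - y‖ := by
    intro x hx
    have h1 := hinj x hx s hs
    have h2 : ‖γ s - y‖ ≤ ‖γ x - y‖ := hsmin hx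
    have h3 : ‖γ x - γ s‖ ≤ ‖γ x - y‖ + ‖γ s - y‖ := by
      have := norm_sub_le (γ x - y) (γ s - y)
      simpa using this
    linarith
  set b : ℝ → ℝ := fun u => R * (3 * C) / (1 + (m * u) ^ 2) with hb
  have hbi : Integrable b := integrable_profile_bound _ hm0
  have hb0 : ∀ u, 0 ≤ b u := fun u => by simp only [hb]; positivity
  have hchange : ∫ x, N i * b (N i * (x - s)) = ∫ u, b u := by
    rw [integral_const_mul, integral_sub_right_eq_self (fun x => b (N i * x)) s,
      Measure.integral_comp_mul_left, abs_of_pos (inv_pos.2 hN0), smul_eq_mul, ← mul_assoc,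
      mul_inv_cancel₀ hN0.ne', one_mul]
  have hbi' : Integrable fun x => N i * b (N i * (x - s)) := by
    have : Integrable fun x => b (N i * x) := hbi.comp_mul_left' hN0.ne'
    exact (this.comp_sub_right s).const_mul _
  calc ‖arcKernel γ Φ (ψ i) ρ c d (N i) (t i) (ε i) y‖
      ≤ ∫ x in Icc c d, N i * b (N i * (x - s)) := by
        refine norm_integral_le_of_norm_le hbi'.integrableOn ?_
        refine (ae_restrict_iff' measurableSet_Icc).2 (Eventually.of_forall fun x hx => ?_)
        rw [norm_smul, Real.norm_eq_abs, abs_of_pos hN0, norm_mul]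
        have h1 := hi.2 x hx y (κ / 2 * (x - s)) (by
          rw [abs_mul, abs_of_pos (by positivity)]; exact hnear x hx)
        have e : 1 / 2 * N i * (κ / 2 * (x - s)) = m * (N i * (x - s)) := by rw [hm]; ring
        rw [e] at h1
        simp only [hb]
        rw [mul_div_assoc]
        gcongr
        exact hR x hx
    _ ≤ ∫ x, N i * b (N i * (x - s)) := setIntegral_le_integral hbi'
        (Eventually.of_forall fun x => mul_nonneg hN0.le (hb0 _))
    _ = _ := hchange

theorem tendsto_arcKernel_of_notMem (hγ : Continuous γ)
    (hΦb : ∀ Z, ‖Φ Z‖ ≤ C / (1 + ‖Z‖ ^ 2)) (hρ : Continuous ρ) (hcd : c ≤ d)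
    (hN : Tendsto N l atTop) (ht : Tendsto t l (𝓝 1)) (hε : Tendsto ε l (𝓝 0))
    {y : E} (hy : y ∉ γ '' Icc c d) :
    Tendsto (fun i => arcKernel γ Φ (ψ i) ρ c d (N i) (t i) (ε i) y) l (𝓝 0) := by
  have hC : 0 ≤ C := by
    have := (norm_nonneg _).trans (hΦb 0)
    simpa using this
  obtain ⟨R, hR⟩ := isCompact_Icc.exists_bound_of_continuousOn (s := Icc c d) hρ.continuousOn
  have hR0 : 0 ≤ R := (norm_nonneg _).trans (hR c ⟨le_rfl, hcd⟩)
  obtain ⟨s, hs, hsmin⟩ := isCompact_Icc.exists_isMinOn (s := Icc c d) ⟨c, ⟨le_rfl, hcd⟩⟩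
    (f := fun x => ‖γ x - y‖) (by fun_prop)
  set δ := ‖γ s - y‖ with hδ
  have hδ0 : 0 < δ := norm_pos_iff.2 (sub_ne_zero.2 fun h => hy ⟨s, hs, h⟩)
  have hlim : Tendsto (fun i => R * (12 * C / δ ^ 2) * (d - c) * (N i)⁻¹) l
      (𝓝 (R * (12 * C / δ ^ 2) * (d - c) * 0)) := (tendsto_inv_atTop_zero.comp hN).const_mul _
  rw [mul_zero] at hlim
  refine squeeze_zero_norm' ?_ hlim
  filter_upwards [eventually_norm_packetKernel_le (c := c) (d := d) (ψ := ψ) hγ hΦb hN ht hε]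
    with i hi
  have hN0 : 0 < N i := by linarith [hi.1]
  have := norm_setIntegral_le_of_norm_le_const (μ := volume) (s := Icc c d)
    (f := fun s₀ => (N i : ℝ) • (ρ s₀ * packetKernel γ Φ (ψ i) (N i) (t i) (ε i) s₀ y))
    (C := R * (12 * C / δ ^ 2) * (N i)⁻¹) (by simp) (fun x hx => by
      rw [norm_smul, Real.norm_eq_abs, abs_of_pos hN0, norm_mul]
      have h1 := hi.2 x hx y δ (by rw [abs_of_pos hδ0]; exact hsmin hx)
      calc N i * (‖ρ x‖ * ‖packetKernel γ Φ (ψ i) (N i) (t i) (ε i) x y‖)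
          ≤ N i * (R * (3 * C / (1 + (1 / 2 * N i * δ) ^ 2))) := by
            gcongr
            exact hR x hx
        _ ≤ N i * (R * (3 * C / ((1 / 2 * N i * δ) ^ 2))) := by
            gcongr
            linarith
        _ = R * (12 * C / δ ^ 2) * (N i)⁻¹ := by field_simp; ring)
  rw [Real.volume_real_Icc_of_le hcd] at this
  calc _ ≤ R * (12 * C / δ ^ 2) * (N i)⁻¹ * (d - c) := this
    _ = _ := by ring

theorem continuous_packetKernel (hγ : Continuous γ) (hΦ : Continuous Φ) {ψ : ℝ → E → ℝ}
    (hψc : Continuous fun q : ℝ × E => ψ q.1 q.2) (N t ε : ℝ) :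
    Continuous fun q : ℝ × E => packetKernel γ Φ ψ N t ε q.1 q.2 :=
  (continuous_fourierChar_coe.comp hψc).mul
    (hΦ.comp (by fun_prop))

/-- Convergence of the superposed responses to the integral of `G`, which is the weight `ρ` times
the integral of the profile over the tangent line, against the part of `μ₁` on the arc. -/
theorem tendsto_integral_packets [MeasurableSpace E] [BorelSpace E] (hγ : Continuous γ)
    (hΦ : Continuous Φ) (hΦb : ∀ Z, ‖Φ Z‖ ≤ C / (1 + ‖Z‖ ^ 2)) (hρ : Continuous ρ) (hκ : 0 < κ)
    (hcd : c ≤ d)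
    (hinj : ∀ x ∈ Icc c d, ∀ y ∈ Icc c d, κ * |x - y| ≤ ‖γ x - γ y‖)
    (hψc : ∀ i, Continuous fun q : ℝ × E => ψ i q.1 q.2) [l.IsCountablyGenerated]
    (hN : Tendsto N l atTop) (ht : Tendsto t l (𝓝 1)) (hε : Tendsto ε l (𝓝 0))
    {v : ℝ → E} (hv : ∀ s ∈ Ioo c d, HasDerivAt γ (v s) s)
    (hψ : ∀ s ∈ Ioo c d, ∀ u, Tendsto (fun i => ψ i (s + u / N i) (γ s)) l (𝓝 0))
    {χ : ℝ → ℝ} (hχ : Continuous χ) (hχs : HasCompactSupport χ)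
    (hfib : ∀ y, volume (tsupport χ ∩ γ ⁻¹' {y}) = 0)
    {G : E → ℝ} (hG : ∀ s ∈ Ioo c d, ρ s * ∫ u : ℝ, Φ (u • v s) = G (γ s)) :
    Tendsto (fun i => ∫ s₀ in Icc c d, ρ s₀ *
        ((N i : ℝ) • ∫ s, (χ s : ℂ) * packetKernel γ Φ (ψ i) (N i) (t i) (ε i) s₀ (γ s))) l
      (𝓝 ((∫ u in γ ⁻¹' (γ '' Icc c d), χ u * G (γ u) : ℝ) : ℂ)) := by
  have hK : IsCompact (tsupport χ) := hχs
  have hKm : MeasurableSet (tsupport χ) := (isClosed_tsupport χ).measurableSet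
  have hAm : MeasurableSet (γ '' Icc c d) := (isCompact_Icc.image hγ).isClosed.measurableSet
  have hsupp : ∀ g : ℝ → ℂ, ∫ s, (χ s : ℂ) * g s = ∫ s in tsupport χ, (χ s : ℂ) * g s := by
    intro g
    rw [setIntegral_eq_integral_of_forall_compl_eq_zero]
    intro s hs
    rw [image_eq_zero_of_notMem_tsupport hs]; simp
  -- exchange the two integrations
  have hswap : ∀ i, ∫ s₀ in Icc c d, ρ s₀ *
        ((N i : ℝ) • ∫ s, (χ s : ℂ) * packetKernel γ Φ (ψ i) (N i) (t i) (ε i) s₀ (γ s)) =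
      ∫ s in tsupport χ, (χ s : ℂ) * arcKernel γ Φ (ψ i) ρ c d (N i) (t i) (ε i) (γ s) := by
    intro i
    have hc : Continuous fun q : ℝ × ℝ => (N i : ℝ) • (ρ q.1 * ((χ q.2 : ℂ) *
        packetKernel γ Φ (ψ i) (N i) (t i) (ε i) q.1 (γ q.2))) := by
      have := (continuous_packetKernel hγ hΦ (hψc i) (N i) (t i) (ε i)).comp
        (continuous_fst.prodMk (hγ.comp continuous_snd) : Continuous fun q : ℝ × ℝ => (q.1, γ q.2))
      have h2 : Continuous fun q : ℝ × ℝ => packetKernel γ Φ (ψ i) (N i) (t i) (ε i) q.1 (γ q.2) :=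
        this
      fun_prop
    have h1 := integral_integral_swap (μ := volume.restrict (Icc c d))
      (ν := volume.restrict (tsupport χ)) (f := fun s₀ s => (N i : ℝ) • (ρ s₀ * ((χ s : ℂ) *
        packetKernel γ Φ (ψ i) (N i) (t i) (ε i) s₀ (γ s)))) (by
        rw [Measure.prod_restrict]
        exact hc.continuousOn.integrableOn_compact (isCompact_Icc.prod hK))
    calc _ = ∫ s₀ in Icc c d, ∫ s in tsupport χ, (N i : ℝ) • (ρ s₀ * ((χ s : ℂ) *
        packetKernel γ Φ (ψ i) (N i) (t i) (ε i) s₀ (γ s))) := by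
          refine integral_congr_ae (Eventually.of_forall fun s₀ => ?_)
          simp only
          rw [hsupp, integral_smul, integral_const_mul, mul_smul_comm]
      _ = _ := h1
      _ = _ := by
          refine integral_congr_ae (Eventually.of_forall fun s => ?_)
          simp only [arcKernel]
          rw [← integral_const_mul]
          refine integral_congr_ae (Eventually.of_forall fun s₀ => ?_)
          simp only [Complex.real_smul]
          ring
  simp_rw [hswap]
  obtain ⟨A, hA⟩ := eventually_norm_arcKernel_le (ψ := ψ) hγ hΦb hρ hκ hcd hinj hN ht hε
  have hlimit : ((∫ u in γ ⁻¹' (γ '' Icc c d), χ u * G (γ u) : ℝ) : ℂ) =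
      ∫ s in tsupport χ, (χ s : ℂ) *
        ((γ ⁻¹' (γ '' Icc c d)).indicator (fun s => (G (γ s) : ℂ)) s) := by
    rw [← integral_complex_ofReal, ← hsupp, ← integral_indicator (hAm.preimage hγ.measurable)]
    congr 1 with s
    by_cases hs : s ∈ γ ⁻¹' (γ '' Icc c d)
    · rw [indicator_of_mem hs, indicator_of_mem hs]; push_cast; rfl
    · rw [indicator_of_notMem hs, indicator_of_notMem hs, mul_zero]
  rw [hlimit]
  refine tendsto_integral_filter_of_dominated_convergence (fun s => |χ s| * A) ?_ ?_ ?_ ?_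
  · refine Eventually.of_forall fun i => Continuous.aestronglyMeasurable ?_
    refine (Complex.continuous_ofReal.comp hχ).mul ?_
    simp only [arcKernel]
    refine continuous_parametric_integral_of_continuous ?_ isCompact_Icc
    have h2 : Continuous fun q : ℝ × ℝ => packetKernel γ Φ (ψ i) (N i) (t i) (ε i) q.2 (γ q.1) :=
      (continuous_packetKernel hγ hΦ (hψc i) (N i) (t i) (ε i)).comp
        (continuous_snd.prodMk (hγ.comp continuous_fst) : Continuous fun q : ℝ × ℝ => (q.2, γ q.1))
    simp only [Function.uncurry_def]
    fun_prop
  · filter_upwards [hA] with i hi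
    refine Eventually.of_forall fun s => ?_
    rw [norm_mul, Complex.norm_real, Real.norm_eq_abs]
    gcongr
    exact hi _
  · exact ((hχ.abs.mul continuous_const).continuousOn).integrableOn_compact hK
  · -- the end points of the arc, where the limit may differ, are met in a null set of parameters
    have h1 : ∀ᵐ s ∂volume.restrict (tsupport χ), γ s ≠ γ c ∧ γ s ≠ γ d := by
      rw [ae_restrict_iff' hKm]
      have h1 := measure_eq_zero_iff_ae_notMem.1 (hfib (γ c))
      have h2 := measure_eq_zero_iff_ae_notMem.1 (hfib (γ d))
      filter_upwards [h1, h2] with s h1 h2 hs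
      exact ⟨fun h => h1 ⟨hs, h⟩, fun h => h2 ⟨hs, h⟩⟩
    filter_upwards [h1] with s hs
    refine Tendsto.const_mul _ ?_
    by_cases hm : s ∈ γ ⁻¹' (γ '' Icc c d)
    · rw [indicator_of_mem hm]
      obtain ⟨s', hs', he⟩ := hm
      have hs'' : s' ∈ Ioo c d := by
        refine ⟨lt_of_le_of_ne hs'.1 ?_, lt_of_le_of_ne hs'.2 ?_⟩
        · rintro rfl; exact hs.1 he.symm
        · rintro rfl; exact hs.2 he.symm
      rw [← he, ← hG s' hs'']
      exact tendsto_arcKernel_of_mem hγ hΦ hΦb hρ hκ hinj hψc hN ht hε hs'' (hv s' hs'')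
        (hψ s' hs'')
    · rw [indicator_of_notMem hm]
      exact tendsto_arcKernel_of_notMem hγ hΦb hρ hcd hN ht hε hm

end Concentration

/-! ### Choice of the arc and of the weight -/

section Arcs

variable {E : Type*} [NormedAddCommGroup E] [InnerProductSpace ℝ E]

omit [InnerProductSpace ℝ E] in
theorem continuousAt_lineIntegral [NormedSpace ℝ E] {Φ : E → ℂ} (hΦ : Continuous Φ) {C : ℝ}
    (hΦb : ∀ Z, ‖Φ Z‖ ≤ C / (1 + ‖Z‖ ^ 2)) {v : E} (hv : v ≠ 0) :
    ContinuousAt (fun v : E => ∫ u : ℝ, Φ (u • v)) v := by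
  have hC : 0 ≤ C := by
    have := (norm_nonneg _).trans (hΦb 0)
    simpa using this
  have hv0 : 0 < ‖v‖ := norm_pos_iff.2 hv
  refine continuousAt_of_dominated (bound := fun u => C / (1 + (‖v‖ / 2 * u) ^ 2)) ?_ ?_
    (integrable_profile_bound C (by positivity)) ?_
  · exact Eventually.of_forall fun x => Continuous.aestronglyMeasurable (by fun_prop)
  · have h1 : ∀ᶠ x in 𝓝 v, ‖v‖ / 2 < ‖x‖ :=
      (continuous_norm.tendsto v).eventually (lt_mem_nhds (by linarith))
    filter_upwards [h1] with x hx
    refine Eventually.of_forall fun u => (hΦb _).trans ?_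
    rw [norm_smul, mul_comm ‖u‖, mul_pow, mul_pow, Real.norm_eq_abs, sq_abs]
    gcongr
  · exact Eventually.of_forall fun u => by fun_prop

/-- The arc and the weight. Near a suitable point `s₁` the weight is chosen as
`ρ s = G (γ s) / ∫ Φ s₁ (u γ'(s)) du`, so that `ρ` times the line integral is a given function `G`
of the point on the curve; the profile `Φ s₁` may depend on `s₁`. -/
theorem exists_arc [MeasurableSpace E] [BorelSpace E] {γ : ℝ → E} (hγ : Continuous γ) {a b : ℝ}
    (hγs : ∀ s ∈ Ioo a b, HasStrictDerivAt γ (deriv γ s) s) (hγ0 : ∀ s ∈ Ioo a b, deriv γ s ≠ 0)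
    (hγc : ContinuousOn (deriv γ) (Ioo a b)) {χ : ℝ → ℝ} (hχ : Continuous χ)
    (hχs : HasCompactSupport χ) (hχab : tsupport χ ⊆ Ioo a b) {g : E → ℂ} (hg : Continuous g)
    (hμ : ∫ s, g (γ s) * (χ s : ℂ) ≠ 0) {Φ : ℝ → E → ℂ} (hΦ : ∀ s, Continuous (Φ s)) {C : ℝ}
    (hΦb : ∀ s Z, ‖Φ s Z‖ ≤ C / (1 + ‖Z‖ ^ 2))
    (hΦ0 : ∀ s ∈ Ioo a b, ∫ u : ℝ, Φ s (u • deriv γ s) ≠ 0) :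
    ∃ s₁ ∈ Ioo a b, ∃ c d κ : ℝ, c < d ∧ Icc c d ⊆ Ioo a b ∧ 0 < κ ∧
      (∀ x ∈ Icc c d, ∀ y ∈ Icc c d, κ * |x - y| ≤ ‖γ x - γ y‖) ∧
      ∃ (ρ : ℝ → ℂ) (G : E → ℝ), Continuous ρ ∧
        (∀ s ∈ Ioo c d, ρ s * ∫ u : ℝ, Φ s₁ (u • deriv γ s) = G (γ s)) ∧
        ∫ u in γ ⁻¹' (γ '' Icc c d), χ u * G (γ u) ≠ 0 := by
  have hloc : ∀ s ∈ Ioo a b, ∃ δ > 0, Icc (s - δ) (s + δ) ⊆ Ioo a b ∧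
      (∀ x ∈ Icc (s - δ) (s + δ), ∀ y ∈ Icc (s - δ) (s + δ),
        ‖deriv γ s‖ / 2 * |x - y| ≤ ‖γ x - γ y‖) ∧
      (∀ x ∈ Icc (s - δ) (s + δ), ∫ u : ℝ, Φ s (u • deriv γ x) ≠ 0) := by
    intro s hs
    obtain ⟨δ₁, hδ₁, h1⟩ := exists_mul_abs_sub_le_norm_sub (hγs s hs) (hγ0 s hs)
    have hc : ContinuousAt (fun x => ∫ u : ℝ, Φ s (u • deriv γ x)) s :=
      ContinuousAt.comp (f := deriv γ) (g := fun v => ∫ u : ℝ, Φ s (u • v))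
        (continuousAt_lineIntegral (hΦ s) (hΦb s) (hγ0 s hs))
        (hγc.continuousAt (Ioo_mem_nhds hs.1 hs.2))
    have h2 : ∀ᶠ x in 𝓝 s, x ∈ Ioo a b ∧ ∫ u : ℝ, Φ s (u • deriv γ x) ≠ 0 :=
      Filter.Eventually.and (Ioo_mem_nhds hs.1 hs.2) (hc.eventually_ne (hΦ0 s hs))
    obtain ⟨δ₂, hδ₂, h3⟩ := Metric.eventually_nhds_iff.1 h2
    have hsub1 : Icc (s - min δ₁ (δ₂ / 2)) (s + min δ₁ (δ₂ / 2)) ⊆ Icc (s - δ₁) (s + δ₁) :=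
      Icc_subset_Icc (by linarith [min_le_left δ₁ (δ₂ / 2)]) (by linarith [min_le_left δ₁ (δ₂ / 2)])
    have hsub2 : ∀ x ∈ Icc (s - min δ₁ (δ₂ / 2)) (s + min δ₁ (δ₂ / 2)), dist x s < δ₂ := by
      intro x hx
      have := min_le_right δ₁ (δ₂ / 2)
      rw [Real.dist_eq, abs_lt]
      constructor <;> linarith [hx.1, hx.2]
    exact ⟨min δ₁ (δ₂ / 2), lt_min hδ₁ (half_pos hδ₂), fun x hx => (h3 (hsub2 x hx)).1,
      fun x hx y hy => h1 x (hsub1 hx) y (hsub1 hy), fun x hx => (h3 (hsub2 x hx)).2⟩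
  choose! δ hδ0 hδ1 hδ2 hδ3 using hloc
  obtain ⟨s, hs, G, hG⟩ := exists_arc_integral_ne_zero hγ hχ hχs hg hμ
    (fun s => Icc (s - δ s) (s + δ s)) (fun s hs => ⟨isCompact_Icc, Icc_mem_nhds
      (by linarith [hδ0 s (hχab hs)]) (by linarith [hδ0 s (hχab hs)])⟩)
  have hs' := hχab hs
  have hlt : s - δ s < s + δ s := by linarith [hδ0 s hs']
  let π := projIcc (s - δ s) (s + δ s) hlt.le
  have hw : ContinuousOn (fun x => ∫ u : ℝ, Φ s (u • deriv γ x)) (Icc (s - δ s) (s + δ s)) := by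
    intro x hx
    have hx' := hδ1 s hs' hx
    exact (ContinuousAt.comp (f := deriv γ) (g := fun v => ∫ u : ℝ, Φ s (u • v))
        (continuousAt_lineIntegral (hΦ s) (hΦb s) (hγ0 x hx'))
        (hγc.continuousAt (Ioo_mem_nhds hx'.1 hx'.2))).continuousWithinAt
  refine ⟨s, hs', s - δ s, s + δ s, ‖deriv γ s‖ / 2, hlt, hδ1 s hs',
    half_pos (norm_pos_iff.2 (hγ0 s hs')), hδ2 s hs',
    fun x => (G (γ (π x)) : ℂ) / ∫ u : ℝ, Φ s (u • deriv γ (π x)), G, ?_, ?_, hG⟩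
  · refine Continuous.div ?_ ?_ fun x => hδ3 s hs' _ (π x).2
    · exact Complex.continuous_ofReal.comp (G.continuous.comp
        (hγ.comp (continuous_subtype_val.comp continuous_projIcc)))
    · exact (continuousOn_iff_continuous_domRestrict.1 hw).comp continuous_projIcc
  · intro x hx
    have hx' := Ioo_subset_Icc_self hx
    have hπ : (π x : ℝ) = x := by simp only [π, projIcc_of_mem _ hx']
    simp only [hπ]
    exact div_mul_cancel₀ _ (hδ3 s hs' x hx')

end Arcs

/-! ### From integrals along the arc to sums over packets -/

section Cells

/-- An integral over `[c, d]` as the average over `v ∈ [0, 1]` of the Riemann sums with nodes at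
relative position `v` in each of `m` equal cells. -/
theorem setIntegral_Icc_eq_cells {g : ℝ → ℂ} (hg : Continuous g) {c d : ℝ} (hcd : c < d) {m : ℕ}
    (hm : 0 < m) :
    ∫ s in Icc c d, g s = ∫ v in Icc (0 : ℝ) 1,
      (((d - c) / m : ℝ) : ℂ) * ∑ k ∈ Finset.range m, g (c + (d - c) / m * (k + v)) := by
  have hm' : (0 : ℝ) < m := by exact_mod_cast hm
  set h := (d - c) / m with hh
  have hh0 : 0 < h := div_pos (by linarith) hm'
  rw [integral_Icc_eq_integral_Ioc, integral_Icc_eq_integral_Ioc,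
    ← intervalIntegral.integral_of_le hcd.le, ← intervalIntegral.integral_of_le zero_le_one,
    intervalIntegral.integral_const_mul, intervalIntegral.integral_finsetSum]
  · have h1 := intervalIntegral.sum_integral_adjacent_intervals (f := g) (μ := volume)
      (a := fun k : ℕ => c + h * k) (n := m) (fun k _ => hg.intervalIntegrable _ _)
    have e : c + h * (m : ℝ) = d := by rw [hh]; field_simp; ring
    simp only [Nat.cast_zero, mul_zero, add_zero, e] at h1
    rw [← h1, Finset.mul_sum]
    refine Finset.sum_congr rfl fun k _ => ?_
    have h2 := intervalIntegral.smul_integral_comp_add_mul (f := g) (a := 0) (b := 1) h (c + h * k)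
    have e3 : ∀ v : ℝ, c + h * (k + v) = c + h * k + h * v := fun v => by ring
    simp only [e3]
    rw [Complex.real_smul] at h2
    rw [h2]
    push_cast
    ring_nf
  · intro k _
    exact Continuous.intervalIntegrable (by fun_prop) _ _

/-- A lower bound for integrals over `[c, d]`, uniform in `t`, passes to the Riemann sums for some
position `v` of the nodes, in the mean over `t`. -/
theorem exists_cell_shift {R : ℝ → ℝ → ℂ} (hR : Continuous fun q : ℝ × ℝ => R q.1 q.2)
    {c d : ℝ} (hcd : c < d) {m : ℕ} (hm : 0 < m) {S : Set ℝ} (hS : MeasurableSet S)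
    (hSf : volume S ≠ ⊤) {A : ℝ} (hA : ∀ t ∈ S, A ≤ ‖∫ s in Icc c d, R s t‖)
    (hSc : ∃ K, IsCompact K ∧ S ⊆ K) :
    ∃ v ∈ Icc (0 : ℝ) 1, ENNReal.ofReal (A * (m / (d - c))) * volume S ≤
      ∫⁻ t in S, ‖∑ k ∈ Finset.range m, R (c + (d - c) / m * (k + v)) t‖ₑ := by
  have hm' : (0 : ℝ) < m := by exact_mod_cast hm
  set h := (d - c) / m with hh
  have hh0 : 0 < h := div_pos (by linarith) hm'
  set V : ℝ → ℝ → ℂ := fun v t => ∑ k ∈ Finset.range m, R (c + h * (k + v)) t with hV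
  have hVc : Continuous fun q : ℝ × ℝ => V q.1 q.2 := by
    simp only [hV]
    refine continuous_finsetSum _ fun k _ => ?_
    exact hR.comp (by fun_prop : Continuous fun q : ℝ × ℝ => (c + h * (k + q.1), q.2))
  have h1 : ∀ t ∈ S, ENNReal.ofReal (A * (m / (d - c))) ≤ ∫⁻ v in Icc (0 : ℝ) 1, ‖V v t‖ₑ := by
    intro t ht
    have e : ∫ s in Icc c d, R s t = (h : ℂ) * ∫ v in Icc (0 : ℝ) 1, V v t := by
      have hRt : Continuous fun s => R s t :=
        hR.comp (by fun_prop : Continuous fun s : ℝ => (s, t))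
      rw [setIntegral_Icc_eq_cells hRt hcd hm, integral_const_mul]
    have h2 := hA t ht
    rw [e, norm_mul, Complex.norm_real, Real.norm_eq_abs, abs_of_pos hh0] at h2
    have h3 : A * (m / (d - c)) ≤ ‖∫ v in Icc (0 : ℝ) 1, V v t‖ := by
      have : (m : ℝ) / (d - c) = h⁻¹ := by rw [hh, inv_div]
      rw [this, mul_inv_le_iff₀ hh0, mul_comm]; exact h2
    calc ENNReal.ofReal (A * (m / (d - c))) ≤ ENNReal.ofReal ‖∫ v in Icc (0 : ℝ) 1, V v t‖ :=
          ENNReal.ofReal_le_ofReal h3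
      _ = ‖∫ v in Icc (0 : ℝ) 1, V v t‖ₑ := ofReal_norm _
      _ ≤ _ := enorm_integral_le_lintegral_enorm _
  have hVm : Measurable fun q : ℝ × ℝ => ‖V q.1 q.2‖ₑ := hVc.enorm.measurable
  have h2 : ENNReal.ofReal (A * (m / (d - c))) * volume S ≤
      ∫⁻ v in Icc (0 : ℝ) 1, ∫⁻ t in S, ‖V v t‖ₑ := by
    rw [lintegral_lintegral_swap hVm.aemeasurable, ← setLIntegral_const]
    exact setLIntegral_mono' hS h1
  have : IsProbabilityMeasure (volume.restrict (Icc (0 : ℝ) 1)) := ⟨by simp⟩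
  have hnull : (volume.restrict (Icc (0 : ℝ) 1)) (Icc (0 : ℝ) 1)ᶜ = 0 := by
    rw [Measure.restrict_apply measurableSet_Icc.compl]; simp
  have hfin : ∫⁻ v in Icc (0 : ℝ) 1, ∫⁻ t in S, ‖V v t‖ₑ ≠ ⊤ := by
    obtain ⟨K, hK, hSK⟩ := hSc
    obtain ⟨M, hM⟩ := ((isCompact_Icc (a := (0 : ℝ)) (b := 1)).prod hK).exists_bound_of_continuousOn
      hVc.continuousOn
    refine ne_top_of_le_ne_top (b := ENNReal.ofReal M * volume S * 1) (by finiteness) ?_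
    calc _ ≤ ∫⁻ v in Icc (0 : ℝ) 1, ENNReal.ofReal M * volume S := by
          refine setLIntegral_mono' measurableSet_Icc fun v hv => ?_
          rw [← setLIntegral_const]
          refine setLIntegral_mono' hS fun t ht => ?_
          rw [← ofReal_norm]
          exact ENNReal.ofReal_le_ofReal (hM (v, t) ⟨hv, hSK ht⟩)
      _ = _ := by rw [setLIntegral_const]; simp
  obtain ⟨v, hv, h3⟩ := exists_notMem_null_lintegral_le hfin hnull
  exact ⟨v, not_not.1 hv, h2.trans h3⟩

end Cells

/-! ### Norms of superpositions of wave packets -/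

section Norms

variable {E : Type*} [NormedAddCommGroup E] [InnerProductSpace ℝ E] [FiniteDimensional ℝ E]
  [MeasurableSpace E] [BorelSpace E]

theorem lintegral_decay_le {M : ℕ} (hM : Module.finrank ℝ E < M) :
    ∃ K : ℝ, 0 < K ∧ ∀ (N : ℝ) (a : E), 0 < N →
      ∫⁻ x : E, ENNReal.ofReal (((1 + N * ‖x - a‖) ^ M)⁻¹) ≤
        ENNReal.ofReal (K * (N ^ Module.finrank ℝ E)⁻¹) := by
  have hint : Integrable fun x : E => ((1 + ‖x‖) ^ M)⁻¹ := by
    have := integrable_one_add_norm (E := E) (μ := volume) (r := M) (by exact_mod_cast hM)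
    refine this.congr (Eventually.of_forall fun x => ?_)
    simp only
    rw [Real.rpow_neg (by positivity), Real.rpow_natCast]
  refine ⟨(∫ x : E, ((1 + ‖x‖) ^ M)⁻¹) + 1, ?_, fun N a hN => ?_⟩
  · have : 0 ≤ ∫ x : E, ((1 + ‖x‖) ^ M)⁻¹ := integral_nonneg fun x => by positivity
    linarith
  · have h1 : ∀ x : E, ((1 + N * ‖x - a‖) ^ M)⁻¹ =
        (fun y : E => ((1 + ‖y‖) ^ M)⁻¹) (N • (x - a)) := by
      intro x
      simp only [norm_smul, Real.norm_eq_abs, abs_of_pos hN]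
    have hint2 : Integrable fun x : E => ((1 + N * ‖x - a‖) ^ M)⁻¹ := by
      simp_rw [h1]
      exact (hint.comp_smul hN.ne').comp_sub_right a
    rw [← ofReal_integral_eq_lintegral_ofReal hint2 (Eventually.of_forall fun x => by positivity)]
    refine ENNReal.ofReal_le_ofReal ?_
    simp_rw [h1]
    rw [integral_sub_right_eq_self (fun x : E => ((1 + ‖N • x‖) ^ M)⁻¹) a,
      Measure.integral_comp_smul volume (fun y : E => ((1 + ‖y‖) ^ M)⁻¹) N,
      abs_of_nonneg (by positivity), smul_eq_mul, mul_comm]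
    gcongr
    linarith

/-- The `L^p` norm of a function of height `A` that is concentrated at scale `N⁻¹` about `a`. -/
theorem eLpNorm_le_of_decay {M : ℕ} (hM : Module.finrank ℝ E < M) {p : ℝ≥0∞} (hp : 1 ≤ p) :
    ∃ K : ℝ, 0 < K ∧ ∀ (N A : ℝ) (a : E) (F : E → ℂ), 0 < N → 0 < A →
      (∀ x, (1 + N * ‖x - a‖) ^ M * ‖F x‖ ≤ A) →
      eLpNorm F p volume ≤
        ENNReal.ofReal (A * (K * ((N ^ Module.finrank ℝ E)⁻¹) ^ p.toReal⁻¹)) := by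
  obtain ⟨K, hK, h⟩ := lintegral_decay_le (E := E) hM
  refine ⟨K ^ p.toReal⁻¹, by positivity, fun N A a F hN hA hF => ?_⟩
  have hb : ∀ x, ‖F x‖ ≤ A * ((1 + N * ‖x - a‖) ^ M)⁻¹ := by
    intro x
    rw [← div_eq_mul_inv, le_div_iff₀ (by positivity), mul_comm]
    exact hF x
  have h1 := eLpNorm_le_interpolate (μ := (volume : Measure E)) (f := F) hp hA
    (B := A * (K * (N ^ Module.finrank ℝ E)⁻¹)) (by positivity)
    (fun x => (hb x).trans (mul_le_of_le_one_right hA.le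
      (inv_le_one_of_one_le₀ (one_le_pow₀ (by
        have : 0 ≤ N * ‖x - a‖ := by positivity
        linarith)))))
    (by
      rw [ENNReal.ofReal_mul hA.le]
      calc ∫⁻ x, ‖F x‖ₑ ≤ ∫⁻ x, ENNReal.ofReal A *
            ENNReal.ofReal (((1 + N * ‖x - a‖) ^ M)⁻¹) := by
            refine lintegral_mono fun x => ?_
            rw [← ENNReal.ofReal_mul hA.le, ← ofReal_norm]
            exact ENNReal.ofReal_le_ofReal (hb x)
        _ = _ := lintegral_const_mul' _ _ ENNReal.ofReal_ne_top
        _ ≤ _ := by gcongr; exact h N a hN)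
  refine h1.trans (ENNReal.ofReal_le_ofReal (le_of_eq ?_))
  rw [Real.mul_rpow hA.le (by positivity), Real.mul_rpow hK.le (by positivity), ← mul_assoc,
    ← Real.rpow_add hA, sub_add_cancel, Real.rpow_one]

theorem card_le_of_pairwise_close {s : Finset ℕ} {r : ℕ} (h : ∀ j ∈ s, ∀ k ∈ s, j ≤ k + r) :
    s.card ≤ r + 1 := by
  rcases s.eq_empty_or_nonempty with rfl | hs
  · simp
  · have hsub : s ⊆ Finset.Icc (s.min' hs) (s.min' hs + r) := fun j hj =>
      Finset.mem_Icc.2 ⟨s.min'_le j hj, h j hj _ (s.min'_mem hs)⟩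
    calc s.card ≤ (Finset.Icc (s.min' hs) (s.min' hs + r)).card := Finset.card_le_card hsub
      _ = r + 1 := by rw [Nat.card_Icc]; omega

/-- The wave packet of frequency `l` in the direction `θ`, cut off by `φ` to the ball of radius
`N⁻¹` about `-c`. -/
noncomputable def wavePacket (φ : E → ℝ) (l N : ℝ) (θ c x : E) : ℂ :=
  (Real.fourierChar (l * inner ℝ θ (x + c)) : ℂ) * (φ (N • (x + c)) : ℂ)

omit [MeasurableSpace E] [BorelSpace E] in
theorem exists_schwartz_wavePacket {φ : E → ℝ} (hφ : ContDiff ℝ ∞ φ)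
    (hφs : tsupport φ ⊆ Metric.closedBall 0 1) (l : ℝ) {N : ℝ} (hN : 0 < N) (θ c : E) :
    ∃ P : 𝓢(E, ℂ), ∀ x, P x = wavePacket φ l N θ c x := by
  have hφc : HasCompactSupport φ := (isCompact_closedBall 0 1).of_isClosed_subset
    (isClosed_tsupport φ) hφs
  have hc : HasCompactSupport (wavePacket φ l N θ c) := by
    refine HasCompactSupport.intro (K := (fun z => N⁻¹ • z - c) '' (tsupport φ)) ?_ ?_
    · exact IsCompact.image hφc (by fun_prop)
    · intro x hx
      have : φ (N • (x + c)) = 0 := by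
        by_contra h
        refine hx ⟨_, subset_tsupport _ h, ?_⟩
        simp only
        rw [smul_smul, inv_mul_cancel₀ hN.ne', one_smul]; abel
      simp only [wavePacket, this, Complex.ofReal_zero, mul_zero]
  have hd : ContDiff ℝ ∞ (wavePacket φ l N θ c) := by
    refine ContDiff.mul ?_ (Complex.ofRealCLM.contDiff.comp (hφ.comp
      ((contDiff_id.add contDiff_const).const_smul _)))
    simp only [Real.fourierChar_apply]
    refine Complex.contDiff_exp.comp ?_
    refine ContDiff.mul (Complex.ofRealCLM.contDiff.comp ?_) contDiff_const
    exact contDiff_const.mul (contDiff_const.mul (contDiff_const.inner ℝ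
      (contDiff_id.add contDiff_const)))
  exact ⟨hc.toSchwartzMap hd, fun x => rfl⟩

omit [FiniteDimensional ℝ E] [MeasurableSpace E] [BorelSpace E] in
theorem norm_wavePacket {φ : E → ℝ} (hφ0 : ∀ x, 0 ≤ φ x) (l N : ℝ) (θ c x : E) :
    ‖wavePacket φ l N θ c x‖ = φ (N • (x + c)) := by
  rw [wavePacket, norm_mul, Circle.norm_coe, one_mul, Complex.norm_real, Real.norm_eq_abs,
    abs_of_nonneg (hφ0 _)]

/-- The `L^p` norm of a sum of `m` packets at scale `N⁻¹` with separated centres: only boundedly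
many of them overlap at any point. -/
theorem eLpNorm_sum_wavePacket_le {φ : E → ℝ} (hφ : Continuous φ)
    (hφs : tsupport φ ⊆ Metric.closedBall 0 1) (hφ0 : ∀ x, 0 ≤ φ x) (hφ1 : ∀ x, φ x ≤ 1)
    {p : ℝ≥0∞} (hp : 1 ≤ p) {κ A : ℝ} (hκ : 0 < κ) (hA : 0 < A) :
    ∃ K : ℝ, 0 < K ∧ ∀ (N l : ℝ) (m : ℕ) (α : ℕ → ℂ) (θ c : ℕ → E), 0 < N →
      (∀ k < m, ‖α k‖ ≤ A) →
      (∀ j < m, ∀ k < m, κ * |(j : ℝ) - k| ≤ N * ‖c j - c k‖) →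
      eLpNorm (fun x => ∑ k ∈ Finset.range m, α k * wavePacket φ l N (θ k) (c k) x) p volume ≤
        ENNReal.ofReal (K * (m * (N ^ Module.finrank ℝ E)⁻¹) ^ p.toReal⁻¹) := by
  have hφc : HasCompactSupport φ := (isCompact_closedBall 0 1).of_isClosed_subset
    (isClosed_tsupport φ) hφs
  have hφi : Integrable φ := hφ.integrable_of_hasCompactSupport hφc
  set r : ℕ := ⌊2 / κ⌋₊ with hr
  set V : ℝ := (∫ x, φ x) + 1 with hV
  have hV0 : 0 < V := by
    have : 0 ≤ ∫ x, φ x := integral_nonneg hφ0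
    linarith
  set q := p.toReal⁻¹ with hq
  refine ⟨(A * (r + 1)) ^ (1 - q) * (A * V) ^ q, by positivity, ?_⟩
  intro N l m α θ c hN hα hsep
  set f : E → ℂ := fun x => ∑ k ∈ Finset.range m, α k * wavePacket φ l N (θ k) (c k) x with hf
  have hpt : ∀ x, ‖f x‖ ≤ A * ∑ k ∈ Finset.range m, φ (N • (x + c k)) := by
    intro x
    rw [Finset.mul_sum]
    refine (norm_sum_le _ _).trans (Finset.sum_le_sum fun k hk => ?_)
    rw [norm_mul, norm_wavePacket hφ0]
    have := hα k (Finset.mem_range.1 hk)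
    have := hφ0 (N • (x + c k))
    gcongr
  have hover : ∀ x, ∑ k ∈ Finset.range m, φ (N • (x + c k)) ≤ r + 1 := by
    intro x
    set s := (Finset.range m).filter fun k => φ (N • (x + c k)) ≠ 0 with hs
    have hnear : ∀ k ∈ s, N * ‖x + c k‖ ≤ 1 := by
      intro k hk
      have h1 := hφs (subset_tsupport _ (Finset.mem_filter.1 hk).2)
      rw [mem_closedBall_zero_iff, norm_smul, Real.norm_eq_abs, abs_of_pos hN] at h1
      exact h1
    have hcard : s.card ≤ r + 1 := by
      refine card_le_of_pairwise_close fun j hj k hk => ?_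
      have hj' := Finset.mem_range.1 (Finset.mem_filter.1 hj).1
      have hk' := Finset.mem_range.1 (Finset.mem_filter.1 hk).1
      have h1 := hsep j hj' k hk'
      have h2 : N * ‖c j - c k‖ ≤ 2 := by
        have h3 : ‖c j - c k‖ ≤ ‖x + c j‖ + ‖x + c k‖ := by
          have := norm_sub_le (x + c j) (x + c k)
          simpa using this
        have := hnear j hj
        have := hnear k hk
        nlinarith
      by_contra! hlt
      have h4 : r + 1 ≤ j - k := by omega
      have h5 : ((r : ℝ) + 1) ≤ |(j : ℝ) - k| := by
        rw [← Nat.cast_sub (by omega)]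
        rw [abs_of_nonneg (by positivity)]
        exact_mod_cast h4
      have h6 : 2 / κ < r + 1 := Nat.lt_floor_add_one _
      rw [div_lt_iff₀ hκ] at h6
      nlinarith
    calc ∑ k ∈ Finset.range m, φ (N • (x + c k)) = ∑ k ∈ s, φ (N • (x + c k)) :=
          (Finset.sum_filter_ne_zero _).symm
      _ ≤ ∑ k ∈ s, (1 : ℝ) := Finset.sum_le_sum fun k _ => hφ1 _
      _ = s.card := by simp
      _ ≤ r + 1 := by exact_mod_cast hcard
  have hfA : ∀ x, ‖f x‖ ≤ A * (r + 1) := fun x => (hpt x).trans (by gcongr; exact hover x)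
  have hscale : ∀ k, Integrable (fun x => φ (N • (x + c k))) ∧
      ∫ x, φ (N • (x + c k)) ≤ V * (N ^ Module.finrank ℝ E)⁻¹ := by
    intro k
    refine ⟨(hφi.comp_smul hN.ne').comp_add_right (c k), ?_⟩
    rw [integral_add_right_eq_self (fun x => φ (N • x)) (c k),
      Measure.integral_comp_smul volume φ N, abs_of_nonneg (by positivity), smul_eq_mul, mul_comm]
    gcongr
    linarith
  have hfB : ∫⁻ x, ‖f x‖ₑ ≤ ENNReal.ofReal (A * V * (m * (N ^ Module.finrank ℝ E)⁻¹)) := by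
    have hint : Integrable fun x => A * ∑ k ∈ Finset.range m, φ (N • (x + c k)) :=
      (integrable_finsetSum _ fun k _ => (hscale k).1).const_mul A
    calc ∫⁻ x, ‖f x‖ₑ ≤ ∫⁻ x, ENNReal.ofReal (A * ∑ k ∈ Finset.range m, φ (N • (x + c k))) := by
          refine lintegral_mono fun x => ?_
          rw [← ofReal_norm]
          exact ENNReal.ofReal_le_ofReal (hpt x)
      _ = ENNReal.ofReal (∫ x, A * ∑ k ∈ Finset.range m, φ (N • (x + c k))) := by
          rw [ofReal_integral_eq_lintegral_ofReal hint]
          exact Eventually.of_forall fun x =>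
            mul_nonneg hA.le (Finset.sum_nonneg fun k _ => hφ0 _)
      _ ≤ _ := by
          refine ENNReal.ofReal_le_ofReal ?_
          rw [integral_const_mul, integral_finsetSum _ fun k _ => (hscale k).1, mul_assoc]
          gcongr
          calc _ ≤ ∑ k ∈ Finset.range m, V * (N ^ Module.finrank ℝ E)⁻¹ :=
                Finset.sum_le_sum fun k _ => (hscale k).2
            _ = _ := by simp; ring
  refine (eLpNorm_le_interpolate (A := A * (r + 1)) hp (by positivity) (by positivity) hfA
    hfB).trans (ENNReal.ofReal_le_ofReal (le_of_eq ?_))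
  rw [Real.mul_rpow (x := A * V) (by positivity) (by positivity), ← mul_assoc]

end Norms

/-! ### The bilinear form of the averaging operator -/

section Pairing

variable {n : ℕ}

/-- The bilinear form `∫ g · A_t f`, with the integral over the curve taken last
(see `integral_mul_curveAverage`). -/
noncomputable def curvePairing (γ : ℝ → EuclideanSpace ℝ (Fin n)) (χ : ℝ → ℝ) (t : ℝ)
    (g f : 𝓢(EuclideanSpace ℝ (Fin n), ℂ)) : ℂ :=
  ∫ s, (χ s : ℂ) * ∫ x, g x * f (x - t • γ s)

variable {γ : ℝ → EuclideanSpace ℝ (Fin n)} {χ : ℝ → ℝ}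

theorem exists_norm_le_of_schwartz (f : 𝓢(EuclideanSpace ℝ (Fin n), ℂ)) : ∃ C, ∀ x, ‖f x‖ ≤ C := by
  obtain ⟨C, hC⟩ := f.decay 0 0
  exact ⟨C, fun x => by simpa using hC.2 x⟩

theorem integrable_mul_translate (g f : 𝓢(EuclideanSpace ℝ (Fin n), ℂ))
    (y : EuclideanSpace ℝ (Fin n)) : Integrable fun x => g x * f (x - y) := by
  obtain ⟨C, hC⟩ := exists_norm_le_of_schwartz f
  exact g.integrable.mul_bdd (c := C) ((f.continuous.comp (by fun_prop)).aestronglyMeasurable)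
    (Eventually.of_forall fun x => hC _)

theorem continuous_correlation (g f : 𝓢(EuclideanSpace ℝ (Fin n), ℂ)) :
    Continuous fun y => ∫ x, g x * f (x - y) := by
  obtain ⟨C, hC⟩ := exists_norm_le_of_schwartz f
  refine continuous_of_dominated (bound := fun x => ‖g x‖ * C) ?_ ?_ ?_ ?_
  · exact fun y => (integrable_mul_translate g f y).aestronglyMeasurable
  · intro y
    refine Eventually.of_forall fun x => ?_
    rw [norm_mul]
    gcongr
    exact hC _
  · exact g.integrable.norm.mul_const C
  · exact Eventually.of_forall fun x => continuous_const.mul (f.continuous.comp (by fun_prop))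

theorem continuous_curvePairing (hγ : Continuous γ) (hχ : Continuous χ) (hχs : HasCompactSupport χ)
    (g f : 𝓢(EuclideanSpace ℝ (Fin n), ℂ)) : Continuous fun t => curvePairing γ χ t g f := by
  have h : ∀ t, curvePairing γ χ t g f =
      ∫ s in tsupport χ, (χ s : ℂ) * ∫ x, g x * f (x - t • γ s) := by
    intro t
    rw [setIntegral_eq_integral_of_forall_compl_eq_zero]; rfl
    intro s hs
    rw [image_eq_zero_of_notMem_tsupport hs]; simp
  simp_rw [h]
  refine continuous_parametric_integral_of_continuous ?_ hχs
  have := (continuous_correlation g f).comp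
    (by fun_prop : Continuous fun q : ℝ × ℝ => q.1 • γ q.2)
  exact (Complex.continuous_ofReal.comp (hχ.comp continuous_snd)).mul this

theorem integral_mul_curveAverage (hγ : Continuous γ) (hχ : Continuous χ)
    (hχs : HasCompactSupport χ) (t : ℝ) (g f : 𝓢(EuclideanSpace ℝ (Fin n), ℂ)) :
    ∫ x, g x * curveAverage γ χ t f x = curvePairing γ χ t g f := by
  obtain ⟨C, hC⟩ := exists_norm_le_of_schwartz f
  have hχi : Integrable fun s => (χ s : ℂ) := (hχ.integrable_of_hasCompactSupport hχs).ofReal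
  have hint : Integrable (Function.uncurry fun (x : EuclideanSpace ℝ (Fin n)) (s : ℝ) =>
      g x * (f (x - t • γ s) * (χ s : ℂ))) (volume.prod volume) := by
    have h1 := g.integrable (μ := volume).mul_prod hχi
    have h2 := h1.mul_bdd (c := C)
      (g := fun q : EuclideanSpace ℝ (Fin n) × ℝ => f (q.1 - t • γ q.2))
      ((f.continuous.comp (by fun_prop)).aestronglyMeasurable) (Eventually.of_forall fun q => hC _)
    refine h2.congr (Eventually.of_forall fun q => ?_)
    simp only [Function.uncurry_def]; ring
  simp only [curveAverage, curveMeasurePairing, curvePairing]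
  simp_rw [← integral_const_mul]
  rw [integral_integral_swap hint]
  congr 1 with s
  congr 1 with x
  ring

theorem integrable_mul_correlation (hγ : Continuous γ) (hχ : Continuous χ)
    (hχs : HasCompactSupport χ) (t : ℝ) (g f : 𝓢(EuclideanSpace ℝ (Fin n), ℂ)) :
    Integrable fun s => (χ s : ℂ) * ∫ x, g x * f (x - t • γ s) := by
  refine Continuous.integrable_of_hasCompactSupport ?_ ?_
  · exact (Complex.continuous_ofReal.comp hχ).mul
      ((continuous_correlation g f).comp (by fun_prop : Continuous fun s => t • γ s))
  · exact (hχs.comp_left (g := fun x : ℝ => (x : ℂ)) Complex.ofReal_zero).mul_right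

theorem curvePairing_sum (hγ : Continuous γ) (hχ : Continuous χ) (hχs : HasCompactSupport χ)
    (t : ℝ) (m₁ m : ℕ) (α β : ℕ → ℂ) (g f : ℕ → 𝓢(EuclideanSpace ℝ (Fin n), ℂ))
    {G F : 𝓢(EuclideanSpace ℝ (Fin n), ℂ)} (hG : ∀ x, G x = ∑ j ∈ Finset.range m₁, β j * g j x)
    (hF : ∀ x, F x = ∑ k ∈ Finset.range m, α k * f k x) :
    curvePairing γ χ t G F =
      ∑ j ∈ Finset.range m₁, ∑ k ∈ Finset.range m, β j * α k * curvePairing γ χ t (g j) (f k) := by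
  simp only [curvePairing]
  have h1 : ∀ y, ∫ x, G x * F (x - y) =
      ∑ j ∈ Finset.range m₁, ∑ k ∈ Finset.range m, β j * α k * ∫ x, g j x * f k (x - y) := by
    intro y
    simp_rw [hG, hF, Finset.sum_mul_sum, ← integral_const_mul]
    have hi : ∀ j k, Integrable fun x => β j * α k * (g j x * f k (x - y)) := fun j k =>
      (integrable_mul_translate (g j) (f k) y).const_mul _
    rw [← Finset.sum_congr rfl fun j _ => integral_finsetSum _ fun k _ => hi j k,
      ← integral_finsetSum _ fun j _ => integrable_finsetSum _ fun k _ => hi j k]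
    congr 1 with x
    exact Finset.sum_congr rfl fun j _ => Finset.sum_congr rfl fun k _ => by ring
  have h2 : ∀ j k, β j * α k * ∫ s, (χ s : ℂ) * ∫ x, g j x * f k (x - t • γ s) =
      ∫ s, β j * α k * ((χ s : ℂ) * ∫ x, g j x * f k (x - t • γ s)) := fun j k =>
    (integral_const_mul _ _).symm
  simp only [h1, h2]
  have hi : ∀ j k, Integrable fun s : ℝ =>
      β j * α k * ((χ s : ℂ) * ∫ x, g j x * f k (x - t • γ s)) := fun j k =>
    (integrable_mul_correlation hγ hχ hχs t (g j) (f k)).const_mul _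
  rw [← Finset.sum_congr rfl fun j _ => integral_finsetSum _ fun k _ => hi j k,
    ← integral_finsetSum _ fun j _ => integrable_finsetSum _ fun k _ => hi j k]
  congr 1 with s
  simp_rw [Finset.mul_sum]
  exact Finset.sum_congr rfl fun j _ => Finset.sum_congr rfl fun k _ => by ring

end Pairing

/-! ### Lower bounds for the responses along an arc -/

section Arc

variable {n : ℕ}

/-- An arc `γ([c, d])` of a curve on which `|γ x - γ y| ≥ κ |x - y|`, together with a field of
directions `θ` such that `γ` stays within `B |s - s₀| ^ n` of the hyperplane through `γ s₀` normal
to `θ s₀`, and a weight `ρ` for which superpositions of wave packets with profile `Φ` centred along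
the arc have a nonzero limit: `ρ s * ∫ Φ (u • γ' s) du` is a function `G` of the point `γ s`, and
`G` integrates to a nonzero number against the part of the measure `μ₁` carried by the arc. -/
structure PacketArc (γ : ℝ → EuclideanSpace ℝ (Fin n)) (χ : ℝ → ℝ)
    (θ : ℝ → EuclideanSpace ℝ (Fin n)) (Φ : EuclideanSpace ℝ (Fin n) → ℂ) where
  (c d κ B C : ℝ)
  (ρ : ℝ → ℂ)
  (G : EuclideanSpace ℝ (Fin n) → ℝ)
  continuous_curve : Continuous γ
  continuous_cutoff : Continuous χ
  hasCompactSupport_cutoff : HasCompactSupport χ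
  volume_fiber : ∀ y, volume (tsupport χ ∩ γ ⁻¹' {y}) = 0
  continuous_direction : Continuous θ
  continuous_profile : Continuous Φ
  profile_le : ∀ Z, ‖Φ Z‖ ≤ C / (1 + ‖Z‖ ^ 2)
  lt : c < d
  κ_pos : 0 < κ
  le_norm_sub : ∀ x ∈ Icc c d, ∀ y ∈ Icc c d, κ * |x - y| ≤ ‖γ x - γ y‖
  hasDerivAt : ∀ s ∈ Ioo c d, HasDerivAt γ (deriv γ s) s
  abs_inner_le : ∀ s₀ ∈ Icc c d, ∀ s ∈ Icc c d,
    |inner ℝ (θ s₀) (γ s₀ - γ s)| ≤ B * |s - s₀| ^ n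
  continuous_weight : Continuous ρ
  weight_mul : ∀ s ∈ Ioo c d, ρ s * ∫ u : ℝ, Φ (u • deriv γ s) = G (γ s)
  integral_ne_zero : ∫ u in γ ⁻¹' (γ '' Icc c d), χ u * G (γ u) ≠ 0

namespace PacketArc

variable {γ : ℝ → EuclideanSpace ℝ (Fin n)} {χ : ℝ → ℝ} {θ : ℝ → EuclideanSpace ℝ (Fin n)}
  {Φ : EuclideanSpace ℝ (Fin n) → ℂ} (Γ : PacketArc γ χ θ Φ)

/-- The pairing of `μ_t` with a wave packet at scale `N⁻¹`, centred at the point `γ s₀` of the arc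
and normalized to have size one. -/
noncomputable def response (_ : PacketArc γ χ θ Φ) (L N ε t s₀ : ℝ) : ℂ :=
  N • ∫ s, (χ s : ℂ) *
    packetKernel γ Φ (fun s₀ y => L * t * inner ℝ (θ s₀) (γ s₀ - y)) N t ε s₀ (γ s)

/-- The parameters at which the `m` packets of a superposition are centred: one in each of `m` cells
of the same length, at relative position `v`. -/
noncomputable def centre (m : ℕ) (v : ℝ) (k : ℕ) : ℝ := Γ.c + (Γ.d - Γ.c) / m * (k + v)

theorem centre_mem {m : ℕ} {v : ℝ} (hv : v ∈ Icc (0 : ℝ) 1) {k : ℕ} (hk : k < m) :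
    Γ.centre m v k ∈ Icc Γ.c Γ.d := by
  have hm : (0 : ℝ) < m := by exact_mod_cast (Nat.zero_le k).trans_lt hk
  have hkm : (k : ℝ) + 1 ≤ m := by exact_mod_cast hk
  have h0 : 0 < Γ.d - Γ.c := sub_pos.2 Γ.lt
  have h1 : (0 : ℝ) ≤ k + v := add_nonneg (Nat.cast_nonneg k) hv.1
  refine ⟨le_add_of_nonneg_right (by positivity), ?_⟩
  have h2 : (Γ.d - Γ.c) / m * (k + v) ≤ (Γ.d - Γ.c) / m * m := by
    gcongr
    linarith [hv.2]
  rw [div_mul_cancel₀ _ hm.ne'] at h2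
  rw [centre]; linarith

theorem mul_abs_sub_le_norm_centre {m : ℕ} {v : ℝ} (hv : v ∈ Icc (0 : ℝ) 1) {j k : ℕ} (hj : j < m)
    (hk : k < m) : Γ.κ * (Γ.d - Γ.c) * |(j : ℝ) - k| ≤
      m * ‖γ (Γ.centre m v j) - γ (Γ.centre m v k)‖ := by
  have hm : (0 : ℝ) < m := by exact_mod_cast (Nat.zero_le k).trans_lt hk
  have h0 : 0 < Γ.d - Γ.c := sub_pos.2 Γ.lt
  have h := Γ.le_norm_sub _ (Γ.centre_mem hv hj) _ (Γ.centre_mem hv hk)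
  have e : Γ.centre m v j - Γ.centre m v k = (Γ.d - Γ.c) / m * ((j : ℝ) - k) := by
    simp only [centre]; ring
  rw [e, abs_mul, abs_of_pos (div_pos h0 hm)] at h
  calc Γ.κ * (Γ.d - Γ.c) * |(j : ℝ) - k|
      = m * (Γ.κ * ((Γ.d - Γ.c) / m * |(j : ℝ) - k|)) := by field_simp
    _ ≤ _ := by gcongr

theorem continuous_response (L N δ e : ℝ) :
    Continuous fun q : ℝ × ℝ => Γ.response L N (δ * (e * (q.2 - 1))) q.2 q.1 := by
  have hγ := Γ.continuous_curve
  have hχ := Γ.continuous_cutoff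
  have hθ := Γ.continuous_direction
  have h : ∀ q : ℝ × ℝ, Γ.response L N (δ * (e * (q.2 - 1))) q.2 q.1 =
      N • ∫ s in tsupport χ, (χ s : ℂ) * packetKernel γ Φ
        (fun s₀ y => L * q.2 * inner ℝ (θ s₀) (γ s₀ - y)) N q.2 (δ * (e * (q.2 - 1))) q.1
          (γ s) := by
    intro q
    rw [setIntegral_eq_integral_of_forall_compl_eq_zero]; rfl
    intro s hs
    rw [image_eq_zero_of_notMem_tsupport hs]; simp
  simp_rw [h]
  refine Continuous.const_smul ?_ N
  refine continuous_parametric_integral_of_continuous ?_ Γ.hasCompactSupport_cutoff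
  simp only [Function.uncurry_def, packetKernel]
  refine (Complex.continuous_ofReal.comp (hχ.comp continuous_snd)).mul
    ((continuous_fourierChar_coe.comp ?_).mul (Γ.continuous_profile.comp ?_))
  · exact (continuous_const.mul (by fun_prop)).mul
      ((hθ.comp (by fun_prop)).inner (by fun_prop))
  · fun_prop

/-- Uniform lower bound for the superposition of the responses along the arc. The rescaled time
`e N * (t - 1)` stays in a fixed interval; `δ` is `1` or `0` according to whether the test functions
stay fixed or move with `t`. -/
theorem exists_integral_response_ge (L e : ℕ → ℝ) (δ : ℝ)
    (hL : Tendsto (fun N : ℕ => L N / (N : ℝ) ^ n) atTop (𝓝 0)) (he : ∀ᶠ N in atTop, 1 ≤ e N) :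
    ∃ A τ : ℝ, 0 < A ∧ 0 < τ ∧ τ ≤ 1 ∧ ∀ᶠ N : ℕ in atTop, 1 ≤ e N ∧
      ∀ t ∈ Icc 1 (1 + τ / e N), A ≤ ‖∫ s₀ in Icc Γ.c Γ.d, Γ.ρ s₀ *
        Γ.response (L N) N (δ * (e N * (t - 1))) t s₀‖ := by
  -- the limit is taken jointly in `N` and in the rescaled time `e N * (t - 1)`
  set ι := ℕ × ℝ
  set l : Filter ι := atTop ×ˢ 𝓝 0 with hl
  set t : ι → ℝ := fun i => 1 + i.2 / e i.1 with ht
  have hfst : Tendsto (fun i : ι => i.1) l atTop := tendsto_fst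
  have hsnd : Tendsto (fun i : ι => i.2) l (𝓝 0) := tendsto_snd
  have hN : Tendsto (fun i : ι => (i.1 : ℝ)) l atTop := tendsto_natCast_atTop_atTop.comp hfst
  have hquot : Tendsto (fun i : ι => i.2 / e i.1) l (𝓝 0) := by
    refine squeeze_zero_norm' ?_ (by simpa using hsnd.abs)
    filter_upwards [hfst.eventually he] with i hi
    rw [norm_div, Real.norm_eq_abs, Real.norm_eq_abs, abs_of_pos (by linarith : 0 < e i.1)]
    exact div_le_self (abs_nonneg _) hi
  have ht1 : Tendsto t l (𝓝 1) := by
    simpa using hquot.const_add 1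
  have hε : Tendsto (fun i : ι => δ * i.2) l (𝓝 0) := by simpa using hsnd.const_mul δ
  have hγ := Γ.continuous_curve
  have hθ := Γ.continuous_direction
  have hlim := tendsto_integral_packets (l := l) (N := fun i => (i.1 : ℝ)) (t := t)
    (ε := fun i => δ * i.2)
    (ψ := fun i s₀ y => L i.1 * t i * inner ℝ (θ s₀) (γ s₀ - y)) (χ := χ) (G := Γ.G)
    (v := deriv γ) hγ Γ.continuous_profile
    Γ.profile_le Γ.continuous_weight Γ.κ_pos Γ.lt.le Γ.le_norm_sub
    (fun i => continuous_const.mul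
      ((hθ.comp continuous_fst).inner ((hγ.comp continuous_fst).sub continuous_snd)))
    hN ht1 hε Γ.hasDerivAt (by
      intro s hs u
      have hin : ∀ᶠ i : ι in l, s + u / (i.1 : ℝ) ∈ Ioo Γ.c Γ.d := by
        have : Tendsto (fun i : ι => s + u / (i.1 : ℝ)) l (𝓝 (s + 0)) :=
          (tendsto_const_nhds.div_atTop hN).const_add s
        rw [add_zero] at this
        exact this.eventually (Ioo_mem_nhds hs.1 hs.2)
      have hz : Tendsto (fun i : ι => |L i.1 / (i.1 : ℝ) ^ n| * |t i| * (Γ.B * |u| ^ n)) l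
          (𝓝 (|0| * |1| * (Γ.B * |u| ^ n))) :=
        (((hL.comp hfst).abs).mul ht1.abs).mul_const _
      rw [abs_zero, zero_mul, zero_mul] at hz
      refine squeeze_zero_norm' ?_ hz
      filter_upwards [hin, hN.eventually (eventually_gt_atTop 0)] with i hi hi0
      have h1 := Γ.abs_inner_le _ (Ioo_subset_Icc_self hi) _ (Ioo_subset_Icc_self hs)
      have h2 : |s - (s + u / (i.1 : ℝ))| ^ n = |u| ^ n / (i.1 : ℝ) ^ n := by
        rw [sub_add_cancel_left, abs_neg, abs_div, abs_of_pos hi0, div_pow]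
      rw [h2] at h1
      rw [Real.norm_eq_abs, abs_mul, abs_mul, abs_div, abs_of_pos (pow_pos hi0 n)]
      calc _ ≤ |L i.1| * |t i| * (Γ.B * (|u| ^ n / (i.1 : ℝ) ^ n)) := by gcongr
        _ = _ := by ring) Γ.continuous_cutoff
    Γ.hasCompactSupport_cutoff Γ.volume_fiber Γ.weight_mul
  set I := ∫ u in γ ⁻¹' (γ '' Icc Γ.c Γ.d), χ u * Γ.G (γ u) with hI
  have hI0 : 0 < ‖((I : ℝ) : ℂ)‖ := by
    rw [norm_pos_iff]
    exact_mod_cast Γ.integral_ne_zero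
  have hev := hlim.norm.eventually (lt_mem_nhds (half_lt_self hI0))
  rw [hl, eventually_prod_iff] at hev
  obtain ⟨p₁, hp₁, p₂, hp₂, hp⟩ := hev
  obtain ⟨τ, hτ, hτ2⟩ := Metric.eventually_nhds_iff.1 hp₂
  refine ⟨_, min (τ / 2) 1, half_pos hI0, by positivity, min_le_right _ _, ?_⟩
  filter_upwards [hp₁, he] with N hN1 hN2
  refine ⟨hN2, fun x hx => ?_⟩
  have he0 : 0 < e N := by linarith
  have hx2 : |e N * (x - 1)| < τ := by
    have h3 : x - 1 ≤ min (τ / 2) 1 / e N := by linarith [hx.2]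
    rw [le_div_iff₀ he0] at h3
    rw [abs_of_nonneg (mul_nonneg he0.le (by linarith [hx.1]))]
    have := min_le_left (τ / 2) 1
    linarith
  have h4 := hp hN1 (hτ2 (y := e N * (x - 1)) (by rwa [Real.dist_eq, sub_zero]))
  have h5 : t (N, e N * (x - 1)) = x := by
    simp only [ht]
    rw [mul_div_cancel_left₀ _ he0.ne']; ring
  simp only [h5] at h4
  exact h4.le

/-- Lower bound, in the mean over a time interval of length `τ / e N`, for the sum of the responses
of `m` packets. -/
theorem exists_sum_response_ge (L e : ℕ → ℝ) (δ : ℝ)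
    (hL : Tendsto (fun N : ℕ => L N / (N : ℝ) ^ n) atTop (𝓝 0)) (he : ∀ᶠ N in atTop, 1 ≤ e N) :
    ∃ A τ : ℝ, 0 < A ∧ 0 < τ ∧ τ ≤ 1 ∧ ∀ᶠ N : ℕ in atTop, 1 ≤ e N ∧ ∀ m : ℕ, 0 < m →
      ∃ v ∈ Icc (0 : ℝ) 1, ENNReal.ofReal (A * m * (τ / e N)) ≤
        ∫⁻ t in Icc 1 (1 + τ / e N), ‖∑ k ∈ Finset.range m, Γ.ρ (Γ.centre m v k) *
          Γ.response (L N) N (δ * (e N * (t - 1))) t (Γ.centre m v k)‖ₑ := by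
  obtain ⟨A, τ, hA, hτ, hτ1, h⟩ := Γ.exists_integral_response_ge L e δ hL he
  have hcd : 0 < Γ.d - Γ.c := sub_pos.2 Γ.lt
  refine ⟨A / (Γ.d - Γ.c), τ, by positivity, hτ, hτ1, ?_⟩
  filter_upwards [h] with N hN
  refine ⟨hN.1, fun m hm => ?_⟩
  have he0 : 0 < e N := by linarith [hN.1]
  obtain ⟨v, hv, h1⟩ := exists_cell_shift
    (R := fun s t => Γ.ρ s * Γ.response (L N) N (δ * (e N * (t - 1))) t s)
    (((Γ.continuous_weight.comp continuous_fst)).mul (Γ.continuous_response _ _ _ _)) Γ.lt hm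
    measurableSet_Icc (isCompact_Icc.measure_lt_top.ne) hN.2 ⟨_, isCompact_Icc, Subset.rfl⟩
  refine ⟨v, hv, le_trans (le_of_eq ?_) h1⟩
  rw [Real.volume_Icc, ← ENNReal.ofReal_mul (by positivity)]
  congr 1
  ring

end PacketArc

end Arc

/-! ### Pairing a packet with a test function -/

section Test

variable {n : ℕ} {γ : ℝ → EuclideanSpace ℝ (Fin n)} {χ : ℝ → ℝ}

/-- The bilinear form on a packet and a test function of opposite frequencies and the same scale. -/
theorem curvePairing_packet {η : EuclideanSpace ℝ (Fin n) → ℂ} {φ Φ : EuclideanSpace ℝ (Fin n) → ℝ}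
    (hΦ : ∀ Z, ∫ x, 𝓕 η x * (φ (x + Z) : ℂ) = Φ Z) (l : ℝ) {N : ℝ} (hN : 0 < N)
    (θ a c : EuclideanSpace ℝ (Fin n)) {g P : 𝓢(EuclideanSpace ℝ (Fin n), ℂ)}
    (hg : ∀ x, g x = (Real.fourierChar (-(l * inner ℝ θ (x - a))) : ℂ) * 𝓕 η (N • (x - a)))
    (hP : ∀ x, P x = wavePacket φ l N θ c x) (t : ℝ) :
    curvePairing γ χ t g P = ((N ^ n)⁻¹ : ℝ) * ∫ s, (χ s : ℂ) *
      ((Real.fourierChar (l * inner ℝ θ (c - t • γ s + a)) : ℂ) *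
        (Φ (N • (c - t • γ s + a)) : ℂ)) := by
  rw [curvePairing, ← integral_const_mul]
  congr 1 with s
  have h := integral_packet_mul_test hΦ l hN θ a (c - t • γ s)
  rw [finrank_euclideanSpace_fin] at h
  rw [mul_left_comm, ← h]
  congr 2 with x
  rw [hg, hP, wavePacket, show x - t • γ s + c = x + (c - t • γ s) by abel]

end Test

/-! ### Profiles, the tested estimate and powers of `N` -/

section Preliminaries

variable {n : ℕ}

/-- The window functions of wave packets and test functions: packets are cut off by `φ`, test
functions by the Fourier transform of `η`, and `Φ` is the correlation of the two. -/
structure PacketProfile (n : ℕ) where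
  η : EuclideanSpace ℝ (Fin n) → ℂ
  (φ Φ : EuclideanSpace ℝ (Fin n) → ℝ)
  contDiff_η : ContDiff ℝ ∞ η
  tsupport_η : tsupport η ⊆ Metric.closedBall 0 1
  contDiff_φ : ContDiff ℝ ∞ φ
  tsupport_φ : tsupport φ ⊆ Metric.closedBall 0 1
  φ_nonneg : ∀ x, 0 ≤ φ x
  φ_le_one : ∀ x, φ x ≤ 1
  correlation : ∀ Z, ∫ x, 𝓕 η x * (φ (x + Z) : ℂ) = Φ Z

theorem toReal_inv_holderConjugate {p p' : ℝ≥0∞} [h : p.HolderConjugate p'] :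
    p'.toReal⁻¹ = 1 - p.toReal⁻¹ := by
  have h1 : p⁻¹ + p'⁻¹ = 1 := by
    have := h.inv_add_inv_eq_inv
    rwa [inv_one] at this
  have hp : p⁻¹ ≠ ⊤ := fun h => by simp [h] at h1
  have hp' : p'⁻¹ ≠ ⊤ := fun h => by simp [h] at h1
  have h2 := congrArg ENNReal.toReal h1
  rw [ENNReal.toReal_add hp hp', ENNReal.toReal_inv, ENNReal.toReal_inv, ENNReal.toReal_one] at h2
  linarith

/-- The case of `lintegral_enorm_pairing_le` in which the dual norm of the test functions is bounded
by a constant. -/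
theorem lintegral_enorm_pairing_le_ofReal {γ : ℝ → EuclideanSpace ℝ (Fin n)} {χ : ℝ → ℝ}
    {σ : ℝ} {p p' : ℝ≥0∞} (hp : 2 ≤ p) [p.HolderConjugate p'] {C : ℝ≥0}
    {f : 𝓢(EuclideanSpace ℝ (Fin n), ℂ)}
    (hC : eLpNorm (fun t : ℝ => sobolevENorm σ p (curveAverage γ χ t f)) p
        (volume.restrict (Icc (1 : ℝ) 2)) ≤ C * eLpNorm f p volume)
    {w : ℝ} (hw : 0 < w) (hw1 : w ≤ 1) (Q H : ℝ → 𝓢(EuclideanSpace ℝ (Fin n), ℂ))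
    (hQH : ∀ t x, H t x = (((1 + ‖x‖ ^ 2) ^ (σ / 2) : ℝ) : ℂ) * Q t x)
    {D F : ℝ} (hD0 : 0 < D) (hF : 0 ≤ F)
    (hD : ∀ t, eLpNorm (𝓕 (Q t) : 𝓢(EuclideanSpace ℝ (Fin n), ℂ)) p' volume ≤ ENNReal.ofReal D)
    (hf : eLpNorm f p volume ≤ ENNReal.ofReal F)
    {G : ℝ → ℂ} (hG : Measurable G)
    (hGt : ∀ t, G t = ∫ x, (𝓕 (H t) : 𝓢(EuclideanSpace ℝ (Fin n), ℂ)) x *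
      curveAverage γ χ t f x) :
    ∫⁻ t in Icc 1 (1 + w), ‖G t‖ₑ ≤ ENNReal.ofReal (D * (C * F) * w ^ (1 - p.toReal⁻¹)) := by
  have h := lintegral_enorm_pairing_le hp hC (S := Icc 1 (1 + w))
    (Icc_subset_Icc_right (by linarith)) measurableSet_Icc Q H hQH
    (D := fun _ => ENNReal.ofReal D) measurable_const (fun _ => by simpa using hD0)
    (fun _ => ENNReal.ofReal_ne_top) (fun t _ => hD t) hG (fun t _ => hGt t)
  refine h.trans ?_
  have hvol : volume (Icc 1 (1 + w)) = ENNReal.ofReal w := by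
    rw [Real.volume_Icc]; congr 1; ring
  rw [setLIntegral_const, hvol, ← ENNReal.ofReal_pow hD0.le, ← ENNReal.ofReal_mul (by positivity),
    ENNReal.ofReal_rpow_of_pos (by positivity), ENNReal.ofReal_rpow_of_pos hw]
  calc _ ≤ ENNReal.ofReal ((D ^ 2 * w) ^ (1 / 2 : ℝ)) * (ENNReal.ofReal C * ENNReal.ofReal F *
        ENNReal.ofReal (w ^ (1 / 2 - p.toReal⁻¹))) := by
        gcongr
        rw [ENNReal.ofReal_coe_nnreal]
    _ = _ := by
        rw [← ENNReal.ofReal_mul (by positivity), ← ENNReal.ofReal_mul (by positivity),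
          ← ENNReal.ofReal_mul (by positivity)]
        congr 1
        rw [Real.mul_rpow (by positivity) hw.le, ← Real.sqrt_eq_rpow (D ^ 2), Real.sqrt_sq hD0.le,
          show 1 - p.toReal⁻¹ = 1 / 2 + (1 / 2 - p.toReal⁻¹) by ring, Real.rpow_add hw]
        ring

theorem not_eventually_le_mul_rpow {c K e : ℝ} (hc : 0 < c) (he : e < 0) :
    ¬ ∀ᶠ N : ℕ in atTop, c ≤ K * (N : ℝ) ^ e := by
  intro h
  have h1 : Tendsto (fun N : ℕ => K * (N : ℝ) ^ e) atTop (𝓝 (K * 0)) := by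
    have := (tendsto_rpow_neg_atTop (neg_pos.2 he)).comp tendsto_natCast_atTop_atTop
    simp only [neg_neg] at this
    exact this.const_mul K
  rw [mul_zero] at h1
  exact absurd (ge_of_tendsto h1 h) (not_le.2 hc)

theorem tendsto_rpow_div_pow {β : ℝ} {n : ℕ} (h : β < n) :
    Tendsto (fun N : ℕ => (N : ℝ) ^ β / (N : ℝ) ^ n) atTop (𝓝 0) := by
  have := (tendsto_rpow_neg_atTop (sub_pos.2 h)).comp tendsto_natCast_atTop_atTop
  refine this.congr' ?_
  filter_upwards [eventually_gt_atTop 0] with N hN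
  have hN' : (0 : ℝ) < N := by exact_mod_cast hN
  rw [Function.comp_apply, neg_sub, Real.rpow_sub hN', Real.rpow_natCast]

theorem eventually_two_mul_le_rpow {β : ℝ} (h : 1 < β) :
    ∀ᶠ N : ℕ in atTop, 2 * (N : ℝ) ≤ (N : ℝ) ^ β := by
  have := (tendsto_rpow_atTop (sub_pos.2 h)).comp tendsto_natCast_atTop_atTop
  filter_upwards [this.eventually (eventually_ge_atTop 2), eventually_gt_atTop 0] with N h2 hN
  have hN' : (0 : ℝ) < N := by exact_mod_cast hN
  rw [Function.comp_apply, Real.rpow_sub hN', Real.rpow_one, le_div_iff₀ hN'] at h2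
  exact h2

end Preliminaries

/-! ### Responses for the three choices of packets -/

section Cases

variable {n : ℕ} {γ : ℝ → EuclideanSpace ℝ (Fin n)} {χ : ℝ → ℝ}
  {θ : ℝ → EuclideanSpace ℝ (Fin n)} (W : PacketProfile n)

/-- The response when the test function is centred at `(t - 1) γ s₀`, hence travels with the packet:
the displacement from the packet is then exactly `t (γ s₀ - γ s)`. -/
theorem response_eq_moving (Γ : PacketArc γ χ θ fun Z => (W.Φ Z : ℂ)) (l : ℝ) {N : ℝ} (hN : 0 < N)
    (t s₀ : ℝ) {g P : 𝓢(EuclideanSpace ℝ (Fin n), ℂ)}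
    (hg : ∀ x, g x = (Real.fourierChar (-(l * inner ℝ (θ s₀) (x - (t - 1) • γ s₀))) : ℂ) *
      𝓕 W.η (N • (x - (t - 1) • γ s₀)))
    (hP : ∀ x, P x = wavePacket W.φ l N (θ s₀) (γ s₀) x) :
    Γ.response l N 0 t s₀ = (N ^ (n + 1) : ℝ) * curvePairing γ χ t g P := by
  rw [curvePairing_packet W.correlation l hN _ _ _ hg hP, PacketArc.response, ← mul_assoc,
    ← Complex.ofReal_mul, pow_succ', mul_assoc, mul_inv_cancel₀ (pow_ne_zero _ hN.ne'), mul_one,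
    ← Complex.real_smul]
  congr 2 with s
  rw [packetKernel, show γ s₀ - t • γ s + (t - 1) • γ s₀ = t • (γ s₀ - γ s) by module,
    inner_smul_right, ← mul_assoc l, smul_smul, zero_smul, sub_zero]

/-- The response when the test function stays at the origin. The displacement from the packet gives
the shift `ε = N (t - 1)` in the profile and a phase that does not depend on `s`. -/
theorem response_eq_fixed (Γ : PacketArc γ χ θ fun Z => (W.Φ Z : ℂ)) (l : ℝ) {N : ℝ} (hN : 0 < N)
    (t s₀ : ℝ) {g P : 𝓢(EuclideanSpace ℝ (Fin n), ℂ)}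
    (hg : ∀ x, g x = (Real.fourierChar (-(l * inner ℝ (θ s₀) (x - 0))) : ℂ) * 𝓕 W.η (N • (x - 0)))
    (hP : ∀ x, P x = wavePacket W.φ l N (θ s₀) (γ s₀) x) :
    Γ.response l N (N * (t - 1)) t s₀ = (N ^ (n + 1) : ℝ) *
      ((Real.fourierChar (l * (t - 1) * inner ℝ (θ s₀) (γ s₀)) : ℂ) * curvePairing γ χ t g P) := by
  rw [curvePairing_packet W.correlation l hN _ _ _ hg hP, PacketArc.response, mul_left_comm _
    (((N ^ n)⁻¹ : ℝ) : ℂ), ← mul_assoc,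
    ← Complex.ofReal_mul, pow_succ', mul_assoc, mul_inv_cancel₀ (pow_ne_zero _ hN.ne'), mul_one,
    ← Complex.real_smul, ← integral_const_mul]
  congr 2 with s
  rw [packetKernel, show N • (γ s₀ - t • γ s + 0) = (N * t) • (γ s₀ - γ s) - (N * (t - 1)) • γ s₀ by
      module, show l * t * inner ℝ (θ s₀) (γ s₀ - γ s) = l * (t - 1) * inner ℝ (θ s₀) (γ s₀) +
      l * inner ℝ (θ s₀) (γ s₀ - t • γ s + 0) by
      rw [add_zero, inner_sub_right, inner_sub_right, inner_smul_right]; ring,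
    AddChar.map_add_eq_mul, Circle.coe_mul]
  ring

/-- The response for packets of frequency `2 N`. At scale `N⁻¹` their phase is of size one and is
made part of the profile; accordingly the field of directions of the arc is taken to be `0`. -/
theorem response_eq_oscillating {θ₁ : EuclideanSpace ℝ (Fin n)}
    (Γ : PacketArc γ χ 0 fun Z => (Real.fourierChar (2 * inner ℝ θ₁ Z) : ℂ) * (W.Φ Z : ℂ))
    {N : ℝ} (hN : 0 < N) (t s₀ : ℝ) {g P : 𝓢(EuclideanSpace ℝ (Fin n), ℂ)}
    (hg : ∀ x, g x = (Real.fourierChar (-(2 * N * inner ℝ θ₁ (x - 0))) : ℂ) * 𝓕 W.η (N • (x - 0)))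
    (hP : ∀ x, P x = wavePacket W.φ (2 * N) N θ₁ (γ s₀) x) :
    Γ.response 0 N (N * (t - 1)) t s₀ = (N ^ (n + 1) : ℝ) * curvePairing γ χ t g P := by
  rw [curvePairing_packet W.correlation _ hN _ _ _ hg hP, PacketArc.response, ← mul_assoc,
    ← Complex.ofReal_mul, pow_succ', mul_assoc, mul_inv_cancel₀ (pow_ne_zero _ hN.ne'), mul_one,
    ← Complex.real_smul]
  congr 2 with s
  rw [packetKernel, zero_mul, zero_mul, AddChar.map_zero_eq_one, Circle.coe_one, one_mul,
    show (N * t) • (γ s₀ - γ s) - (N * (t - 1)) • γ s₀ = N • (γ s₀ - t • γ s + 0) by module,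
    inner_smul_right, mul_assoc 2 N]

end Cases

/-! ### The bounds obtained from a single test function -/

section SingleTest

variable {n : ℕ} {γ : ℝ → EuclideanSpace ℝ (Fin n)} {χ : ℝ → ℝ}
  {θ : ℝ → EuclideanSpace ℝ (Fin n)} (W : PacketProfile n)

/-- Upper bound for the pairing of a superposition of `m` packets with a test function which may
move with `t`. -/
theorem exists_lintegral_curvePairing_le (hγ : Continuous γ) (hχ : Continuous χ)
    (hχs : HasCompactSupport χ) {p p' : ℝ≥0∞} (hp : 2 ≤ p) [hpp : p.HolderConjugate p'] {σ : ℝ}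
    (hLS : LocalSmoothingEstimate γ χ p σ) {κ R : ℝ} (hκ : 0 < κ) (hR : 0 < R) :
    ∃ K : ℝ, ∀ (l N w : ℝ) (m : ℕ) (α : ℕ → ℂ) (θ c : ℕ → EuclideanSpace ℝ (Fin n))
      (P : ℕ → 𝓢(EuclideanSpace ℝ (Fin n), ℂ)) (f : 𝓢(EuclideanSpace ℝ (Fin n), ℂ))
      (θ₀ : EuclideanSpace ℝ (Fin n)) (a : ℝ → EuclideanSpace ℝ (Fin n)),
      1 ≤ l → 0 < N → 2 * N ≤ l → 0 < w → w ≤ 1 → (∀ k < m, ‖α k‖ ≤ R) →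
      (∀ j < m, ∀ k < m, κ * |(j : ℝ) - k| ≤ N * ‖c j - c k‖) →
      (∀ k x, P k x = wavePacket W.φ l N (θ k) (c k) x) →
      (∀ x, f x = ∑ k ∈ Finset.range m, α k * P k x) → ‖θ₀‖ = 1 →
      ∃ g : ℝ → 𝓢(EuclideanSpace ℝ (Fin n), ℂ),
        (∀ t x, g t x = (Real.fourierChar (-(l * inner ℝ θ₀ (x - a t))) : ℂ) *
          𝓕 W.η (N • (x - a t))) ∧
        (Measurable (fun t => curvePairing γ χ t (g t) f) →
          ∫⁻ t in Icc 1 (1 + w), ‖curvePairing γ χ t (g t) f‖ₑ ≤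
            ENNReal.ofReal (K * (l ^ (-σ) * ((N ^ n)⁻¹) ^ (1 - p.toReal⁻¹) *
              (m * (N ^ n)⁻¹) ^ p.toReal⁻¹ * w ^ (1 - p.toReal⁻¹)))) := by
  obtain ⟨C, hC⟩ := hLS
  have hp1 : 1 ≤ p := le_trans (by norm_num) hp
  obtain ⟨C₁, hC₁, htest⟩ := exists_bessel_testFunctions W.contDiff_η W.tsupport_η σ (n + 1)
  obtain ⟨K₁, hK₁, hdecay⟩ := eLpNorm_le_of_decay (E := EuclideanSpace ℝ (Fin n)) (M := n + 1)
    (by simp) (p := p') (ENNReal.HolderConjugate.one_le p' p)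
  obtain ⟨K₂, hK₂, hpack⟩ := eLpNorm_sum_wavePacket_le W.contDiff_φ.continuous W.tsupport_φ
    W.φ_nonneg W.φ_le_one hp1 hκ hR
  rw [finrank_euclideanSpace_fin, toReal_inv_holderConjugate (p := p) (p' := p')] at hdecay
  rw [finrank_euclideanSpace_fin] at hpack
  refine ⟨C₁ * K₁ * (C * K₂), ?_⟩
  intro l N w m α θ c P f θ₀ a hl hN hNl hw hw1 hα hsep hP hf hθ₀
  choose Q H hQH hH hQ using fun t => htest l N θ₀ (a t) hl hN hNl hθ₀
  refine ⟨fun t => 𝓕 (H t), fun t x => ?_, fun hmeas => ?_⟩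
  · rw [← hH t x, SchwartzMap.fourier_coe]
  have hl0 : 0 < l := by linarith
  refine (lintegral_enorm_pairing_le_ofReal (p' := p') hp (hC f) hw hw1 Q H hQH
    (D := C₁ * l ^ (-σ) * (K₁ * ((N ^ n)⁻¹) ^ (1 - p.toReal⁻¹)))
    (F := K₂ * (m * (N ^ n)⁻¹) ^ p.toReal⁻¹) (by positivity) (by positivity) (fun t => ?_) ?_
    hmeas fun t => ?_).trans (ENNReal.ofReal_le_ofReal (le_of_eq (by ring)))
  · refine hdecay N _ (a t) _ hN (by positivity) fun x => ?_
    rw [SchwartzMap.fourier_coe]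
    exact hQ t x
  · have hfe : (f : EuclideanSpace ℝ (Fin n) → ℂ) =
        fun x => ∑ k ∈ Finset.range m, α k * wavePacket W.φ l N (θ k) (c k) x := by
      ext x
      rw [hf x]
      exact Finset.sum_congr rfl fun k _ => by rw [hP]
    rw [hfe]
    exact hpack N l m α θ c hN hα hsep
  · exact (integral_mul_curveAverage hγ hχ hχs t _ f).symm

theorem PacketArc.exists_weight_le {Φ : EuclideanSpace ℝ (Fin n) → ℂ} (Γ : PacketArc γ χ θ Φ) :
    ∃ R, 0 < R ∧ ∀ s ∈ Icc Γ.c Γ.d, ‖Γ.ρ s‖ ≤ R := by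
  obtain ⟨R, hR⟩ := isCompact_Icc.exists_bound_of_continuousOn
    (s := Icc Γ.c Γ.d) Γ.continuous_weight.continuousOn
  exact ⟨max R 1, by positivity, fun s hs => (hR s hs).trans (le_max_left _ _)⟩

theorem exists_schwartz_sum (m : ℕ) (α : ℕ → ℂ) (P : ℕ → 𝓢(EuclideanSpace ℝ (Fin n), ℂ)) :
    ∃ f : 𝓢(EuclideanSpace ℝ (Fin n), ℂ), ∀ x, f x = ∑ k ∈ Finset.range m, α k * P k x := by
  refine ⟨∑ k ∈ Finset.range m, α k • P k, fun x => ?_⟩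
  rw [sum_apply]
  rfl

/-- Comparison of a lower bound for `F = X G` with an upper bound for `G`; it is applied with `F` a
sum of responses, `G` the corresponding bilinear form and `X = N ^ (n + 1)`. -/
theorem le_mul_of_lintegral_le {A X Y : ℝ} (hX : 0 < X) (hY : 0 ≤ Y) {S : Set ℝ} {F G : ℝ → ℂ}
    (hF : ENNReal.ofReal A ≤ ∫⁻ t in S, ‖F t‖ₑ) (hFG : ∀ t, F t = (X : ℂ) * G t)
    (hG : ∫⁻ t in S, ‖G t‖ₑ ≤ ENNReal.ofReal Y) : A ≤ X * Y := by
  have h : ∫⁻ t in S, ‖F t‖ₑ = ENNReal.ofReal X * ∫⁻ t in S, ‖G t‖ₑ := by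
    rw [← lintegral_const_mul' _ _ ENNReal.ofReal_ne_top]
    refine lintegral_congr fun t => ?_
    rw [hFG, enorm_mul, ← ofReal_norm, Complex.norm_real, Real.norm_of_nonneg hX.le]
  rw [h] at hF
  have h2 : ENNReal.ofReal A ≤ ENNReal.ofReal (X * Y) := by
    rw [ENNReal.ofReal_mul hX.le]
    exact hF.trans (by gcongr)
  exact (ENNReal.ofReal_le_ofReal_iff (by positivity)).1 h2

theorem PacketArc.measurable_of_sum_response_eq {Φ : EuclideanSpace ℝ (Fin n) → ℂ}
    (Γ : PacketArc γ χ θ Φ) {L N δ e X : ℝ} {m : ℕ} {b : ℕ → ℂ} {s : ℕ → ℝ} {G : ℝ → ℂ} (hX : X ≠ 0)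
    (h : ∀ t, ∑ k ∈ Finset.range m, b k * Γ.response L N (δ * (e * (t - 1))) t (s k) =
      (X : ℂ) * G t) : Measurable G := by
  have hc : ∀ s : ℝ, Continuous fun t => Γ.response L N (δ * (e * (t - 1))) t s := fun s => by
    have := (Γ.continuous_response L N δ e).comp
      (continuous_const.prodMk continuous_id : Continuous fun t : ℝ => (s, t))
    exact this
  have h1 : G = fun t => (X : ℂ)⁻¹ *
      ∑ k ∈ Finset.range m, b k * Γ.response L N (δ * (e * (t - 1))) t (s k) := by
    ext t
    rw [h, inv_mul_cancel_left₀ (Complex.ofReal_ne_zero.2 hX)]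
  rw [h1]
  exact (continuous_const.mul (continuous_finsetSum _ fun k _ =>
    continuous_const.mul (hc (s k)))).measurable

/-- A single wave packet of frequency `N ^ β`, tested against functions that travel with it. -/
theorem le_one_div_of_localSmoothing (hn : 2 ≤ n)
    (Γ : PacketArc γ χ θ fun Z => (W.Φ Z : ℂ)) (hθ : ∀ s, ‖θ s‖ = 1) {p p' : ℝ≥0∞} (hp : 2 ≤ p)
    [p.HolderConjugate p'] {σ : ℝ} (hLS : LocalSmoothingEstimate γ χ p σ) : σ ≤ 1 / n := by
  by_contra! hσ
  have hn0 : (0 : ℝ) < n := by exact_mod_cast (by omega : 0 < n)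
  have hσ0 : 0 < σ := lt_trans (by positivity) hσ
  -- the phase of the packet is harmless for `β < n`, and `β > 1 / σ` leads to a contradiction
  obtain ⟨β, hβ1, hβn⟩ := exists_between (a₁ := max 1 (1 / σ)) (a₂ := (n : ℝ))
    (max_lt (by exact_mod_cast hn) (by rwa [div_lt_comm₀ hσ0 hn0]))
  have hβσ : 1 < β * σ := by
    have := (le_max_right _ _).trans_lt hβ1
    rwa [div_lt_iff₀ hσ0] at this
  obtain ⟨R, hR, hρ⟩ := Γ.exists_weight_le
  obtain ⟨K, hK⟩ := exists_lintegral_curvePairing_le W Γ.continuous_curve Γ.continuous_cutoff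
    Γ.hasCompactSupport_cutoff (p' := p') hp hLS one_pos hR
  obtain ⟨A, τ, hA, hτ, hτ1, hev⟩ := Γ.exists_sum_response_ge (fun N => (N : ℝ) ^ β) (fun _ => 1) 0
    (tendsto_rpow_div_pow hβn) (Eventually.of_forall fun _ => le_rfl)
  set q := p.toReal⁻¹ with hq
  refine not_eventually_le_mul_rpow (c := A * τ) (K := |K| * τ ^ (1 - q)) (e := 1 - β * σ)
    (by positivity) (by linarith) ?_
  filter_upwards [hev, eventually_gt_atTop 0,
    eventually_two_mul_le_rpow ((le_max_left _ _).trans_lt hβ1)] with N hNA hN hNβ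
  obtain ⟨v, hv, hlow⟩ := hNA.2 1 one_pos
  have hN0 : (0 : ℝ) < N := by exact_mod_cast hN
  have hN1 : (1 : ℝ) ≤ N := by exact_mod_cast hN
  set l := (N : ℝ) ^ β with hl
  set s : ℕ → ℝ := Γ.centre 1 v with hs
  choose P hP using fun k => exists_schwartz_wavePacket W.contDiff_φ W.tsupport_φ l hN0 (θ (s k))
    (γ (s k))
  obtain ⟨f, hf⟩ := exists_schwartz_sum 1 (fun k => Γ.ρ (s k)) P
  obtain ⟨g, hg, hle⟩ := hK l N τ 1 (fun k => Γ.ρ (s k)) (fun k => θ (s k)) (fun k => γ (s k)) P f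
    (θ (s 0)) (fun t => (t - 1) • γ (s 0)) (by linarith) hN0 hNβ hτ hτ1
    (fun k hk => hρ _ (Γ.centre_mem hv hk))
    (fun j hj k hk => by
      rw [show j = k by omega]; simp) hP hf (hθ _)
  have hsum : ∀ t, ∑ k ∈ Finset.range 1, Γ.ρ (s k) * Γ.response l N (0 * (1 * (t - 1))) t (s k) =
      ((N ^ (n + 1) : ℝ) : ℂ) * curvePairing γ χ t (g t) f := by
    intro t
    rw [curvePairing_sum Γ.continuous_curve Γ.continuous_cutoff Γ.hasCompactSupport_cutoff t 1 1
      (fun k => Γ.ρ (s k)) (fun _ => 1) (fun _ => g t) P (by simp) hf]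
    simp only [Finset.range_one, Finset.sum_singleton, zero_mul, one_mul]
    rw [response_eq_moving W Γ l hN0 t (s 0) (hg t) (hP 0)]
    ring
  have hmeas := Γ.measurable_of_sum_response_eq (pow_ne_zero _ hN0.ne') hsum
  rw [div_one] at hlow
  have hle2 := (hle hmeas).trans (ENNReal.ofReal_le_ofReal (mul_le_mul_of_nonneg_right
    (le_abs_self K) (by positivity)))
  have hfin := le_mul_of_lintegral_le (pow_pos hN0 (n + 1)) (by positivity) hlow hsum hle2
  simp only [Nat.cast_one, mul_one, one_mul] at hfin
  have e1 : (N : ℝ) ^ (n + 1) * (((N : ℝ) ^ n)⁻¹ ^ (1 - q) * ((N : ℝ) ^ n)⁻¹ ^ q) = N := by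
    rw [← Real.rpow_add (by positivity), sub_add_cancel, Real.rpow_one, pow_succ']
    field_simp
  have e2 : l ^ (-σ) * N = (N : ℝ) ^ (1 - β * σ) := by
    rw [hl, ← Real.rpow_mul hN0.le]
    nth_rewrite 2 [← Real.rpow_one (N : ℝ)]
    rw [← Real.rpow_add hN0]
    congr 1; ring
  calc A * τ ≤ _ := hfin
    _ = |K| * τ ^ (1 - q) * (l ^ (-σ) * ((N : ℝ) ^ (n + 1) *
        (((N : ℝ) ^ n)⁻¹ ^ (1 - q) * ((N : ℝ) ^ n)⁻¹ ^ q))) := by ring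
    _ = _ := by rw [e1, e2]

/-- Packets of the same direction and of frequency comparable to `N` spread along the arc, tested
against a single fixed function. -/
theorem le_two_mul_of_localSmoothing {θ₁ : EuclideanSpace ℝ (Fin n)} (hθ₁ : ‖θ₁‖ = 1)
    (Γ : PacketArc γ χ 0 fun Z => (Real.fourierChar (2 * inner ℝ θ₁ Z) : ℂ) * (W.Φ Z : ℂ))
    {p p' : ℝ≥0∞} (hp : 2 ≤ p)
    [p.HolderConjugate p'] {σ : ℝ} (hLS : LocalSmoothingEstimate γ χ p σ) :
    σ ≤ 2 * p.toReal⁻¹ := by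
  by_contra! hσ
  obtain ⟨R, hR, hρ⟩ := Γ.exists_weight_le
  have hsep : 0 < Γ.κ * (Γ.d - Γ.c) := mul_pos Γ.κ_pos (sub_pos.2 Γ.lt)
  obtain ⟨K, hK⟩ := exists_lintegral_curvePairing_le W Γ.continuous_curve Γ.continuous_cutoff
    Γ.hasCompactSupport_cutoff (p' := p') hp hLS hsep hR
  obtain ⟨A, τ, hA, hτ, hτ1, hev⟩ := Γ.exists_sum_response_ge (fun _ => 0) (fun N => N) 1
    (by simp) (eventually_ge_atTop 1 |>.mono fun N hN => by exact_mod_cast hN)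
  set q := p.toReal⁻¹ with hq
  refine not_eventually_le_mul_rpow (c := A * τ) (K := |K| * 2 ^ (-σ) * τ ^ (1 - q))
    (e := 2 * q - σ) (by positivity) (by linarith) ?_
  filter_upwards [hev, eventually_gt_atTop 0] with N hNA hN
  obtain ⟨v, hv, hlow⟩ := hNA.2 N hN
  have hN0 : (0 : ℝ) < N := by exact_mod_cast hN
  have hN1 : (1 : ℝ) ≤ N := by exact_mod_cast hN
  set s : ℕ → ℝ := Γ.centre N v with hs
  choose P hP using fun k => exists_schwartz_wavePacket W.contDiff_φ W.tsupport_φ (2 * N) hN0 θ₁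
    (γ (s k))
  obtain ⟨f, hf⟩ := exists_schwartz_sum N (fun k => Γ.ρ (s k)) P
  obtain ⟨g, hg, hle⟩ := hK (2 * N) N (τ / N) N (fun k => Γ.ρ (s k)) (fun _ => θ₁)
    (fun k => γ (s k)) P f θ₁ (fun _ => 0) (by linarith) hN0 le_rfl (by positivity)
    ((div_le_self hτ.le hN1).trans hτ1) (fun k hk => hρ _ (Γ.centre_mem hv hk))
    (fun j hj k hk => Γ.mul_abs_sub_le_norm_centre hv hj hk) hP hf hθ₁
  have hsum : ∀ t, ∑ k ∈ Finset.range N, Γ.ρ (s k) * Γ.response 0 N (1 * (N * (t - 1))) t (s k) =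
      ((N ^ (n + 1) : ℝ) : ℂ) * curvePairing γ χ t (g t) f := by
    intro t
    rw [curvePairing_sum Γ.continuous_curve Γ.continuous_cutoff Γ.hasCompactSupport_cutoff t 1 N
      (fun k => Γ.ρ (s k)) (fun _ => 1) (fun _ => g t) P (by simp) hf]
    simp only [Finset.range_one, Finset.sum_singleton, one_mul, Finset.mul_sum]
    refine Finset.sum_congr rfl fun k _ => ?_
    rw [response_eq_oscillating W Γ hN0 t (s k) (hg t) (hP k)]
    ring
  have hmeas := Γ.measurable_of_sum_response_eq (pow_ne_zero _ hN0.ne') hsum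
  have hle2 := (hle hmeas).trans (ENNReal.ofReal_le_ofReal (mul_le_mul_of_nonneg_right
    (le_abs_self K) (by positivity)))
  have hfin := le_mul_of_lintegral_le (pow_pos hN0 (n + 1)) (by positivity) hlow hsum hle2
  have e0 : A * N * (τ / N) = A * τ := by field_simp
  rw [e0] at hfin
  refine hfin.trans (le_of_eq ?_)
  rw [← Real.rpow_natCast, ← Real.rpow_natCast, ← Real.rpow_neg hN0.le, Real.div_rpow hτ.le hN0.le,
    Real.mul_rpow zero_le_two hN0.le, div_eq_mul_inv, ← Real.rpow_neg hN0.le,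
    ← Real.rpow_mul hN0.le]
  have e1 : ((N : ℝ) * (N : ℝ) ^ (-(n : ℝ))) ^ q = (N : ℝ) ^ ((1 - n) * q) := by
    rw [Real.rpow_mul hN0.le, sub_eq_add_neg, Real.rpow_add hN0, Real.rpow_one]
  have e2 : (N : ℝ) ^ (2 * q - σ) = (N : ℝ) ^ ((n + 1 : ℕ) : ℝ) * (N : ℝ) ^ (-σ) *
      (N : ℝ) ^ (-(n : ℝ) * (1 - q)) * (N : ℝ) ^ ((1 - n) * q) * (N : ℝ) ^ (-(1 - q)) := by
    simp only [← Real.rpow_add hN0]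
    congr 1
    push_cast; ring
  rw [e1, e2]
  ring

end SingleTest

/-! ### Orthogonal sign patterns -/

section Signs

theorem sum_inv_pow_mul_pow {z w : ℂ} {m : ℕ} (hz : z ≠ 0) (hzm : z ^ m = 1) (hwm : w ^ m = 1) :
    ∑ r ∈ Finset.range m, z⁻¹ ^ r * w ^ r = if z = w then (m : ℂ) else 0 := by
  split_ifs with h
  · subst h
    simp_rw [← mul_pow, inv_mul_cancel₀ hz]
    simp
  · have h1 : z⁻¹ * w ≠ 1 := fun h2 => h (by rw [inv_mul_eq_one₀ hz] at h2; exact h2)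
    simp_rw [← mul_pow]
    have h3 := mul_neg_geom_sum (z⁻¹ * w) m
    rw [mul_pow, inv_pow, hzm, hwm, inv_one, one_mul, sub_self] at h3
    exact (mul_eq_zero.1 h3).resolve_left (sub_ne_zero.2 (Ne.symm h1))

/-- The `m`-th roots of unity provide `m` unimodular sign patterns `k ↦ z k ^ r` that are orthogonal
on average over `r`. -/
theorem exists_orthogonal_signs {m : ℕ} (hm : 0 < m) : ∃ z : ℕ → ℂ, (∀ k, ‖z k‖ = 1) ∧
    ∀ j < m, ∀ k < m, ∑ r ∈ Finset.range m, (z j)⁻¹ ^ r * (z k) ^ r =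
      if j = k then (m : ℂ) else 0 := by
  have hζ := Complex.isPrimitiveRoot_exp m hm.ne'
  set ζ := Complex.exp (2 * Real.pi * Complex.I / m) with hζd
  have hpow : ∀ k, (ζ ^ k) ^ m = 1 := fun k => by rw [← pow_mul, mul_comm, pow_mul, hζ.pow_eq_one,
    one_pow]
  refine ⟨fun k => ζ ^ k, fun k => ?_, fun j hj k hk => ?_⟩
  · exact Complex.norm_eq_one_of_pow_eq_one (hpow k) hm.ne'
  · rw [sum_inv_pow_mul_pow (pow_ne_zero _ (hζ.ne_zero hm.ne')) (hpow j) (hpow k)]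
    have : ζ ^ j = ζ ^ k ↔ j = k := ⟨hζ.pow_inj hj hk, fun h => h ▸ rfl⟩
    simp only [this]

/-- Averaging a bilinear expression over the sign patterns leaves its diagonal. -/
theorem sum_signs_bilinear {m : ℕ} {z : ℕ → ℂ}
    (hz : ∀ j < m, ∀ k < m, ∑ r ∈ Finset.range m, (z j)⁻¹ ^ r * (z k) ^ r =
      if j = k then (m : ℂ) else 0) (I : ℕ → ℕ → ℂ) :
    ∑ r ∈ Finset.range m, ∑ j ∈ Finset.range m, ∑ k ∈ Finset.range m,
      (z j)⁻¹ ^ r * z k ^ r * I j k = m * ∑ k ∈ Finset.range m, I k k := by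
  rw [Finset.sum_comm, Finset.mul_sum]
  refine Finset.sum_congr rfl fun j hj => ?_
  rw [Finset.sum_comm]
  have h : ∀ k ∈ Finset.range m, ∑ r ∈ Finset.range m, (z j)⁻¹ ^ r * z k ^ r * I j k =
      if j = k then (m : ℂ) * I j j else 0 := by
    intro k hk
    rw [← Finset.sum_mul, hz j (Finset.mem_range.1 hj) k (Finset.mem_range.1 hk)]
    split_ifs with h
    · rw [h]
    · rw [zero_mul]
  rw [Finset.sum_congr rfl h, Finset.sum_ite_eq, if_pos hj]

/-- Averaging `|∑ ± a j|²` over the sign patterns leaves the square function. -/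
theorem sum_signs_enorm_sq {m : ℕ} {z : ℕ → ℂ} (hz1 : ∀ k, ‖z k‖ = 1)
    (hz : ∀ j < m, ∀ k < m, ∑ r ∈ Finset.range m, (z j)⁻¹ ^ r * (z k) ^ r =
      if j = k then (m : ℂ) else 0) (a : ℕ → ℂ) :
    ∑ r ∈ Finset.range m, ‖∑ j ∈ Finset.range m, (z j)⁻¹ ^ r * a j‖ₑ ^ 2 =
      m * ∑ j ∈ Finset.range m, ‖a j‖ₑ ^ 2 := by
  have hconj : ∀ k, (starRingEnd ℂ) (z k)⁻¹ = z k := fun k => by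
    rw [Complex.inv_eq_conj (hz1 k), Complex.conj_conj]
  have hC : ((∑ r ∈ Finset.range m, ‖∑ j ∈ Finset.range m, (z j)⁻¹ ^ r * a j‖ ^ 2 : ℝ) : ℂ) =
      ((m * ∑ j ∈ Finset.range m, ‖a j‖ ^ 2 : ℝ) : ℂ) := by
    have h := sum_signs_bilinear hz fun j k => a j * (starRingEnd ℂ) (a k)
    simp only [Complex.mul_conj'] at h
    push_cast
    rw [← h]
    refine Finset.sum_congr rfl fun r _ => ?_
    rw [← Complex.mul_conj', map_sum, Finset.sum_mul_sum]
    refine Finset.sum_congr rfl fun j _ => Finset.sum_congr rfl fun k _ => ?_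
    rw [map_mul, map_pow, hconj]
    ring
  have hR := Complex.ofReal_injective hC
  have e : ∀ x : ℂ, ‖x‖ₑ ^ 2 = ENNReal.ofReal (‖x‖ ^ 2) := fun x => by
    rw [ENNReal.ofReal_pow (norm_nonneg _), ofReal_norm]
  simp_rw [e]
  rw [← ENNReal.ofReal_sum_of_nonneg fun _ _ => by positivity,
    ← ENNReal.ofReal_sum_of_nonneg fun _ _ => by positivity, hR,
    ENNReal.ofReal_mul (Nat.cast_nonneg m), ENNReal.ofReal_natCast]

theorem sum_rpow_half_le (m : ℕ) (U : ℕ → ℝ≥0∞) :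
    ∑ r ∈ Finset.range m, U r ^ (1 / 2 : ℝ) ≤
      (m : ℝ≥0∞) ^ (1 / 2 : ℝ) * (∑ r ∈ Finset.range m, U r) ^ (1 / 2 : ℝ) := by
  have h := ENNReal.inner_le_Lp_mul_Lq (Finset.range m) (fun _ => 1) (fun r => U r ^ (1 / 2 : ℝ))
    (p := 2) (q := 2) Real.HolderConjugate.two_two
  simp only [one_mul, ENNReal.one_rpow, Finset.sum_const, Finset.card_range, nsmul_eq_mul,
    mul_one, ← ENNReal.rpow_mul] at h
  norm_num at h ⊢
  exact h

end Signs

/-! ### Weighted norms of the test functions -/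

section Weight

variable {n : ℕ}

/-- Hölder's inequality against the weight `(1 + N ‖x‖) ^ (n + 1)`. -/
theorem exists_eLpNorm_le_weighted {p p' : ℝ≥0∞} (hp : 2 ≤ p) [hpp : p.HolderConjugate p'] :
    ∃ K : ℝ, 0 < K ∧ ∀ (N : ℝ) (F : EuclideanSpace ℝ (Fin n) → ℂ), 0 < N → Continuous F →
      eLpNorm F p' volume ≤ ENNReal.ofReal (K * ((N ^ n)⁻¹) ^ (1 / 2 - p.toReal⁻¹)) *
        (∫⁻ x, ‖(((1 + N * ‖x‖) ^ (n + 1) : ℝ) : ℂ) * F x‖ₑ ^ 2) ^ (1 / 2 : ℝ) := by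
  have hle : p⁻¹ ≤ 2⁻¹ := ENNReal.inv_le_inv.2 hp
  have hhalf : (2⁻¹ : ℝ≥0∞) + 2⁻¹ = 1 := ENNReal.inv_two_add_inv_two
  -- `1 / r + 1 / 2 = 1 / p'`; at `p = 2` this is `r = ∞`
  set r : ℝ≥0∞ := (2⁻¹ - p⁻¹)⁻¹ with hr
  have hr1 : 1 ≤ r := by
    rw [hr, ENNReal.one_le_inv]
    exact tsub_le_self.trans (by rw [← hhalf]; exact self_le_add_right _ _)
  have hrq : r.toReal⁻¹ = 1 / 2 - p.toReal⁻¹ := by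
    rw [hr, ENNReal.toReal_inv, inv_inv, ENNReal.toReal_sub_of_le hle (by simp),
      ENNReal.toReal_inv, ENNReal.toReal_inv]
    norm_num
  have : ENNReal.HolderTriple r 2 p' := ⟨by
    rw [hr, inv_inv, ← ENNReal.HolderConjugate.one_sub_inv p p', ← hhalf,
      ENNReal.sub_add_eq_add_sub hle (ne_top_of_le_ne_top (by simp) hle)]⟩
  obtain ⟨K, hK, hdecay⟩ := eLpNorm_le_of_decay (E := EuclideanSpace ℝ (Fin n)) (M := n + 1)
    (by simp) hr1
  rw [finrank_euclideanSpace_fin, hrq] at hdecay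
  refine ⟨K, hK, fun N F hN hF => ?_⟩
  have hw : ∀ x : EuclideanSpace ℝ (Fin n), 0 < (1 + N * ‖x‖) ^ (n + 1) := fun x => by positivity
  set V : EuclideanSpace ℝ (Fin n) → ℂ := fun x => (((1 + N * ‖x‖) ^ (n + 1) : ℝ) : ℂ)⁻¹ with hV
  have hFe : F = V • fun x => (((1 + N * ‖x‖) ^ (n + 1) : ℝ) : ℂ) * F x := by
    ext x
    simp only [Pi.smul_apply', smul_eq_mul, hV]
    rw [inv_mul_cancel_left₀ (Complex.ofReal_ne_zero.2 (hw x).ne')]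
  have hc : Continuous fun x : EuclideanSpace ℝ (Fin n) => (((1 + N * ‖x‖) ^ (n + 1) : ℝ) : ℂ) := by
    fun_prop
  have hVc : Continuous V := hc.inv₀ fun x => Complex.ofReal_ne_zero.2 (hw x).ne'
  have h1 := eLpNorm_smul_le_mul_eLpNorm (p := r) (q := 2) (r := p') (μ := volume)
    (hc.mul hF).aestronglyMeasurable hVc.aestronglyMeasurable
  have h1' : eLpNorm F p' volume ≤ eLpNorm V r volume *
      eLpNorm (fun x => (((1 + N * ‖x‖) ^ (n + 1) : ℝ) : ℂ) * F x) 2 volume := by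
    conv_lhs => rw [hFe]
    exact h1
  have h2 := hdecay N 1 0 V hN one_pos fun x => by
    rw [sub_zero, hV]
    simp only
    rw [norm_inv, Complex.norm_real, Real.norm_of_nonneg (hw x).le, mul_inv_cancel₀ (hw x).ne']
  rw [one_mul] at h2
  have h3 : eLpNorm (fun x => (((1 + N * ‖x‖) ^ (n + 1) : ℝ) : ℂ) * F x) 2 volume =
      (∫⁻ x, ‖(((1 + N * ‖x‖) ^ (n + 1) : ℝ) : ℂ) * F x‖ₑ ^ 2) ^ (1 / 2 : ℝ) := by
    rw [eLpNorm_eq_lintegral_rpow_enorm_toReal two_ne_zero ENNReal.ofNat_ne_top]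
    norm_num
  rw [← h3]
  exact h1'.trans (by gcongr)

theorem exists_lintegral_weighted_sq_le : ∃ K : ℝ, 0 < K ∧
    ∀ (N A : ℝ) (F : EuclideanSpace ℝ (Fin n) → ℂ), 0 < N → 0 < A →
      (∀ x, (1 + N * ‖x - 0‖) ^ (2 * (n + 1)) * ‖F x‖ ≤ A) →
      ∫⁻ x, ‖(((1 + N * ‖x‖) ^ (n + 1) : ℝ) : ℂ) * F x‖ₑ ^ 2 ≤
        ENNReal.ofReal (K * (A ^ 2 * (N ^ n)⁻¹)) := by
  obtain ⟨K, hK, hdecay⟩ := eLpNorm_le_of_decay (E := EuclideanSpace ℝ (Fin n)) (M := n + 1)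
    (by simp) one_le_two
  refine ⟨K ^ 2, by positivity, fun N A F hN hA hF => ?_⟩
  have hw : ∀ x : EuclideanSpace ℝ (Fin n), 0 < (1 + N * ‖x‖) ^ (n + 1) := fun x => by positivity
  have h := hdecay N A 0 (fun x => (((1 + N * ‖x‖) ^ (n + 1) : ℝ) : ℂ) * F x) hN hA fun x => by
    have := hF x
    rw [sub_zero] at this ⊢
    rwa [norm_mul, Complex.norm_real, Real.norm_of_nonneg (hw x).le, ← mul_assoc, ← pow_add,
      ← two_mul]
  have h3 : ∫⁻ x, ‖(((1 + N * ‖x‖) ^ (n + 1) : ℝ) : ℂ) * F x‖ₑ ^ 2 =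
      eLpNorm (fun x => (((1 + N * ‖x‖) ^ (n + 1) : ℝ) : ℂ) * F x) 2 volume ^ 2 := by
    have := eLpNorm_nnreal_pow_eq_lintegral (μ := (volume : Measure (EuclideanSpace ℝ (Fin n))))
      (f := fun x => (((1 + N * ‖x‖) ^ (n + 1) : ℝ) : ℂ) * F x) (p := 2) two_ne_zero
    simpa using this.symm
  rw [h3]
  calc _ ≤ _ := pow_le_pow_left' h 2
    _ = _ := by
      rw [← ENNReal.ofReal_pow (by positivity), finrank_euclideanSpace_fin]
      congr 1
      have : (((N ^ n)⁻¹) ^ (ENNReal.toReal 2)⁻¹) ^ 2 = (N ^ n)⁻¹ := by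
        rw [← Real.rpow_natCast, ← Real.rpow_mul (by positivity)]
        norm_num
      rw [mul_pow, mul_pow, this]
      ring

end Weight

/-! ### Averaging over signs -/

section Randomized

variable {n : ℕ}

/-- Superpositions `∑ ± b j t · g j` of test functions `g j` at the origin, with the `r`-th sign
pattern, and bounds `D r t` for their dual norms. The dual norm is first estimated by a weighted
`L²` norm, in which the cross terms cancel on averaging over `r`: the mean of `D r t ^ 2` over `r`
is at most a constant times `m` times the square of the bound for one test function. -/
theorem exists_sum_sign_tests_le (W : PacketProfile n) {p p' : ℝ≥0∞} (hp : 2 ≤ p)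
    [hpp : p.HolderConjugate p'] (σ : ℝ) {R : ℝ} (hR : 0 < R) :
    ∃ K : ℝ, 0 < K ∧ ∀ (l N : ℝ) (m : ℕ) (θ : ℕ → EuclideanSpace ℝ (Fin n)) (b : ℕ → ℝ → ℂ)
      (z : ℕ → ℂ), 1 ≤ l → 0 < N → 2 * N ≤ l → 0 < m → (∀ k, ‖θ k‖ = 1) →
      (∀ k, Continuous (b k)) → (∀ k < m, ∀ t, ‖b k t‖ ≤ R) → (∀ k, ‖z k‖ = 1) →
      (∀ j < m, ∀ k < m, ∑ r ∈ Finset.range m, (z j)⁻¹ ^ r * (z k) ^ r =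
        if j = k then (m : ℂ) else 0) →
      ∃ (g : ℕ → 𝓢(EuclideanSpace ℝ (Fin n), ℂ))
        (Q H : ℕ → ℝ → 𝓢(EuclideanSpace ℝ (Fin n), ℂ)) (D : ℕ → ℝ → ℝ≥0∞),
        (∀ k x, g k x = (Real.fourierChar (-(l * inner ℝ (θ k) (x - 0))) : ℂ) *
          𝓕 W.η (N • (x - 0))) ∧
        (∀ r t x, H r t x = (((1 + ‖x‖ ^ 2) ^ (σ / 2) : ℝ) : ℂ) * Q r t x) ∧
        (∀ r t x, (𝓕 (H r t) : 𝓢(EuclideanSpace ℝ (Fin n), ℂ)) x =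
          ∑ j ∈ Finset.range m, ((z j)⁻¹ ^ r * b j t) * g j x) ∧
        (∀ r, Measurable (D r)) ∧ (∀ r t, D r t ≠ 0) ∧ (∀ r < m, ∀ t, D r t ≠ ⊤) ∧
        (∀ r t, eLpNorm (𝓕 (Q r t) : 𝓢(EuclideanSpace ℝ (Fin n), ℂ)) p' volume ≤ D r t) ∧
        ∀ t, ∑ r ∈ Finset.range m, D r t ^ 2 ≤ ENNReal.ofReal
          (K * (m * l ^ (-σ) * ((N ^ n)⁻¹) ^ (1 - p.toReal⁻¹)) ^ 2) := by
  obtain ⟨C₁, hC₁, htest⟩ := exists_bessel_testFunctions W.contDiff_η W.tsupport_η σ (2 * (n + 1))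
  obtain ⟨K₁, hK₁, hweight⟩ := exists_eLpNorm_le_weighted (n := n) (p' := p') hp
  obtain ⟨K₂, hK₂, hsq⟩ := exists_lintegral_weighted_sq_le (n := n)
  refine ⟨2 * K₁ ^ 2 * K₂ * R ^ 2 * C₁ ^ 2, by positivity, ?_⟩
  intro l N m θ b z hl hN hNl hm hθ hb hbR hz1 hz
  have hl0 : 0 < l := by linarith
  choose Q H hQH hH hQ using fun k => htest l N (θ k) 0 hl hN hNl (hθ k)
  set E : ℝ := K₂ * ((C₁ * l ^ (-σ)) ^ 2 * (N ^ n)⁻¹) with hE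
  have hE0 : 0 < E := by positivity
  have hm' : (0 : ℝ) < m := by exact_mod_cast hm
  set q := p.toReal⁻¹ with hq
  set c : ℝ := K₁ * ((N ^ n)⁻¹) ^ (1 / 2 - q) with hc
  have hc0 : 0 < c := by positivity
  set Y : ℝ := m * R ^ 2 * E with hY
  have hY0 : 0 < Y := by positivity
  set h : ℕ → EuclideanSpace ℝ (Fin n) → ℂ := fun j x =>
    (((1 + N * ‖x‖) ^ (n + 1) : ℝ) : ℂ) * (𝓕 (Q j) : 𝓢(EuclideanSpace ℝ (Fin n), ℂ)) x with hh
  have hhc : ∀ j, Continuous (h j) := fun j =>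
    Continuous.mul (by fun_prop) (𝓕 (Q j) : 𝓢(EuclideanSpace ℝ (Fin n), ℂ)).continuous
  have hhE : ∀ j, ∫⁻ x, ‖h j x‖ₑ ^ 2 ≤ ENNReal.ofReal E := fun j =>
    hsq N (C₁ * l ^ (-σ)) _ hN (by positivity) fun x => by
      rw [SchwartzMap.fourier_coe]; exact hQ j x
  -- the weighted `L²` norm of the test function with the `r`-th sign pattern, squared
  set U : ℕ → ℝ → ℝ≥0∞ := fun r t =>
    ∫⁻ x, ‖∑ j ∈ Finset.range m, (z j)⁻¹ ^ r * (b j t * h j x)‖ₑ ^ 2 with hU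
  have hUm : ∀ r, Measurable (U r) := by
    intro r
    have hcont : Continuous fun a : ℝ × EuclideanSpace ℝ (Fin n) =>
        ‖∑ j ∈ Finset.range m, (z j)⁻¹ ^ r * (b j a.1 * h j a.2)‖ₑ ^ 2 := by
      refine (ENNReal.continuous_pow 2).comp (continuous_enorm.comp ?_)
      exact continuous_finsetSum _ fun j _ => continuous_const.mul
        (((hb j).comp continuous_fst).mul ((hhc j).comp continuous_snd))
    exact hcont.measurable.lintegral_prod_right'
  have hUsum : ∀ t, ∑ r ∈ Finset.range m, U r t ≤ ENNReal.ofReal (m * Y) := by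
    intro t
    have hmeas : ∀ j, Measurable fun x => ‖b j t * h j x‖ₑ ^ 2 := fun j =>
      ((ENNReal.continuous_pow 2).comp
        (continuous_enorm.comp (continuous_const.mul (hhc j)))).measurable
    have hone : ∀ j ∈ Finset.range m, ∫⁻ x, ‖b j t * h j x‖ₑ ^ 2 ≤ ENNReal.ofReal (R ^ 2 * E) := by
      intro j hj
      calc ∫⁻ x, ‖b j t * h j x‖ₑ ^ 2 ≤ ∫⁻ x, ENNReal.ofReal (R ^ 2) * ‖h j x‖ₑ ^ 2 := by
            refine lintegral_mono fun x => ?_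
            simp only
            rw [enorm_mul, mul_pow, ENNReal.ofReal_pow hR.le]
            gcongr
            rw [← ofReal_norm]
            exact ENNReal.ofReal_le_ofReal (hbR j (Finset.mem_range.1 hj) t)
        _ = ENNReal.ofReal (R ^ 2) * ∫⁻ x, ‖h j x‖ₑ ^ 2 :=
            lintegral_const_mul' _ _ ENNReal.ofReal_ne_top
        _ ≤ _ := by
            rw [ENNReal.ofReal_mul (by positivity)]
            gcongr
            exact hhE j
    calc ∑ r ∈ Finset.range m, U r t
        = ∫⁻ x, ∑ r ∈ Finset.range m,
            ‖∑ j ∈ Finset.range m, (z j)⁻¹ ^ r * (b j t * h j x)‖ₑ ^ 2 := by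
          rw [lintegral_finsetSum]
          intro r _
          exact ((ENNReal.continuous_pow 2).comp (continuous_enorm.comp
            (continuous_finsetSum _ fun j _ => continuous_const.mul
              (continuous_const.mul (hhc j))))).measurable
      _ = ∫⁻ x, m * ∑ j ∈ Finset.range m, ‖b j t * h j x‖ₑ ^ 2 := by
          refine lintegral_congr fun x => ?_
          exact sum_signs_enorm_sq hz1 hz _
      _ = m * ∑ j ∈ Finset.range m, ∫⁻ x, ‖b j t * h j x‖ₑ ^ 2 := by
          rw [lintegral_const_mul' _ _ (ENNReal.natCast_ne_top m),
            lintegral_finsetSum _ fun j _ => hmeas j]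
      _ ≤ m * ∑ j ∈ Finset.range m, ENNReal.ofReal (R ^ 2 * E) := by
          gcongr with j hj
          exact hone j hj
      _ = ENNReal.ofReal (m * Y) := by
          rw [Finset.sum_const, Finset.card_range, nsmul_eq_mul, hY, mul_assoc (m : ℝ),
            ENNReal.ofReal_mul hm'.le, ENNReal.ofReal_mul hm'.le, ENNReal.ofReal_natCast]
  refine ⟨fun k => 𝓕 (H k),
    fun r t => ∑ j ∈ Finset.range m, ((z j)⁻¹ ^ r * b j t) • Q j,
    fun r t => ∑ j ∈ Finset.range m, ((z j)⁻¹ ^ r * b j t) • H j,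
    -- `Y` bounds the mean of `U r t` over `r`; adding it keeps the bounds away from zero
    fun r t => ENNReal.ofReal c * (U r t + ENNReal.ofReal Y) ^ (1 / 2 : ℝ), ?_, ?_, ?_, ?_, ?_, ?_,
    ?_, ?_⟩
  · intro k x
    rw [← hH k x, SchwartzMap.fourier_coe]
  · intro r t x
    simp only [sum_apply, smul_apply, smul_eq_mul, hQH, Finset.mul_sum]
    exact Finset.sum_congr rfl fun j _ => by ring
  · intro r t x
    simp only [FourierTransform.fourier_sum, FourierTransform.fourier_smul, sum_apply,
      smul_apply, smul_eq_mul]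
  · exact fun r => (((hUm r).add_const _).pow_const _).const_mul _
  · intro r t
    refine mul_ne_zero (by simpa using hc0) ?_
    rw [Ne, ENNReal.rpow_eq_zero_iff_of_pos (by norm_num)]
    simp [hY0]
  · intro r hr t
    refine ENNReal.mul_ne_top ENNReal.ofReal_ne_top
      (ENNReal.rpow_ne_top_of_nonneg (by norm_num) (ENNReal.add_ne_top.2
        ⟨ne_top_of_le_ne_top ENNReal.ofReal_ne_top
          ((Finset.single_le_sum (f := fun r => U r t) (fun _ _ => zero_le)
            (Finset.mem_range.2 hr)).trans (hUsum t)), ENNReal.ofReal_ne_top⟩))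
  · intro r t
    refine (hweight N _ hN (SchwartzMap.continuous _)).trans ?_
    refine mul_le_mul' le_rfl (ENNReal.rpow_le_rpow ?_ (by norm_num))
    refine le_trans (le_of_eq ?_) (self_le_add_right _ _)
    refine lintegral_congr fun x => ?_
    congr 2
    simp only [FourierTransform.fourier_sum, FourierTransform.fourier_smul, sum_apply,
      smul_apply, smul_eq_mul, Finset.mul_sum, hh]
    exact Finset.sum_congr rfl fun j _ => by ring
  · intro t
    have e1 : ∀ r, (ENNReal.ofReal c * (U r t + ENNReal.ofReal Y) ^ (1 / 2 : ℝ)) ^ 2 =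
        ENNReal.ofReal (c ^ 2) * (U r t + ENNReal.ofReal Y) := by
      intro r
      rw [mul_pow, ← ENNReal.ofReal_pow hc0.le, ← ENNReal.rpow_natCast, ← ENNReal.rpow_mul]
      norm_num
    simp only [e1]
    rw [← Finset.mul_sum, Finset.sum_add_distrib, Finset.sum_const, Finset.card_range,
      nsmul_eq_mul]
    calc _ ≤ ENNReal.ofReal (c ^ 2) * (ENNReal.ofReal (m * Y) + m * ENNReal.ofReal Y) := by
          gcongr; exact hUsum t
      _ = ENNReal.ofReal (c ^ 2 * (m * Y + m * Y)) := by
          rw [← ENNReal.ofReal_natCast m, ← ENNReal.ofReal_mul hm'.le,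
            ← ENNReal.ofReal_add (by positivity) (by positivity),
            ← ENNReal.ofReal_mul (by positivity)]
      _ = _ := by
          congr 1
          have hy : 0 < (N ^ n)⁻¹ := by positivity
          have e2 : (((N ^ n)⁻¹) ^ (1 - q)) ^ 2 = (((N ^ n)⁻¹) ^ (1 / 2 - q)) ^ 2 * (N ^ n)⁻¹ := by
            rw [show 1 - q = 1 / 2 - q + 1 / 2 by ring, Real.rpow_add hy, mul_pow,
              ← Real.sqrt_eq_rpow, Real.sq_sqrt hy.le]
          rw [hY, hE, hc, mul_pow (m * l ^ (-σ)), e2]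
          ring

/-- Upper bound for the diagonal `∑ k, b k t · ∫ g k · A_t P k`, where each packet `P k` is tested
only against the test function `g k` of the same direction. It is the average over the sign patterns
of the pairings of `∑ ± P k` with `∑ ± b k g k`, the signs of the two sums being inverse to each
other. -/
theorem exists_lintegral_diagonal_le {γ : ℝ → EuclideanSpace ℝ (Fin n)} {χ : ℝ → ℝ}
    (W : PacketProfile n) (hγ : Continuous γ) (hχ : Continuous χ)
    (hχs : HasCompactSupport χ) {p p' : ℝ≥0∞} (hp : 2 ≤ p) [hpp : p.HolderConjugate p'] {σ : ℝ}
    (hLS : LocalSmoothingEstimate γ χ p σ) {κ R : ℝ} (hκ : 0 < κ) (hR : 0 < R) :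
    ∃ K : ℝ, 0 ≤ K ∧ ∀ (l N w : ℝ) (m : ℕ) (θ c : ℕ → EuclideanSpace ℝ (Fin n)) (b : ℕ → ℝ → ℂ)
      (P : ℕ → 𝓢(EuclideanSpace ℝ (Fin n), ℂ)),
      1 ≤ l → 0 < N → 2 * N ≤ l → 0 < w → w ≤ 1 → 0 < m → (∀ k, ‖θ k‖ = 1) →
      (∀ k, Continuous (b k)) → (∀ k < m, ∀ t, ‖b k t‖ ≤ R) →
      (∀ j < m, ∀ k < m, κ * |(j : ℝ) - k| ≤ N * ‖c j - c k‖) →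
      (∀ k x, P k x = wavePacket W.φ l N (θ k) (c k) x) →
      ∃ g : ℕ → 𝓢(EuclideanSpace ℝ (Fin n), ℂ),
        (∀ k x, g k x = (Real.fourierChar (-(l * inner ℝ (θ k) (x - 0))) : ℂ) *
          𝓕 W.η (N • (x - 0))) ∧
        ∫⁻ t in Icc 1 (1 + w), ‖∑ k ∈ Finset.range m, b k t * curvePairing γ χ t (g k) (P k)‖ₑ ≤
          ENNReal.ofReal (K * ((m : ℝ) ^ (1 / 2 : ℝ) * (l ^ (-σ) * ((N ^ n)⁻¹) ^ (1 - p.toReal⁻¹) *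
              (m * (N ^ n)⁻¹) ^ p.toReal⁻¹ * w ^ (1 - p.toReal⁻¹)))) := by
  obtain ⟨C, hC⟩ := hLS
  have hp1 : 1 ≤ p := le_trans (by norm_num) hp
  obtain ⟨K₁, hK₁, htests⟩ := exists_sum_sign_tests_le W (p' := p') hp σ hR
  obtain ⟨K₂, hK₂, hpack⟩ := eLpNorm_sum_wavePacket_le W.contDiff_φ.continuous W.tsupport_φ
    W.φ_nonneg W.φ_le_one hp1 hκ one_pos
  rw [finrank_euclideanSpace_fin] at hpack
  refine ⟨K₁ ^ (1 / 2 : ℝ) * (C * K₂), by positivity, ?_⟩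
  intro l N w m θ c b P hl hN hNl hw hw1 hm hθ hb hbR hsep hP
  obtain ⟨z, hz1, hz⟩ := exists_orthogonal_signs hm
  obtain ⟨g, Q, H, D, hg, hQH, hH, hDm, hD0, hDt, hD, hDsum⟩ :=
    htests l N m θ b z hl hN hNl hm hθ hb hbR hz1 hz
  refine ⟨g, hg, ?_⟩
  have hl0 : 0 < l := by linarith
  have hm' : (0 : ℝ) < m := by exact_mod_cast hm
  set q := p.toReal⁻¹ with hq
  choose f hf using fun r : ℕ => exists_schwartz_sum m (fun k => z k ^ r) P
  set G : ℕ → ℝ → ℂ := fun r t => curvePairing γ χ t (𝓕 (H r t)) (f r) with hG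
  have hGeq : ∀ r t, G r t = ∑ j ∈ Finset.range m, ∑ k ∈ Finset.range m,
      (z j)⁻¹ ^ r * z k ^ r * (b j t * curvePairing γ χ t (g j) (P k)) := by
    intro r t
    rw [hG]
    simp only
    rw [curvePairing_sum hγ hχ hχs t m m (fun k => z k ^ r) (fun j => (z j)⁻¹ ^ r * b j t) g P
      (hH r t) (hf r)]
    exact Finset.sum_congr rfl fun j _ => Finset.sum_congr rfl fun k _ => by ring
  have hGm : ∀ r, Measurable (G r) := by
    intro r
    rw [show G r = fun t => _ from funext (hGeq r)]
    exact (continuous_finsetSum _ fun j _ => continuous_finsetSum _ fun k _ =>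
      continuous_const.mul ((hb j).mul (continuous_curvePairing hγ hχ hχs (g j) (P k)))).measurable
  have hdiag : ∀ t, ∑ k ∈ Finset.range m, b k t * curvePairing γ χ t (g k) (P k) =
      ((m : ℝ)⁻¹ : ℝ) * ∑ r ∈ Finset.range m, G r t := by
    intro t
    have hmC : (m : ℂ) ≠ 0 := by exact_mod_cast hm.ne'
    simp_rw [hGeq]
    rw [sum_signs_bilinear hz fun j k => b j t * curvePairing γ χ t (g j) (P k)]
    push_cast
    rw [inv_mul_cancel_left₀ hmC]
  have hvol : volume (Icc 1 (1 + w)) = ENNReal.ofReal w := by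
    rw [Real.volume_Icc]; congr 1; ring
  set F : ℝ := K₂ * (m * (N ^ n)⁻¹) ^ q with hF
  have hF0 : 0 < F := by positivity
  have hfF : ∀ r, eLpNorm (f r) p volume ≤ ENNReal.ofReal F := by
    intro r
    have hfe : (f r : EuclideanSpace ℝ (Fin n) → ℂ) =
        fun x => ∑ k ∈ Finset.range m, z k ^ r * wavePacket W.φ l N (θ k) (c k) x := by
      ext x
      rw [hf r x]
      exact Finset.sum_congr rfl fun k _ => by rw [hP]
    rw [hfe]
    exact hpack N l m _ θ c hN (fun k _ => by rw [norm_pow, hz1, one_pow]) hsep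
  set X : ℝ := C * F * w ^ (1 / 2 - q) with hX
  have hX0 : 0 ≤ X := by positivity
  have hone : ∀ r ∈ Finset.range m, ∫⁻ t in Icc 1 (1 + w), ‖G r t‖ₑ ≤
      (∫⁻ t in Icc 1 (1 + w), D r t ^ 2) ^ (1 / 2 : ℝ) * ENNReal.ofReal X := by
    intro r hr
    refine (lintegral_enorm_pairing_le (p' := p') hp (hC (f r)) (S := Icc 1 (1 + w))
      (Icc_subset_Icc_right (by linarith)) measurableSet_Icc (Q r) (H r) (hQH r) (hDm r) (hD0 r)
      (hDt r (Finset.mem_range.1 hr)) (fun t _ => hD r t) (hGm r)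
      (fun t _ => (integral_mul_curveAverage hγ hχ hχs t _ (f r)).symm)).trans ?_
    rw [hvol, ENNReal.ofReal_rpow_of_pos hw, hX, ENNReal.ofReal_mul (by positivity),
      ENNReal.ofReal_mul (by positivity), ENNReal.ofReal_coe_nnreal]
    gcongr
    exact hfF r
  set V : ℝ := m * l ^ (-σ) * ((N ^ n)⁻¹) ^ (1 - q) with hV
  have hV0 : 0 < V := by positivity
  have htot : ∑ r ∈ Finset.range m, ∫⁻ t in Icc 1 (1 + w), ‖G r t‖ₑ ≤
      ENNReal.ofReal ((m : ℝ) ^ (1 / 2 : ℝ) * (K₁ * V ^ 2 * w) ^ (1 / 2 : ℝ) * X) := by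
    calc ∑ r ∈ Finset.range m, ∫⁻ t in Icc 1 (1 + w), ‖G r t‖ₑ
        ≤ ∑ r ∈ Finset.range m,
          (∫⁻ t in Icc 1 (1 + w), D r t ^ 2) ^ (1 / 2 : ℝ) * ENNReal.ofReal X :=
          Finset.sum_le_sum hone
      _ = (∑ r ∈ Finset.range m, (∫⁻ t in Icc 1 (1 + w), D r t ^ 2) ^ (1 / 2 : ℝ)) *
          ENNReal.ofReal X := (Finset.sum_mul _ _ _).symm
      _ ≤ ((m : ℝ≥0∞) ^ (1 / 2 : ℝ) *
          (∑ r ∈ Finset.range m, ∫⁻ t in Icc 1 (1 + w), D r t ^ 2) ^ (1 / 2 : ℝ)) *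
          ENNReal.ofReal X := by
          gcongr
          exact sum_rpow_half_le m _
      _ ≤ ((m : ℝ≥0∞) ^ (1 / 2 : ℝ) *
          (ENNReal.ofReal (K₁ * V ^ 2 * w)) ^ (1 / 2 : ℝ)) * ENNReal.ofReal X := by
          gcongr
          rw [← lintegral_finsetSum _ fun r _ => (hDm r).pow_const 2]
          calc _ ≤ ∫⁻ t in Icc 1 (1 + w), ENNReal.ofReal (K₁ * V ^ 2) :=
                lintegral_mono fun t => hDsum t
            _ = _ := by
                rw [setLIntegral_const, hvol, ← ENNReal.ofReal_mul (by positivity)]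
      _ = _ := by
          rw [← ENNReal.ofReal_natCast m, ENNReal.ofReal_rpow_of_pos hm',
            ENNReal.ofReal_rpow_of_pos (by positivity), ← ENNReal.ofReal_mul (by positivity),
            ← ENNReal.ofReal_mul (by positivity)]
  calc ∫⁻ t in Icc 1 (1 + w), ‖∑ k ∈ Finset.range m, b k t * curvePairing γ χ t (g k) (P k)‖ₑ
      = ENNReal.ofReal (m : ℝ)⁻¹ * ∫⁻ t in Icc 1 (1 + w), ‖∑ r ∈ Finset.range m, G r t‖ₑ := by
        rw [← lintegral_const_mul' _ _ ENNReal.ofReal_ne_top]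
        refine lintegral_congr fun t => ?_
        rw [hdiag, enorm_mul, ← ofReal_norm, Complex.norm_real, Real.norm_of_nonneg (by positivity)]
    _ ≤ ENNReal.ofReal (m : ℝ)⁻¹ *
        ∑ r ∈ Finset.range m, ∫⁻ t in Icc 1 (1 + w), ‖G r t‖ₑ := by
        gcongr
        rw [← lintegral_finsetSum _ fun r _ => (hGm r).enorm]
        exact lintegral_mono fun t => enorm_sum_le _ _
    _ ≤ ENNReal.ofReal (m : ℝ)⁻¹ *
        ENNReal.ofReal ((m : ℝ) ^ (1 / 2 : ℝ) * (K₁ * V ^ 2 * w) ^ (1 / 2 : ℝ) * X) := by gcongr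
    _ = _ := by
        rw [← ENNReal.ofReal_mul (by positivity)]
        congr 1
        have e1 : (K₁ * V ^ 2 * w) ^ (1 / 2 : ℝ) = K₁ ^ (1 / 2 : ℝ) * V * w ^ (1 / 2 : ℝ) := by
          rw [Real.mul_rpow (by positivity) hw.le, Real.mul_rpow hK₁.le (by positivity),
            ← Real.sqrt_eq_rpow (V ^ 2), Real.sqrt_sq hV0.le]
        have e2 : w ^ (1 - q) = w ^ (1 / 2 : ℝ) * w ^ (1 / 2 - q) := by
          rw [← Real.rpow_add hw]; congr 1; ring
        rw [e1, e2, hX, hF, hV]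
        field_simp

end Randomized

/-! ### The bound obtained from packets in all normal directions -/

section Spread

variable {n : ℕ} {γ : ℝ → EuclideanSpace ℝ (Fin n)} {χ : ℝ → ℝ}
  {θ : ℝ → EuclideanSpace ℝ (Fin n)} (W : PacketProfile n)

/-- Packets of frequency `N ^ β` in all the normal directions along the arc, superposed with
signs and tested against test functions at the origin with the inverse signs. -/
theorem le_mul_of_localSmoothing (hn : 2 ≤ n)
    (Γ : PacketArc γ χ θ fun Z => (W.Φ Z : ℂ)) (hθ : ∀ s, ‖θ s‖ = 1) {p p' : ℝ≥0∞} (hp : 2 ≤ p)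
    [p.HolderConjugate p'] {σ : ℝ} (hLS : LocalSmoothingEstimate γ χ p σ) :
    σ ≤ 1 / n * (1 / 2 + 2 * p.toReal⁻¹) := by
  by_contra! hσ
  set q := p.toReal⁻¹ with hq
  have hq0 : 0 ≤ q := by positivity
  have hn0 : (0 : ℝ) < n := by exact_mod_cast (by omega : 0 < n)
  have hσ0 : 0 < σ := lt_of_le_of_lt (by positivity) hσ
  -- the phase of the packets is harmless for `β < n`, and `β` close to `n` contradicts `hσ`
  obtain ⟨β, hβ1, hβn⟩ := exists_between (a₁ := max 1 ((1 / 2 + 2 * q) / σ)) (a₂ := (n : ℝ))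
    (max_lt (by exact_mod_cast hn) (by
      rw [div_lt_iff₀ hσ0]
      rwa [one_div_mul_eq_div, div_lt_iff₀' hn0] at hσ))
  have hβσ : 1 / 2 + 2 * q < β * σ := by
    have := (le_max_right _ _).trans_lt hβ1
    rwa [div_lt_iff₀ hσ0] at this
  obtain ⟨R, hR, hρ⟩ := Γ.exists_weight_le
  have hsep : 0 < Γ.κ * (Γ.d - Γ.c) := mul_pos Γ.κ_pos (sub_pos.2 Γ.lt)
  obtain ⟨K, hK0, hK⟩ := exists_lintegral_diagonal_le W Γ.continuous_curve Γ.continuous_cutoff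
    Γ.hasCompactSupport_cutoff (p' := p') hp hLS hsep hR
  obtain ⟨A, τ, hA, hτ, hτ1, hev⟩ := Γ.exists_sum_response_ge (fun N => (N : ℝ) ^ β) (fun N => N) 1
    (tendsto_rpow_div_pow hβn) (eventually_ge_atTop 1 |>.mono fun N hN => by exact_mod_cast hN)
  refine not_eventually_le_mul_rpow (c := A * τ) (K := K * τ ^ (1 - q))
    (e := 1 / 2 + 2 * q - β * σ) (by positivity) (by linarith) ?_
  filter_upwards [hev, eventually_gt_atTop 0,
    eventually_two_mul_le_rpow ((le_max_left _ _).trans_lt hβ1)] with N hNA hN hNβ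
  obtain ⟨v, hv, hlow⟩ := hNA.2 N hN
  have hN0 : (0 : ℝ) < N := by exact_mod_cast hN
  have hN1 : (1 : ℝ) ≤ N := by exact_mod_cast hN
  set l := (N : ℝ) ^ β with hl
  set s : ℕ → ℝ := Γ.centre N v with hs
  choose P hP using fun k => exists_schwartz_wavePacket W.contDiff_φ W.tsupport_φ l hN0 (θ (s k))
    (γ (s k))
  -- the phases make up for the fact that the test functions do not travel with the packets
  obtain ⟨g, hg, hle⟩ := hK l N (τ / N) N (fun k => θ (s k)) (fun k => γ (s k))
    (fun k t => Γ.ρ (s k) *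
      (Real.fourierChar (l * (t - 1) * inner ℝ (θ (s k)) (γ (s k))) : ℂ)) P (by linarith) hN0 hNβ
    (by positivity) ((div_le_self hτ.le hN1).trans hτ1) hN (fun k => hθ _)
    (fun k => continuous_const.mul (continuous_fourierChar_coe.comp (by fun_prop)))
    (fun k hk t => by
      rw [norm_mul, Circle.norm_coe, mul_one]
      exact hρ _ (Γ.centre_mem hv hk))
    (fun j hj k hk => Γ.mul_abs_sub_le_norm_centre hv hj hk) hP
  have hsum : ∀ t, ∑ k ∈ Finset.range N, Γ.ρ (s k) * Γ.response l N (1 * (N * (t - 1))) t (s k) =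
      ((N ^ (n + 1) : ℝ) : ℂ) * ∑ k ∈ Finset.range N, Γ.ρ (s k) *
        (Real.fourierChar (l * (t - 1) * inner ℝ (θ (s k)) (γ (s k))) : ℂ) *
        curvePairing γ χ t (g k) (P k) := by
    intro t
    rw [Finset.mul_sum]
    refine Finset.sum_congr rfl fun k _ => ?_
    rw [one_mul, response_eq_fixed W Γ l hN0 t (s k) (hg k) (hP k)]
    ring
  have hfin := le_mul_of_lintegral_le (pow_pos hN0 (n + 1)) (by positivity) hlow hsum hle
  have e0 : A * N * (τ / N) = A * τ := by field_simp
  rw [e0] at hfin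
  refine hfin.trans (le_of_eq ?_)
  rw [← hq, ← Real.rpow_natCast, ← Real.rpow_natCast, ← Real.rpow_neg hN0.le,
    Real.div_rpow hτ.le hN0.le, div_eq_mul_inv (τ ^ (1 - q)), ← Real.rpow_neg hN0.le, hl,
    ← Real.rpow_mul hN0.le, ← Real.rpow_mul hN0.le]
  have e1 : ((N : ℝ) * (N : ℝ) ^ (-(n : ℝ))) ^ q = (N : ℝ) ^ ((1 - n) * q) := by
    rw [Real.rpow_mul hN0.le, sub_eq_add_neg, Real.rpow_add hN0, Real.rpow_one]
  have e2 : (N : ℝ) ^ (1 / 2 + 2 * q - β * σ) = (N : ℝ) ^ ((n + 1 : ℕ) : ℝ) *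
      (N : ℝ) ^ (1 / 2 : ℝ) * (N : ℝ) ^ (β * -σ) *
      (N : ℝ) ^ (-(n : ℝ) * (1 - q)) * (N : ℝ) ^ ((1 - n) * q) * (N : ℝ) ^ (-(1 - q)) := by
    simp only [← Real.rpow_add hN0]
    congr 1
    push_cast; ring
  rw [e1, e2]
  ring

end Spread

/-! ### Construction of the packets and conclusion -/

section Final

variable {n : ℕ}

theorem exists_packetProfile (n : ℕ) : ∃ W : PacketProfile n, Continuous W.Φ ∧ (∀ Z, 0 ≤ W.Φ Z) ∧
    0 < W.Φ 0 ∧ ∃ C, ∀ Z, W.Φ Z ≤ C / (1 + ‖Z‖ ^ 2) := by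
  obtain ⟨η, φ, Φ, h1, h2, h3, h4, h5, h6, h7, h8, h9, h10, h11⟩ :=
    exists_profile (E := EuclideanSpace ℝ (Fin n))
  exact ⟨⟨η, φ, Φ, h1, h2, h3, h4, h5, h6, h11⟩, h7, h8, h9, h10⟩

theorem integral_line_pos {Φ : EuclideanSpace ℝ (Fin n) → ℝ} (hΦ : Continuous Φ)
    (hΦ0 : ∀ Z, 0 ≤ Φ Z) (hΦp : 0 < Φ 0) {C : ℝ} (hC : ∀ Z, Φ Z ≤ C / (1 + ‖Z‖ ^ 2))
    {v : EuclideanSpace ℝ (Fin n)} (hv : v ≠ 0) : 0 < ∫ u : ℝ, Φ (u • v) := by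
  have hc : Continuous fun u : ℝ => Φ (u • v) := by fun_prop
  have hi : Integrable fun u : ℝ => Φ (u • v) := by
    refine ((integrable_profile_bound C (norm_pos_iff.2 hv))).mono' hc.aestronglyMeasurable
      (Eventually.of_forall fun u => ?_)
    rw [Real.norm_of_nonneg (hΦ0 _)]
    refine (hC _).trans (le_of_eq ?_)
    rw [norm_smul, Real.norm_eq_abs, mul_pow, mul_pow, sq_abs]
    ring
  exact integral_pos_of_integrable_nonneg_nonzero (x := 0) hc hi (fun u => hΦ0 _)
    (by simpa using hΦp.ne')

theorem exists_packetArc {γ : ℝ → EuclideanSpace ℝ (Fin n)} (hγ : Continuous γ) {a b : ℝ}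
    (hγs : ∀ s ∈ Ioo a b, HasStrictDerivAt γ (deriv γ s) s) (hγ0 : ∀ s ∈ Ioo a b, deriv γ s ≠ 0)
    (hγc : ContinuousOn (deriv γ) (Ioo a b)) {χ : ℝ → ℝ} (hχ : Continuous χ)
    (hχs : HasCompactSupport χ) (hχab : tsupport χ ⊆ Ioo a b)
    {g : EuclideanSpace ℝ (Fin n) → ℂ} (hg : Continuous g)
    (hμ : ∫ s, g (γ s) * (χ s : ℂ) ≠ 0) {Φ : ℝ → EuclideanSpace ℝ (Fin n) → ℂ}
    (hΦ : ∀ s, Continuous (Φ s)) {C : ℝ} (hΦb : ∀ s Z, ‖Φ s Z‖ ≤ C / (1 + ‖Z‖ ^ 2))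
    (hΦ0 : ∀ s ∈ Ioo a b, ∫ u : ℝ, Φ s (u • deriv γ s) ≠ 0)
    {θ : ℝ → EuclideanSpace ℝ (Fin n)} (hθ : Continuous θ) {B : ℝ}
    (hB : ∀ s₀ ∈ Icc a b, ∀ s ∈ Icc a b, |inner ℝ (θ s₀) (γ s₀ - γ s)| ≤ B * |s - s₀| ^ n) :
    ∃ s₁ ∈ Ioo a b, Nonempty (PacketArc γ χ θ (Φ s₁)) := by
  obtain ⟨s₁, hs₁, c, d, κ, hcd, hsub, hκ, hinj, ρ, G, hρ, hG, hne⟩ :=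
    exists_arc hγ hγs hγ0 hγc hχ hχs hχab hg hμ hΦ hΦb hΦ0
  have hsub' : Icc c d ⊆ Icc a b := hsub.trans Ioo_subset_Icc_self
  refine ⟨s₁, hs₁, ⟨{
    c, d, κ, B, C, ρ, G
    continuous_curve := hγ
    continuous_cutoff := hχ
    hasCompactSupport_cutoff := hχs
    volume_fiber := volume_fiber_eq_zero hχs hγ fun s hs => ?_
    continuous_direction := hθ
    continuous_profile := hΦ s₁
    profile_le := hΦb s₁
    lt := hcd
    κ_pos := hκ
    le_norm_sub := hinj
    hasDerivAt := fun s hs => (hγs s (hsub (Ioo_subset_Icc_self hs))).hasDerivAt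
    abs_inner_le := fun s₀ hs₀ s hs => hB s₀ (hsub' hs₀) s (hsub' hs)
    continuous_weight := hρ
    weight_mul := hG
    integral_ne_zero := hne }⟩⟩
  obtain ⟨δ, hδ, h⟩ := exists_mul_abs_sub_le_norm_sub (hγs s (hχab hs)) (hγ0 s (hχab hs))
  refine ⟨δ, hδ, fun x hx y hy hxy => ?_⟩
  have h1 := h x hx y hy
  rw [hxy, sub_self, norm_zero] at h1
  have h2 : 0 < ‖deriv γ s‖ := norm_pos_iff.2 (hγ0 s (hχab hs))
  have h3 : |x - y| ≤ 0 := by nlinarith [abs_nonneg (x - y)]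
  exact sub_eq_zero.1 (abs_nonpos_iff.1 h3)

end Final

end CurveAverages

open CurveAverages Filter Topology in
theorem theorem1p1 (n : ℕ) (hn : 2 ≤ n) (p : ℝ≥0∞) (hp : 2 ≤ p)
    (a b : ℝ) (hab : a < b) (γ : ℝ → EuclideanSpace ℝ (Fin n))
    (hγ : IsNondegenerateCurve a b γ)
    (χ : ℝ → ℝ) (hχ : ContDiff ℝ ∞ χ) (hχsupp : tsupport χ ⊆ Ioo a b)
    (hμ : ∃ g : EuclideanSpace ℝ (Fin n) → ℂ, Continuous g ∧ curveMeasurePairing γ χ 1 g ≠ 0)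
    (σ : ℝ) (hLS : LocalSmoothingEstimate γ χ p σ) :
    σ ≤ min (1 / (n : ℝ))
      (min (1 / (n : ℝ) * (1 / 2 + (2 / p).toReal)) (2 / p).toReal) := by
  obtain ⟨g, hg, hμ⟩ := hμ
  obtain ⟨θ, hθ, hθ1, ⟨B, hB⟩, hγ0⟩ := exists_unit_normal hab hn hγ
  have hχc : HasCompactSupport χ := isCompact_Icc.of_isClosed_subset (isClosed_tsupport χ)
    (hχsupp.trans Ioo_subset_Icc_self)
  -- only the values of the curve on `[a, b]` matter; extend it continuously to the line
  set γ' : ℝ → EuclideanSpace ℝ (Fin n) := IccExtend hab.le ((Icc a b).domRestrict γ) with hγ'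
  have hγ'c : Continuous γ' :=
    (continuousOn_iff_continuous_domRestrict.1 hγ.1.continuousOn).Icc_extend'
  have heq : ∀ s ∈ Icc a b, γ' s = γ s := fun s hs => IccExtend_of_mem hab.le _ hs
  have hev : ∀ s ∈ Ioo a b, γ' =ᶠ[𝓝 s] γ := fun s hs => by
    filter_upwards [Ioo_mem_nhds hs.1 hs.2] with x hx using heq x (Ioo_subset_Icc_self hx)
  have hsmooth : ∀ s ∈ Ioo a b, ContDiffAt ℝ ∞ γ' s := fun s hs =>
    (hγ.1.contDiffAt (Icc_mem_nhds hs.1 hs.2)).congr_of_eventuallyEq (hev s hs)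
  have hstrict : ∀ s ∈ Ioo a b, HasStrictDerivAt γ' (deriv γ' s) s := fun s hs =>
    (hsmooth s hs).hasStrictDerivAt (by simp)
  have hderiv : ∀ s ∈ Ioo a b, deriv γ' s ≠ 0 := fun s hs => by
    rw [(hev s hs).deriv_eq]; exact (hγ0 s hs).1
  have hderivc : ContinuousOn (deriv γ') (Ioo a b) := by
    have : ContDiffOn ℝ ∞ γ' (Ioo a b) := fun s hs => (hsmooth s hs).contDiffWithinAt
    exact this.continuousOn_deriv_of_isOpen isOpen_Ioo (by simp)
  have hsupp : ∀ s ∈ tsupport χ, γ s = γ' s := fun s hs =>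
    (heq s (Ioo_subset_Icc_self (hχsupp hs))).symm
  have hLS' : LocalSmoothingEstimate γ' χ p σ := by
    obtain ⟨C, hC⟩ := hLS
    refine ⟨C, fun f => ?_⟩
    have := hC f
    simp_rw [curveAverage_congr hsupp] at this
    exact this
  have hμ' : ∫ s, g (γ' s) * (χ s : ℂ) ≠ 0 := by
    convert hμ using 1
    rw [curveMeasurePairing]
    congr 1 with s
    by_cases hs : s ∈ tsupport χ
    · rw [hsupp s hs, one_smul]
    · rw [image_eq_zero_of_notMem_tsupport hs]; simp
  have hB' : ∀ s₀ ∈ Icc a b, ∀ s ∈ Icc a b,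
      |inner ℝ (θ s₀) (γ' s₀ - γ' s)| ≤ B * |s - s₀| ^ n := fun s₀ hs₀ s hs => by
    rw [heq s₀ hs₀, heq s hs]; exact hB s₀ hs₀ s hs
  obtain ⟨W, hΦ, hΦ0, hΦp, C, hΦb⟩ := exists_packetProfile n
  have hnorm : ∀ Z, ‖(W.Φ Z : ℂ)‖ ≤ C / (1 + ‖Z‖ ^ 2) := fun Z => by
    rw [Complex.norm_real, Real.norm_of_nonneg (hΦ0 Z)]; exact hΦb Z
  have hline : ∀ s ∈ Ioo a b, ∫ u : ℝ, (W.Φ (u • deriv γ' s) : ℂ) ≠ 0 := fun s hs => by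
    rw [integral_complex_ofReal]
    exact Complex.ofReal_ne_zero.2 (integral_line_pos hΦ hΦ0 hΦp hΦb (hderiv s hs)).ne'
  obtain ⟨_, -, ⟨Γ⟩⟩ := exists_packetArc hγ'c hstrict hderiv hderivc hχ.continuous hχc hχsupp hg hμ'
    (Φ := fun _ Z => (W.Φ Z : ℂ)) (fun _ => Complex.continuous_ofReal.comp hΦ) (fun _ => hnorm)
    hline hθ hB'
  -- near `s₁` the oscillating profile has a nonzero integral over tangent lines: there is no
  -- oscillation on the line spanned by `γ' s₁`, which is orthogonal to `θ s₁`
  obtain ⟨s₁, -, ⟨Γ'⟩⟩ := exists_packetArc hγ'c hstrict hderiv hderivc hχ.continuous hχc hχsupp hg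
    hμ' (Φ := fun s Z => (Real.fourierChar (2 * inner ℝ (θ s) Z) : ℂ) * (W.Φ Z : ℂ))
    (fun s => (continuous_fourierChar_coe.comp (by fun_prop)).mul
      (Complex.continuous_ofReal.comp hΦ))
    (fun s Z => by rw [norm_mul, Circle.norm_coe, one_mul]; exact hnorm Z)
    (fun s hs => by
      have h0 : inner ℝ (θ s) (deriv γ' s) = 0 := by
        rw [(hev s hs).deriv_eq]; exact (hγ0 s hs).2
      simp only [inner_smul_right, h0, mul_zero, AddChar.map_zero_eq_one, Circle.coe_one, one_mul]
      exact hline s hs)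
    (θ := 0) continuous_const (B := 0) (by simp)
  have hp1 : p⁻¹ ≤ 1 := ENNReal.inv_le_one.2 (le_trans (by norm_num) hp)
  have : p.HolderConjugate (1 - p⁻¹)⁻¹ := by
    rw [ENNReal.holderConjugate_iff, inv_inv, add_tsub_cancel_of_le hp1]
  have h2p : (2 / p).toReal = 2 * p.toReal⁻¹ := by
    rw [ENNReal.toReal_div, ENNReal.toReal_ofNat, div_eq_mul_inv]
  rw [h2p]
  exact le_min (le_one_div_of_localSmoothing W hn Γ hθ1 (p' := (1 - p⁻¹)⁻¹) hp hLS')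
    (le_min (le_mul_of_localSmoothing W hn Γ hθ1 (p' := (1 - p⁻¹)⁻¹) hp hLS')
      (le_two_mul_of_localSmoothing W (hθ1 s₁) Γ' (p' := (1 - p⁻¹)⁻¹) hp hLS'))
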